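/- Let $\mathfrak g$ be $\mathfrak{so}(2n+1)$ or $\mathfrak{sp}(2n)$ with $n\ge 1$, or $\mathfrak{so}(2n)$ with $n\ge 3$; let $N$ be the dimension of the natural representation, $i'=N+1-i$ and $*=\frac{N+1}{2}$. Let $\varepsilon_1,\dots,\varepsilon_n$ be the standard orthonormal basis of $\mathfrak h^*\cong\mathbb C^n$, $\varepsilon_{i'}=-\varepsilon_i$ (so $\varepsilon_*=0$ for $\mathfrak{so}(2n+1)$). The simple roots are $\alpha_a=\varepsilon_a-\varepsilon_{a+1}$ for $a<n$, and $\alpha_n=\varepsilon_n$, $2\varepsilon_n$, $\varepsilon_{n-1}+\varepsilon_n$ for $\mathfrak{so}(2n+1)$, $\mathfrak{sp}(2n)$, $\mathfrak{so}(2n)$ respectively; $\rho$ is the half-sum of the positive roots. Fix $\hbar\in\mathbb C$ such that $q=e^{\hbar}$ is not a root of unity, and put $q^z=e^{\hbar z}$, $\bar q=q^{-1}$, $[z]_q=\frac{q^z-q^{-z}}{q-q^{-1}}$. Let $U_q(\mathfrak g_-)$ be the $\mathbb C$-algebra generated by $e_{-\alpha}$ ($\alpha$ simple) subject to the $q$-Serre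 relations (with $q_\alpha=q^{(\alpha,\alpha)/2}$). Put $f_a=e_{-\alpha_a}$, except $f_n=[\tfrac12]_q e_{-\alpha_n}$ for $\mathfrak{so}(2n+1)$. In the natural representation $\pi$ on $\mathbb C^N$ with basis $w_1,\dots,w_N$ one has $\pi(f_a)=E_{a+1,a}+E_{a',a'-1}$ for $a<n$, and $\pi(f_n)=E_{*,n}+E_{n',*}$, $E_{n'n}$, $E_{n',n-1}+E_{n'+1,n}$ for $\mathfrak{so}(2n+1)$, $\mathfrak{sp}(2n)$, $\mathfrak{so}(2n)$ respectively. Order $[1,N]$ by $i\preccurlyeq j$ iff $w_j\in U_q(\mathfrak g_-)w_i$. With $[x,y]_a=xy-a\,yx$ define $f_{ij}\in U_q(\mathfrak g_-)$ as follows: $f_{ii}=1$, $f_{ij}=0$ for $i>j$; for $i<j\le *$, $$f_{ij}=[f_{j-1},\ldots[f_{i+1},f_i]_{\bar q}\ldots]_{\bar q},\qquad f_{j'i'}=[\ldots[f_i,f_{i+1}]_{\bar q},\ldots f_{j-1}]_{\bar q};$$ and further (with $\delta_{ij}$ the Kronecker symbol) - for $\mathfrak{so}(2n+1)$: $f_{ij'}=q^{\delta_{ij}}[f_{*,j'},f_{i,*}]_{\bar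 q^{\delta_{ij}}}$ for $i,j\le n$; - for $\mathfrak{sp}(2n)$: $f_{nn'}=[2]_qf_n$, $f_{in'}=[f_n,f_{in}]_{\bar q^2}$, $f_{ni'}=[f_{n'i'},f_n]_{\bar q^2}$ for $i<n$, and $f_{ij'}=q^{\delta_{ij}}[f_{nj'},f_{in}]_{\bar q^{1+\delta_{ij}}}$ for $i,j<n$; - for $\mathfrak{so}(2n)$: $f_{nn'}=0$, $f_{n-1,n'}=f_{n,(n-1)'}=f_n$, $f_{in'}=[f_n,f_{i,n-1}]_{\bar q}$, $f_{ni'}=[f_{n'+1,i'},f_n]_{\bar q}$ for $i<n-1$, and $f_{ij'}=q^{\delta_{ij}}[f_{nj'},f_{in}]_{\bar q^{1+\delta_{ij}}}$ for $i,j<n$. Fix $j$. For $l\ne j$ let $y_l=q^{-2\eta_{lj}}$, where $\eta_{lj}=h_{\varepsilon_l}-h_{\varepsilon_j}+(\rho,\varepsilon_l-\varepsilon_j)-\frac12\|\varepsilon_l-\varepsilon_j\|^2$; here $q^{h_\mu}$ ($\mu\in\oplus_{k}\mathbb Z\varepsilon_k$) are the basis elements of the group algebra $\mathcal U$ of the lattice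 $\oplus_{k=1}^n\mathbb Z\varepsilon_k$, regarded as functions $\lambda\mapsto q^{(\lambda,\mu)}$ on $\mathfrak h^*$. Put $A_l=\frac{q-\bar q}{y_l-1}$ and $\bar A_l=A_l^{-1}$. For $a\prec b\preccurlyeq j$ set $$\hat f_{ab}=\sum_{a\prec m_1\prec\dots\prec m_r\prec b}f_{a m_1}f_{m_1m_2}\cdots f_{m_rb}\,A_aA_{m_1}\cdots A_{m_r},\qquad \check f_{ab}=\hat f_{ab}\prod_{a\preccurlyeq l\prec b}\bar A_l,$$ the sum being over all routes, including the empty one $r=0$. Then $\check f_{ab}\in U_q(\mathfrak g_-)\otimes\mathcal U$, an algebra in which the $y_l$ are central; in all products below the same variables $y_l=q^{-2\eta_{lj}}$ (with the fixed $j$) are used. For $\lambda\in\mathfrak h^*$ let $\check f_{ij}(\lambda)\in U_q(\mathfrak g_-)$ denote the value of $\check f_{ij}$ at $\lambda$. Let $s=n$ for $\mathfrak{so}(2n+1)$, $\mathfrak{sp}(2n)$ and $s=n-1$ for $\mathfrak{so}(2n)$; let $\Sigma=[1,s]\cup[s',1']$ and $\Sigma_{ij}=\{k\in\Sigma: i<k<j\}$.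 Let $J_k$ be the two-sided ideal of $U_q(\mathfrak g_-)$ generated by all $f_{lr}$ where $l\prec k\prec r$ are such that $l$ is an immediate predecessor and $r$ an immediate successor of $k$ and the Chevalley generators corresponding to the simple roots $\varepsilon_l-\varepsilon_k$ and $\varepsilon_k-\varepsilon_r$ do not commute. Congruences modulo $J_k$ are understood in $U_q(\mathfrak g_-)\otimes\mathcal U$ modulo $J_k\otimes\mathcal U$. Suppose that $i\prec j$. Then: (i) for all $k\in\Sigma_{ij}$, $\check f_{ij}\equiv\check f_{ik}\check f_{kj}\mod J_k$ and $\check f_{ij}\equiv\check f_{ik}\check f_{kj}\,y_k\mod J_{k'}$; (ii) if $k,k'\in\Sigma_{ij}$ and $k<k'$, then $\check f_{ij}\equiv\check f_{ik}\check f_{kk'}\check f_{k'j}\,y_{k'}\mod J_k$; (iii) if $j<s'$ or $s<i$, then $\check f_{ij}(\lambda)\ne0$ for all $\lambda\in\mathfrak h^*$. -/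

import Mathlib

open scoped TensorProduct

noncomputable section

namespace QReg

/-- The three series of classical Lie algebras: `B` is `so(2n+1)`, `C` is `sp(2n)`, `D` is `so(2n)`. -/
inductive Series
  | B
  | C
  | D

/-- The dimension `N` of the natural representation. -/
def dimN (t : Series) (n : ℕ) : ℕ :=
  match t with
  | .B => 2 * n + 1
  | .C => 2 * n
  | .D => 2 * n

/-- The flip `i' = N + 1 - i` of the interval `[1, N]`. -/
def flip (t : Series) (n i : ℕ) : ℕ := dimN t n + 1 - i

/-- `s = n` for `so(2n+1)`, `sp(2n)`, and `s = n - 1` for `so(2n)`. -/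
def sRank (t : Series) (n : ℕ) : ℕ :=
  match t with
  | .B => n
  | .C => n
  | .D => n - 1

/-! ### Weights and roots

Integral weights are integer vectors in the orthonormal basis `ε_1, …, ε_n`;
nodes of `[1, N]` and simple roots are numbered from `1`. -/

/-- The weight `ε_i` of `w_i`, `1 ≤ i ≤ N`; `ε_{i'} = -ε_i`, and `ε_i = 0` for `i = i'`. -/
def eps (t : Series) (n i : ℕ) : Fin n → ℤ := fun k =>
  (if (k : ℕ) + 1 = i then 1 else 0) - (if (k : ℕ) + 1 = flip t n i then 1 else 0)

/-- The inner product on the weight lattice. -/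
def inn {n : ℕ} (μ ν : Fin n → ℤ) : ℤ := ∑ k, μ k * ν k

/-- The simple roots `α_1, …, α_n`. -/
def simpleRoot (t : Series) (n a : ℕ) : Fin n → ℤ :=
  if a < n then eps t n a - eps t n (a + 1)
  else match t with
    | .B => eps t n n
    | .C => 2 • eps t n n
    | .D => eps t n (n - 1) + eps t n n

/-- `2ρ`, the sum of the positive roots `ε_i - ε_j`, `ε_i + ε_j` (`i < j`) and, in addition,
`ε_i` for `B` and `2 ε_i` for `C`. -/
def twoRho (t : Series) (n : ℕ) : Fin n → ℤ :=
  (∑ p : Fin n × Fin n, if p.1 < p.2 then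
      ((Pi.single p.1 1 - Pi.single p.2 1) + (Pi.single p.1 1 + Pi.single p.2 1)) else 0) +
  match t with
    | .B => ∑ i : Fin n, Pi.single i 1
    | .C => ∑ i : Fin n, Pi.single i 2
    | .D => 0

/-! ### The algebra `U_q(g_-)`

Here `q = exp ħ`, and `q^z = exp (ħ z)` for complex `z`. -/

/-- `q^z`. -/
def qpow (ħ z : ℂ) : ℂ := Complex.exp (ħ * z)

/-- The `q`-number `[z]_q = (q^z - q^{-z}) / (q - q^{-1})`. -/
def qnum (ħ z : ℂ) : ℂ := (qpow ħ z - qpow ħ (-z)) / (qpow ħ 1 - qpow ħ (-1))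

/-- `[m]_q!` -/
def qfact (ħ : ℂ) (m : ℕ) : ℂ := ∏ k ∈ Finset.Icc 1 m, qnum ħ k

/-- The `q`-binomial coefficient. -/
def qbinom (ħ : ℂ) (m k : ℕ) : ℂ := qfact ħ m / (qfact ħ k * qfact ħ (m - k))

/-- The Cartan number `a_{αβ} = 2(α,β)/(α,α)`, `α = α_a`, `β = α_b` (the division is exact). -/
def cartan (t : Series) (n a b : ℕ) : ℤ :=
  2 * inn (simpleRoot t n a) (simpleRoot t n b) / inn (simpleRoot t n a) (simpleRoot t n a)

/-- `ħ_α` with `q_α = exp ħ_α = q^{(α,α)/2}`, `α = α_a`. -/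
def hbarRoot (t : Series) (n : ℕ) (ħ : ℂ) (a : ℕ) : ℂ :=
  ħ * ((inn (simpleRoot t n a) (simpleRoot t n a) : ℤ) : ℂ) / 2

/-- The left-hand side of the `q`-Serre relation for the simple roots `α_{a+1}`, `α_{b+1}`. -/
def serre (t : Series) (n : ℕ) (ħ : ℂ) (a b : Fin n) : FreeAlgebra ℂ (Fin n) :=
  ∑ k ∈ Finset.range ((1 - cartan t n (a + 1) (b + 1)).toNat + 1),
    ((-1) ^ k * qbinom (hbarRoot t n ħ (a + 1)) (1 - cartan t n (a + 1) (b + 1)).toNat k) •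
      (FreeAlgebra.ι ℂ a ^ ((1 - cartan t n (a + 1) (b + 1)).toNat - k) *
        FreeAlgebra.ι ℂ b * FreeAlgebra.ι ℂ a ^ k)

/-- The `q`-Serre relations. -/
inductive SerreRel (t : Series) (n : ℕ) (ħ : ℂ) :
    FreeAlgebra ℂ (Fin n) → FreeAlgebra ℂ (Fin n) → Prop
  | rel (a b : Fin n) (hab : a ≠ b) : SerreRel t n ħ (serre t n ħ a b) 0

/-- `U_q(g_-)`: generators `e_{-α}`, `α` simple, and the `q`-Serre relations. -/
abbrev Uminus (t : Series) (n : ℕ) (ħ : ℂ) : Type := RingQuot (SerreRel t n ħ)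

/-- The generator `e_{-α_a}`, `1 ≤ a ≤ n`. -/
def eNeg (t : Series) (n : ℕ) (ħ : ℂ) (a : ℕ) : Uminus t n ħ :=
  if h : 1 ≤ a ∧ a ≤ n then
    RingQuot.mkAlgHom ℂ (SerreRel t n ħ) (FreeAlgebra.ι ℂ ⟨a - 1, by omega⟩)
  else 0

/-- The Chevalley generator `f_a`, `1 ≤ a ≤ n`: `f_a = e_{-α_a}`, except that
`f_n = [1/2]_q e_{-α_n}` for `so(2n+1)`. -/
def chev (t : Series) (n : ℕ) (ħ : ℂ) (a : ℕ) : Uminus t n ħ :=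
  match t with
  | .B => if a = n then qnum ħ (1 / 2) • eNeg .B n ħ n else eNeg .B n ħ a
  | .C => eNeg .C n ħ a
  | .D => eNeg .D n ħ a

/-! ### The partial order on `[1, N]` -/

/-- The matrix unit `E_{ij}`, `1 ≤ i, j ≤ N`. -/
def unitE (N i j : ℕ) : Matrix (Fin N) (Fin N) ℂ :=
  fun x y => if (x : ℕ) + 1 = i ∧ (y : ℕ) + 1 = j then 1 else 0

/-- The standard basis vector `w_i` of `ℂ^N`, `1 ≤ i ≤ N`. -/
def basisW (N i : ℕ) : Fin N → ℂ := fun x => if (x : ℕ) + 1 = i then 1 else 0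

/-- The matrices `π(f_a)` of the natural representation. -/
def piF (t : Series) (n a : ℕ) : Matrix (Fin (dimN t n)) (Fin (dimN t n)) ℂ :=
  if a < n then
    unitE (dimN t n) (a + 1) a + unitE (dimN t n) (flip t n a) (flip t n a - 1)
  else match t with
    | .B => unitE (dimN .B n) (n + 1) n + unitE (dimN .B n) (flip .B n n) (n + 1)
    | .C => unitE (dimN .C n) (flip .C n n) n
    | .D => unitE (dimN .D n) (flip .D n n) (n - 1) + unitE (dimN .D n) (flip .D n n + 1) n

/-- `i ≼ j`: both are nodes of `[1, N]` and `w_j ∈ U_q(g_-) w_i`. -/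
def Preceq (t : Series) (n i j : ℕ) : Prop :=
  (1 ≤ i ∧ i ≤ dimN t n) ∧ (1 ≤ j ∧ j ≤ dimN t n) ∧
    ∃ X ∈ Algebra.adjoin ℂ {M | ∃ a, 1 ≤ a ∧ a ≤ n ∧ M = piF t n a},
      X.mulVec (basisW (dimN t n) i) = basisW (dimN t n) j

/-- `i ≺ j`. -/
def Prec (t : Series) (n i j : ℕ) : Prop := Preceq t n i j ∧ i ≠ j

/-- `j` is an immediate successor of `i` in the partial order. -/
def Cover (t : Series) (n i j : ℕ) : Prop :=
  Prec t n i j ∧ ∀ m, ¬ (Prec t n i m ∧ Prec t n m j)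

/-! ### The elements `f_{ij}` -/

section entries

variable (t : Series) (n : ℕ) (ħ : ℂ)

/-- The modified commutator `[x, y]_a = x y - a y x`. -/
def qcomm {t : Series} {n : ℕ} {ħ : ℂ} (x y : Uminus t n ħ) (a : ℂ) : Uminus t n ħ :=
  x * y - a • (y * x)

/-- `[f_{i+d}, … [f_{i+1}, f_i]_{q⁻¹} …]_{q⁻¹}`. -/
def lowAux (i : ℕ) : ℕ → Uminus t n ħ
  | 0 => chev t n ħ i
  | d + 1 => qcomm (chev t n ħ (i + d + 1)) (lowAux i d) (qpow ħ (-1))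

/-- `[… [f_i, f_{i+1}]_{q⁻¹}, … f_{i+d}]_{q⁻¹}`. -/
def upAux (i : ℕ) : ℕ → Uminus t n ħ
  | 0 => chev t n ħ i
  | d + 1 => qcomm (upAux i d) (chev t n ħ (i + d + 1)) (qpow ħ (-1))

/-- `f_{ij}` for `i < j ≤ (N+1)/2`. -/
def fLow (i j : ℕ) : Uminus t n ħ := lowAux t n ħ i (j - i - 1)

/-- `f_{j'i'}` for `i < j ≤ (N+1)/2`. -/
def fUp (i j : ℕ) : Uminus t n ħ := upAux t n ħ i (j - i - 1)

/-- `f_{ij'}` for `so(2n+1)` and `i, j ≤ n`. -/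
def fMidB (i j : ℕ) : Uminus .B n ħ :=
  if i = j then qpow ħ 1 • qcomm (fUp .B n ħ j (n + 1)) (fLow .B n ħ i (n + 1)) (qpow ħ (-1))
  else qcomm (fUp .B n ħ j (n + 1)) (fLow .B n ħ i (n + 1)) 1

/-- `f_{ij'}` for `sp(2n)` and `i, j ≤ n`. -/
def fMidC (i j : ℕ) : Uminus .C n ħ :=
  if j = n then
    if i = n then qnum ħ 2 • chev .C n ħ n
    else qcomm (chev .C n ħ n) (fLow .C n ħ i n) (qpow ħ (-2))
  else
    if i = n then qcomm (fUp .C n ħ j n) (chev .C n ħ n) (qpow ħ (-2))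
    else
      if i = j then
        qpow ħ 1 • qcomm (qcomm (fUp .C n ħ j n) (chev .C n ħ n) (qpow ħ (-2)))
          (fLow .C n ħ i n) (qpow ħ (-2))
      else
        qcomm (qcomm (fUp .C n ħ j n) (chev .C n ħ n) (qpow ħ (-2)))
          (fLow .C n ħ i n) (qpow ħ (-1))

/-- `f_{ni'}` for `so(2n)` and `i < n`. -/
def fMidDn (i : ℕ) : Uminus .D n ħ :=
  if i + 1 = n then chev .D n ħ n
  else qcomm (fUp .D n ħ i (n - 1)) (chev .D n ħ n) (qpow ħ (-1))

/-- `f_{ij'}` for `so(2n)` and `i, j ≤ n`. -/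
def fMidD (i j : ℕ) : Uminus .D n ħ :=
  if j = n then
    if i = n then 0
    else if i + 1 = n then chev .D n ħ n
    else qcomm (chev .D n ħ n) (fLow .D n ħ i (n - 1)) (qpow ħ (-1))
  else
    if i = n then fMidDn n ħ j
    else
      if i = j then qpow ħ 1 • qcomm (fMidDn n ħ j) (fLow .D n ħ i n) (qpow ħ (-2))
      else qcomm (fMidDn n ħ j) (fLow .D n ħ i n) (qpow ħ (-1))

/-- `f_{ij'}` for `i, j ≤ n`. -/
def fMid (i j : ℕ) : Uminus t n ħ :=
  match t with
  | .B => fMidB n ħ i j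
  | .C => fMidC n ħ i j
  | .D => fMidD n ħ i j

/-- The elements `f_{ij}`, `1 ≤ i, j ≤ N`.  The conditions `2 j ≤ N + 1` and `N + 1 ≤ 2 i` say
that `j ≤ (N+1)/2` and `i ≥ (N+1)/2`. -/
def fEntry (i j : ℕ) : Uminus t n ħ :=
  if i = j then 1
  else if j < i then 0
  else if 2 * j ≤ dimN t n + 1 then fLow t n ħ i j
  else if dimN t n + 1 ≤ 2 * i then fUp t n ħ (flip t n j) (flip t n i)
  else fMid t n ħ i (flip t n j)

/-- `f_{i,m_1} f_{m_1,m_2} ⋯ f_{m_k,j}` for `m = (m_1, …, m_k)`; it is `f_{ij}` for empty `m`. -/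
def fPath (i : ℕ) (m : List ℕ) (j : ℕ) : Uminus t n ħ :=
  match m with
  | [] => fEntry t n ħ i j
  | a :: l => fEntry t n ħ i a * fPath a l j

end entries

/-! ### Cartan coefficients and the elements `f̂_{ij}`, `f̌_{ij}` -/

/-- The group algebra of the lattice `ℤ ε_1 ⊕ ⋯ ⊕ ℤ ε_n`; the basis element of `μ` is
`q^{h_μ}`. -/
abbrev Uh (n : ℕ) : Type := AddMonoidAlgebra ℂ (Fin n → ℤ)

/-- The field of fractions of `Uh n`. -/
abbrev Kh (n : ℕ) : Type := FractionRing (Uh n)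

/-- Evaluation at `λ ∈ h^* = ℂ^n`: `q^{h_μ} ↦ q^{(λ,μ)}`. -/
def evalChar {n : ℕ} (ħ : ℂ) (lam : Fin n → ℂ) : Uh n →ₐ[ℂ] ℂ :=
  AddMonoidAlgebra.lift ℂ ℂ (Fin n → ℤ)
    { toFun := fun μ => qpow ħ (∑ k, lam k * ((Multiplicative.toAdd μ k : ℤ) : ℂ))
      map_one' := by simp [qpow]
      map_mul' := fun μ ν => by
        simp [qpow, ← Complex.exp_add, mul_add, Finset.sum_add_distrib] }

/-- Evaluation at `λ` of a `U_q(g_-)`-valued function on `h^*`. -/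
def evalAt {t : Series} {n : ℕ} {ħ : ℂ} (lam : Fin n → ℂ) :
    Uh n ⊗[ℂ] Uminus t n ħ →ₗ[ℂ] Uminus t n ħ :=
  TensorProduct.lift
    ((LinearMap.lsmul ℂ (Uminus t n ħ)).comp (evalChar ħ lam).toLinearMap)

section regularization

variable (t : Series) (n : ℕ) (ħ : ℂ)

/-- `y_l = q^{-2 η_{lj}}`, where
`η_{lj} = h_{ε_l} - h_{ε_j} + (ρ, ε_l - ε_j) - ‖ε_l - ε_j‖² / 2`. -/
def yy (j l : ℕ) : Uh n :=
  AddMonoidAlgebra.single ((-2 : ℤ) • (eps t n l - eps t n j))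
    (qpow ħ ((-(inn (twoRho t n) (eps t n l - eps t n j))
      + inn (eps t n l - eps t n j) (eps t n l - eps t n j) : ℤ) : ℂ))

/-- `Ā_l = (y_l - 1) / (q - q⁻¹)`, with `y_l = q^{-2 η_{lj}}`. -/
def Abar (j l : ℕ) : Uh n := (qpow ħ 1 - qpow ħ (-1))⁻¹ • (yy t n ħ j l - 1)

/-- `A_l = (q - q⁻¹) / (y_l - 1)`, with `y_l = q^{-2 η_{lj}}`. -/
def AA (j l : ℕ) : Kh n :=
  algebraMap ℂ (Kh n) (qpow ħ 1 - qpow ħ (-1)) / algebraMap (Uh n) (Kh n) (yy t n ħ j l - 1)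

open Classical in
/-- The (possibly empty) routes `m` with `i ≺ m ≺ j`, as sets of nodes. -/
def routes (i j : ℕ) : Finset (Finset ℕ) :=
  (Finset.Ioo i j).powerset.filter
    fun S => List.IsChain (Prec t n) (i :: (S.sort (· ≤ ·) ++ [j]))

open Classical in
/-- The set of nodes `l` with `i ≼ l ≺ j`. -/
def between (i j : ℕ) : Finset ℕ :=
  (Finset.range (dimN t n + 1)).filter fun l => Preceq t n i l ∧ Prec t n l j

/-- The element `f̂_{ij}` over the field of fractions, written in the variables
`y_l = q^{-2 η_{lb}}`.  The element `f̂_{ij}` proper is the case `b = j`. -/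
def fhat (b i j : ℕ) : Kh n ⊗[ℂ] Uminus t n ħ :=
  if i = j then 1
  else ∑ S ∈ routes t n i j,
    (∏ l ∈ insert i S, AA t n ħ b l) ⊗ₜ fPath t n ħ i (S.sort (· ≤ ·)) j

/-- The natural regularization `f̌_{ij} = f̂_{ij} ∏_{i ≼ l ≺ j} Ā_l`, written in the variables
`y_l = q^{-2 η_{lb}}` and with the common denominator cancelled, see `fcheck_eq`. The element
`f̌_{ij}` proper is the case `b = j`. -/
def fcheck (b i j : ℕ) : Uh n ⊗[ℂ] Uminus t n ħ :=
  if i = j then 1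
  else ∑ S ∈ routes t n i j,
    (∏ l ∈ between t n i j \ insert i S, Abar t n ħ b l) ⊗ₜ fPath t n ħ i (S.sort (· ≤ ·)) j

/-- The set `Σ_{ij} = ]i, j[ ∩ ([1, s] ∪ [s', 1'])`. -/
def SigmaSet (i j : ℕ) : Set ℕ :=
  {k | (i < k ∧ k < j) ∧
    ((1 ≤ k ∧ k ≤ sRank t n) ∨ (flip t n (sRank t n) ≤ k ∧ k ≤ flip t n 1))}

/-- The two-sided ideal `J_k` of `U_q(g_-)` generated by all `f_{lr}`, where `l`, `r` are nearest
nodes to `k` with `l ≺ k ≺ r`, and the Chevalley generators for the simple roots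
`ε_l - ε_k` and `ε_k - ε_r` do not commute. -/
def idealJ (k : ℕ) : TwoSidedIdeal (Uminus t n ħ) :=
  TwoSidedIdeal.span {x | ∃ l r a b : ℕ, Cover t n l k ∧ Cover t n k r ∧
    (1 ≤ a ∧ a ≤ n) ∧ (1 ≤ b ∧ b ≤ n) ∧
    eps t n l - eps t n k = simpleRoot t n a ∧ eps t n k - eps t n r = simpleRoot t n b ∧
    ¬ Commute (chev t n ħ a) (chev t n ħ b) ∧ x = fEntry t n ħ l r}

/-- Congruence modulo the ideal `J_k` extended to scalars in `Uh n`, i.e. modulo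
`Uh n ⊗ J_k`. -/
def CongrJ (k : ℕ) (x y : Uh n ⊗[ℂ] Uminus t n ħ) : Prop :=
  x - y ∈ Submodule.baseChange (Uh n)
    ((TwoSidedIdeal.asIdeal (idealJ t n ħ k)).restrictScalars ℂ)

end regularization

/-! ### The regularization is the product of `f̂_{ij}` and the common denominator -/

theorem Preceq.trans {t : Series} {n i j k : ℕ} (h : Preceq t n i j) (h' : Preceq t n j k) :
    Preceq t n i k := by
  obtain ⟨hi, -, X, hX, hX'⟩ := h
  obtain ⟨-, hk, Y, hY, hY'⟩ := h'
  refine ⟨hi, hk, Y * X, mul_mem hY hX, ?_⟩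
  rw [← Matrix.mulVec_mulVec, hX', hY']

theorem eps_inj {t : Series} {n : ℕ} {j l : ℕ} (hj : 1 ≤ j ∧ j ≤ dimN t n)
    (hl : 1 ≤ l ∧ l ≤ dimN t n) (h : eps t n l = eps t n j) : l = j := by
  have key : ∀ i : ℕ, 1 ≤ i → i ≤ n →
      ((if i = l then (1 : ℤ) else 0) - (if i = flip t n l then 1 else 0)) =
      ((if i = j then 1 else 0) - (if i = flip t n j then 1 else 0)) := by
    intro i h1 h2
    have := congrFun h ⟨i - 1, by omega⟩
    simpa [eps, Nat.sub_add_cancel h1] using this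
  have kl := key l
  have kj := key j
  have kl' := key (flip t n l)
  have kj' := key (flip t n j)
  cases t <;> simp only [flip, dimN] at * <;> grind

theorem yy_ne_one {t : Series} {n : ℕ} (ħ : ℂ) {j l : ℕ} (hj : 1 ≤ j ∧ j ≤ dimN t n)
    (hl : 1 ≤ l ∧ l ≤ dimN t n) (h : l ≠ j) : yy t n ħ j l ≠ 1 := by
  intro e
  have hc : qpow ħ ((-(inn (twoRho t n) (eps t n l - eps t n j))
      + inn (eps t n l - eps t n j) (eps t n l - eps t n j) : ℤ) : ℂ) ≠ 0 := Complex.exp_ne_zero _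
  rw [yy, AddMonoidAlgebra.one_def] at e
  rcases AddMonoidAlgebra.single_inj.1 e with ⟨h1, -⟩ | ⟨h1, -⟩
  · refine h (eps_inj hj hl ?_)
    have : eps t n l - eps t n j = 0 := by
      exact (smul_eq_zero.1 h1).resolve_left (by norm_num)
    exact sub_eq_zero.1 this
  · exact hc h1

theorem q_sub_ne_zero {ħ : ℂ} (hq : ∀ m : ℕ, 0 < m → Complex.exp ħ ^ m ≠ 1) :
    qpow ħ 1 - qpow ħ (-1) ≠ 0 := by
  intro h
  apply hq 2 (by norm_num)
  have h' : Complex.exp ħ = Complex.exp (-ħ) := by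
    simpa [qpow, sub_eq_zero] using h
  rw [sq]
  nth_rewrite 2 [h']
  rw [← Complex.exp_add]
  simp

theorem Abar_mul_AA {t : Series} {n : ℕ} {ħ : ℂ} (hq : ∀ m : ℕ, 0 < m → Complex.exp ħ ^ m ≠ 1)
    {j l : ℕ} (hj : 1 ≤ j ∧ j ≤ dimN t n) (hl : 1 ≤ l ∧ l ≤ dimN t n) (h : l ≠ j) :
    algebraMap (Uh n) (Kh n) (Abar t n ħ j l) * AA t n ħ j l = 1 := by
  have hy : algebraMap (Uh n) (Kh n) (yy t n ħ j l - 1) ≠ 0 := by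
    rw [Ne, IsFractionRing.to_map_eq_zero_iff, sub_eq_zero]
    exact yy_ne_one ħ hj hl h
  have hc := q_sub_ne_zero hq
  have hc' : algebraMap ℂ (Kh n) (qpow ħ 1 - qpow ħ (-1)) ≠ 0 := by
    rwa [Ne, FaithfulSMul.algebraMap_eq_zero_iff]
  rw [Abar, AA, Algebra.smul_def, map_mul, ← IsScalarTower.algebraMap_apply, map_inv₀]
  field_simp

theorem prec_of_isChain {t : Series} {n : ℕ} {i j : ℕ} (L : List ℕ)
    (h : List.IsChain (Prec t n) (i :: (L ++ [j]))) :
    ∀ l ∈ L, Preceq t n i l ∧ Preceq t n l j := by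
  have hp : List.Pairwise (Preceq t n) (i :: (L ++ [j])) := by
    have : IsTrans ℕ (Preceq t n) := ⟨fun _ _ _ => Preceq.trans⟩
    exact List.isChain_iff_pairwise.1 (h.imp fun _ _ hab => hab.1)
  intro l hl
  rw [List.pairwise_cons, List.pairwise_append] at hp
  exact ⟨hp.1 l (by simp [hl]), hp.2.2.2 l hl j (by simp)⟩

/-- `f̌_{ij} = f̂_{ij} ∏_{i ≼ l ≺ j} Ā_l` over the field of fractions. -/
theorem fcheck_eq {t : Series} {n : ℕ} {ħ : ℂ} (hq : ∀ m : ℕ, 0 < m → Complex.exp ħ ^ m ≠ 1)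
    {i j : ℕ} (hij : Prec t n i j) :
    Algebra.TensorProduct.map (IsScalarTower.toAlgHom ℂ (Uh n) (Kh n))
        (AlgHom.id ℂ (Uminus t n ħ)) (fcheck t n ħ j i j) =
      (∏ l ∈ between t n i j, algebraMap (Uh n) (Kh n) (Abar t n ħ j l)) • fhat t n ħ j i j := by
  classical
  rw [fcheck, fhat, if_neg hij.2, if_neg hij.2, map_sum, Finset.smul_sum]
  refine Finset.sum_congr rfl fun S hS => ?_
  rw [Algebra.TensorProduct.map_tmul, TensorProduct.smul_tmul']
  congr 1
  have hS' := Finset.mem_filter.1 hS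
  have hsub : insert i S ⊆ between t n i j := by
    intro l hl
    rcases Finset.mem_insert.1 hl with rfl | hl
    · have := hij.1.1
      refine Finset.mem_filter.2 ⟨Finset.mem_range.2 (by omega), ⟨this, this, 1, one_mem _, ?_⟩, hij⟩
      simp
    · have h1 := prec_of_isChain _ hS'.2 l (by simpa using hl)
      have h2 := Finset.mem_Ioo.1 (Finset.mem_powerset.1 hS'.1 hl)
      have h3 := h1.2.1
      exact Finset.mem_filter.2 ⟨Finset.mem_range.2 (by omega), h1.1, h1.2, by omega⟩
  rw [← Finset.prod_sdiff hsub, smul_eq_mul, mul_assoc, ← Finset.prod_mul_distrib]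
  rw [Finset.prod_congr (s₁ := insert i S) rfl (g := fun _ => (1 : Kh n))]
  · simp
  · intro l hl
    have h1 := (Finset.mem_filter.1 (hsub hl)).2
    exact Abar_mul_AA hq hij.1.2.1 h1.1.2.1 h1.2.2

end QReg
end

/-!
The congruences come from relations between the elements `f_{lr}` alone. Modulo `J_k` all `f_{lr}`
with `l ≺ k ≺ r` vanish, and modulo `J_{k'}` they satisfy
`f_{lr} ≡ (q - q⁻¹) f_{lk} f_{kr}` (`fEntry_factors`). Since `k` is comparable with all nodes, the
routes from `i` to `j` come in pairs, with and without `k` (`sum_routes`). If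
`f_{lr} ≡ c f_{lk} f_{kr}` for all `l ≺ k ≺ r`, then the route without `k` contributes `c Ā_k`
times the contribution of the route with `k`, so that
`f̌_{ij} ≡ (1 + c Ā_k) f̌_{ik} f̌_{kj}` (`fcheck_factor`). The coefficient is `1` for `c = 0` and
`y_k` for `c = q - q⁻¹`. The congruence for a pair `k, k'` follows by applying the first
factorization at `k` and the second one at `k'`.

The relations for `f_{lr}` are proved in the quotient algebra. The vanishing of the generators of
the ideal says that two adjacent Chevalley generators, `f_{k-1}` and `f_k`, commute up to a scalar.
For `k ≤ s`, the scalar `a` in `f_k f_{k-1} = a f_{k-1} f_k` is `q⁻¹` for `J_k` and `q` for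
`J_{k'}`, or the square of that if `k = n` for `sp(2n)`. The element `f_{lr}` is an iterated
commutator, and such a commutator splits at any inner place into the commutator of two parts
(`chainLow_split`). The two parts behave like forms of degree one in the generators that they
contain (`Multihomog`), so they inherit the commutation scalar, and the commutator either vanishes
or becomes a multiple of the product (`chainLow_factor`). Only for `k = n` in `sp(2n)` do the Serre
relations of adjacent generators enter: they imply that the commutators
`[… [f_r, f_{r+1}], … f_{n-1}]` and `[f_{n-1}, … [f_{l+1}, f_l] …]` commute up to a scalar
(`SerreChain.skew_up_low`).

For the non-vanishing, if `j < s'` or `s < i`, then the nodes between `i` and `j` form a chain,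
which corresponds to a linear part of the Dynkin diagram. On the functions of finite sets
there are operators `shiftOp u p` with `Y_p² = 0`, `Y_p Y_{p+1} = u Y_{p+1} Y_p`, which commute for
distant `p`; they define representations of `U_q(g_-)` (`exists_shift_rep`). With `u = q^{±1}`
all `f_{lr}` of this part vanish except those of immediate neighbors, and iterating `fcheck_factor`
with the kernel of the representation as the ideal, `f̌_{ij}(λ)` acts as a product of distinct
shift operators, whatever `λ` is. This product is not zero (`evalAt_fcheck_ne_zero_of_rep`).
-/

noncomputable section

namespace QReg

/-! ### Iterated `c`-commutators -/

section generic

variable {A : Type*} [Ring A] [Algebra ℂ A]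

/-- The iterated commutator `[x_{i+d}, … [x_{i+1}, x_i]_c …]_c` in an arbitrary algebra. -/
def chainLow (c : ℂ) (x : ℕ → A) (i : ℕ) : ℕ → A
  | 0 => x i
  | d + 1 => x (i + d + 1) * chainLow c x i d - c • (chainLow c x i d * x (i + d + 1))

/-- The iterated commutator `[… [x_i, x_{i+1}]_c, … x_{i+d}]_c` in an arbitrary algebra. -/
def chainUp (c : ℂ) (x : ℕ → A) (i : ℕ) : ℕ → A
  | 0 => x i
  | d + 1 => chainUp c x i d * x (i + d + 1) - c • (x (i + d + 1) * chainUp c x i d)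

theorem op_chainUp (c : ℂ) (x : ℕ → A) (i d : ℕ) :
    MulOpposite.op (chainUp c x i d) = chainLow c (fun a => MulOpposite.op (x a)) i d := by
  induction d with
  | zero => rfl
  | succ d ih => simp [chainUp, chainLow, ← ih]

theorem chainLow_congr (c : ℂ) {x y : ℕ → A} {i d : ℕ} (h : ∀ a, i ≤ a → a ≤ i + d → x a = y a) :
    chainLow c x i d = chainLow c y i d := by
  induction d with
  | zero => exact h _ le_rfl le_rfl
  | succ d ih =>
    rw [chainLow, chainLow, ih fun a h1 h2 => h a h1 (by omega), h _ (by omega) (by omega)]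

theorem chainUp_congr (c : ℂ) {x y : ℕ → A} {i d : ℕ} (h : ∀ a, i ≤ a → a ≤ i + d → x a = y a) :
    chainUp c x i d = chainUp c y i d := by
  induction d with
  | zero => exact h _ le_rfl le_rfl
  | succ d ih =>
    rw [chainUp, chainUp, ih fun a h1 h2 => h a h1 (by omega), h _ (by omega) (by omega)]

/-- `z` behaves like a form of degree one in each of `x_i, …, x_{i+d}`: an element that commutes
with every `x_a` up to a scalar factor commutes with `z` up to the product of the factors. -/
def Multihomog (x : ℕ → A) (i d : ℕ) (z : A) : Prop :=
  ∀ (y : A) (w : ℕ → ℂ), (∀ a, i ≤ a → a ≤ i + d → y * x a = w a • (x a * y)) →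
    y * z = (∏ a ∈ Finset.Icc i (i + d), w a) • (z * y)

theorem skew_mul {y u v : A} {a b : ℂ} (h1 : y * u = a • (u * y)) (h2 : y * v = b • (v * y)) :
    y * (u * v) = (a * b) • (u * v * y) := by
  rw [← mul_assoc, h1, smul_mul_assoc, mul_assoc, h2, mul_smul_comm, smul_smul, mul_assoc]

theorem skew_qcomm {y u v : A} {a b : ℂ} (c : ℂ) (h1 : y * u = a • (u * y))
    (h2 : y * v = b • (v * y)) :
    y * (u * v - c • (v * u)) = (a * b) • ((u * v - c • (v * u)) * y) := by
  rw [mul_sub, mul_smul_comm, skew_mul h1 h2, skew_mul h2 h1, sub_mul, smul_sub, smul_mul_assoc,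
    smul_comm c, mul_comm b a]

theorem skew_symm {y z : A} {c : ℂ} (hc : c ≠ 0) (h : y * z = c • (z * y)) :
    z * y = c⁻¹ • (y * z) := by
  rw [h, inv_smul_smul₀ hc]

theorem multihomog_chainLow (c : ℂ) (x : ℕ → A) (i d : ℕ) :
    Multihomog x i d (chainLow c x i d) := by
  intro y w h
  induction d with
  | zero => simpa [chainLow] using h i le_rfl le_rfl
  | succ d ih =>
    rw [← add_assoc, ← Finset.insert_Icc_right_eq_Icc_add_one (by omega),
      Finset.prod_insert (by simp)]
    exact skew_qcomm c (h _ (by omega) (by omega)) (ih fun a h1 h2 => h a h1 (by omega))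

theorem multihomog_chainUp (c : ℂ) (x : ℕ → A) (i d : ℕ) :
    Multihomog x i d (chainUp c x i d) := by
  intro y w h
  induction d with
  | zero => simpa [chainUp] using h i le_rfl le_rfl
  | succ d ih =>
    rw [← add_assoc, ← Finset.insert_Icc_right_eq_Icc_add_one (by omega),
      Finset.prod_insert (by simp), mul_comm (w _)]
    exact skew_qcomm c (ih fun a h1 h2 => h a h1 (by omega)) (h _ (by omega) (by omega))

theorem Multihomog.skew {x : ℕ → A} {i d : ℕ} {y z : A} (hz : Multihomog x i d z) (m : ℕ) (c : ℂ)
    (hm : i ≤ m ∧ m ≤ i + d) (h : y * x m = c • (x m * y))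
    (h' : ∀ a, i ≤ a → a ≤ i + d → a ≠ m → Commute y (x a)) : y * z = c • (z * y) := by
  have := hz y (fun a => if a = m then c else 1) (by
    intro a h1 h2
    by_cases ha : a = m
    · simpa [ha] using h
    · simpa [ha] using (h' a h1 h2 ha).eq)
  rwa [Finset.prod_ite_eq' , if_pos (by simpa using hm)] at this

theorem Multihomog.commute {x : ℕ → A} {i d : ℕ} {y z : A} (hz : Multihomog x i d z)
    (h' : ∀ a, i ≤ a → a ≤ i + d → Commute y (x a)) : Commute y z := by
  have := hz y (fun _ => 1) (by
    intro a h1 h2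
    simpa using (h' a h1 h2).eq)
  simpa [Commute, SemiconjBy] using this

/-- If `x_k x_{k-1} = c x_{k-1} x_k` is the only non-trivial commutation between two adjacent
segments, then forms of degree one in the variables of the segments satisfy the same relation. -/
theorem Multihomog.skew_adjacent {x : ℕ → A} {i d k e : ℕ} {y z : A} {c : ℂ} (hc : c ≠ 0)
    (hk : k = i + d + 1) (hy : Multihomog x i d y) (hz : Multihomog x k e z)
    (hrel : x k * x (k - 1) = c • (x (k - 1) * x k))
    (hcomm : ∀ a b, i ≤ a → b ≤ k + e → a + 2 ≤ b → Commute (x a) (x b)) :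
    z * y = c • (y * z) := by
  have h1 : x k * y = c • (y * x k) :=
    hy.skew (k - 1) c (by omega) hrel fun a h1 h2 h3 =>
      (hcomm a k h1 (by omega) (by omega)).symm
  have h2 : y * z = c⁻¹ • (z * y) :=
    hz.skew k c⁻¹ (by omega) (skew_symm hc h1) fun b h3 h4 h5 =>
      (hy.commute fun a h6 h7 => (hcomm a b h6 h4 (by omega)).symm).symm
  simpa using skew_symm (inv_ne_zero hc) h2

/-- The commutator of a segment is the `c`-commutator of those of its two parts; only the
commutation of distant variables is needed. -/
theorem chainLow_split (c : ℂ) {x : ℕ → A} {i d k e : ℕ} (hk : k = i + d + 1)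
    (hcomm : ∀ a b, i ≤ a → b ≤ k + e → a + 2 ≤ b → Commute (x a) (x b)) :
    chainLow c x i (d + e + 1) =
      chainLow c x k e * chainLow c x i d - c • (chainLow c x i d * chainLow c x k e) := by
  subst hk
  induction e with
  | zero => rfl
  | succ e ih =>
    rw [show d + (e + 1) + 1 = (d + e + 1) + 1 by ring, chainLow,
      ih fun a b h1 h2 h3 => hcomm a b h1 (by omega) h3, chainLow]
    have h : Commute (x (i + (d + e + 1) + 1)) (chainLow c x i d) :=
      (multihomog_chainLow c x i d).commute fun a h1 h2 =>
        (hcomm a _ h1 (by omega) (by omega)).symm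
    rw [show i + (d + e + 1) + 1 = i + d + 1 + e + 1 by ring] at *
    set X := chainLow c x i d
    set Y := chainLow c x (i + d + 1) e
    set u := x (i + d + 1 + e + 1)
    have e1 : u * (X * Y) = X * (u * Y) := by rw [← mul_assoc, h.eq, mul_assoc]
    have e2 : Y * X * u = Y * u * X := by rw [mul_assoc, ← h.eq, mul_assoc]
    simp only [mul_sub, sub_mul, smul_sub, mul_smul_comm, smul_mul_assoc, e1, e2]
    simp only [mul_assoc]
    abel

theorem chainUp_split (c : ℂ) {x : ℕ → A} {i d k e : ℕ} (hk : k = i + d + 1)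
    (hcomm : ∀ a b, i ≤ a → b ≤ k + e → a + 2 ≤ b → Commute (x a) (x b)) :
    chainUp c x i (d + e + 1) =
      chainUp c x i d * chainUp c x k e - c • (chainUp c x k e * chainUp c x i d) := by
  apply MulOpposite.op_injective
  have := chainLow_split c (x := fun a => MulOpposite.op (x a)) (e := e) hk
    fun a b h1 h2 h3 => (hcomm a b h1 h2 h3).op
  simpa [op_chainUp] using this

/-- `[x_{j-1}, … [x_{i+1}, x_i]_c …]_c` factorizes at `k` if the variables skew-commute there. -/
theorem chainLow_factor (c b : ℂ) {x : ℕ → A} {i k j : ℕ} (hik : i < k) (hkj : k < j) (hb : b ≠ 0)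
    (hrel : x k * x (k - 1) = b • (x (k - 1) * x k))
    (hcomm : ∀ a b, i ≤ a → b < j → a + 2 ≤ b → Commute (x a) (x b)) :
    chainLow c x i (j - i - 1) =
      (b - c) • (chainLow c x i (k - i - 1) * chainLow c x k (j - k - 1)) := by
  have hc' : ∀ a b, i ≤ a → b ≤ k + (j - k - 1) → a + 2 ≤ b → Commute (x a) (x b) :=
    fun a b h1 h2 h3 => hcomm a b h1 (by omega) h3
  rw [show j - i - 1 = (k - i - 1) + (j - k - 1) + 1 by omega,
    chainLow_split c (k := k) (by omega) hc',
    (multihomog_chainLow c x i (k - i - 1)).skew_adjacent hb (by omega)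
      (multihomog_chainLow c x k (j - k - 1)) hrel hc', sub_smul]

theorem chainUp_factor (c b : ℂ) {x : ℕ → A} {i k j : ℕ} (hik : i < k) (hkj : k < j) (hb : b ≠ 0)
    (hrel : x (k - 1) * x k = b • (x k * x (k - 1)))
    (hcomm : ∀ a b, i ≤ a → b < j → a + 2 ≤ b → Commute (x a) (x b)) :
    chainUp c x i (j - i - 1) =
      (b - c) • (chainUp c x k (j - k - 1) * chainUp c x i (k - i - 1)) := by
  apply MulOpposite.op_injective
  have := chainLow_factor c b (x := fun a => MulOpposite.op (x a)) hik hkj hb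
    (by simpa using congrArg MulOpposite.op hrel)
    fun a b h1 h2 h3 => (hcomm a b h1 h2 h3).op
  simpa [op_chainUp] using this

/-! ### Consequences of a single quantum Serre relation -/

theorem commute_qcomm {y u v : A} (c : ℂ) (h1 : Commute y u) (h2 : Commute y v) :
    Commute y (u * v - c • (v * u)) :=
  (h1.mul_right h2).sub_right ((h2.mul_right h1).smul_right c)

/-- The middle variable commutes with the triple `q`-commutator. -/
theorem serre_middle {c : ℂ} (hc : c ≠ 0) (hc2 : c + c⁻¹ ≠ 0) {a y b : A}
    (hy : a * a * y - (c + c⁻¹) • (a * y * a) + y * a * a = 0)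
    (hb : a * a * b - (c + c⁻¹) • (a * b * a) + b * a * a = 0) (hyb : Commute y b) :
    Commute a ((y * a - c • (a * y)) * b - c • (b * (y * a - c • (a * y)))) := by
  have e1 : a * a * y * b - (c + c⁻¹) • (a * y * a * b) + y * a * a * b = 0 := by
    simpa only [sub_mul, add_mul, smul_mul_assoc, zero_mul] using congrArg (· * b) hy
  have e2 : b * a * a * y - (c + c⁻¹) • (b * a * y * a) + b * y * a * a = 0 := by
    simpa only [mul_sub, mul_add, mul_smul_comm, mul_zero, mul_assoc] using congrArg (b * ·) hy
  have e3 : y * a * a * b - (c + c⁻¹) • (y * a * b * a) + b * y * a * a = 0 := by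
    rw [← hyb.eq]
    simpa only [mul_sub, mul_add, mul_smul_comm, mul_zero, mul_assoc] using congrArg (y * ·) hb
  have e4 : a * a * y * b - (c + c⁻¹) • (a * b * a * y) + b * a * a * y = 0 := by
    rw [mul_assoc (a * a) y b, hyb.eq]
    simpa only [sub_mul, add_mul, smul_mul_assoc, zero_mul, mul_assoc] using congrArg (· * y) hb
  have e5 : a * y * b * a = a * b * y * a := by rw [mul_assoc a y b, hyb.eq, ← mul_assoc]
  have hc3 : c ^ 2 + 1 ≠ 0 := by
    intro h
    apply hc2
    field_simp
    linear_combination h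
  rw [Commute, SemiconjBy]
  simp only [mul_sub, sub_mul, smul_sub, mul_smul_comm, smul_mul_assoc, ← mul_assoc, e5]
  linear_combination (norm := skip) (-(c + c⁻¹)⁻¹) • e1 + (c ^ 2 * (c + c⁻¹)⁻¹) • e2 +
    ((c + c⁻¹)⁻¹) • e3 + (-c ^ 2 * (c + c⁻¹)⁻¹) • e4
  match_scalars <;> field_simp <;> ring

/-- With the Serre relation, `a` and the `c`-commutator `[a, b]_c` commute up to a scalar. -/
theorem serre_skew {c : ℂ} (hc : c ≠ 0) {a b : A}
    (hb : a * a * b - (c + c⁻¹) • (a * b * a) + b * a * a = 0) :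
    a * (a * b - c • (b * a)) = c⁻¹ • ((a * b - c • (b * a)) * a) := by
  simp only [mul_sub, sub_mul, smul_sub, mul_smul_comm, smul_mul_assoc, ← mul_assoc, smul_smul,
    inv_mul_cancel₀ hc]
  linear_combination (norm := module) hb

theorem serre_skew' {c : ℂ} (hc : c ≠ 0) {a b : A}
    (hb : a * a * b - (c + c⁻¹) • (a * b * a) + b * a * a = 0) :
    a * (b * a - c • (a * b)) = c • ((b * a - c • (a * b)) * a) := by
  simp only [mul_sub, sub_mul, smul_sub, mul_smul_comm, smul_mul_assoc, ← mul_assoc, smul_smul]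
  have := congrArg (c • ·) hb
  simp only [smul_sub, smul_add, smul_smul, mul_add, mul_inv_cancel₀ hc, smul_zero] at this
  linear_combination (norm := module) (-1 : ℂ) • this

end generic

/-! ### Commutators of a sequence with Serre relations of type `A` -/

section serreChain

variable {A : Type*} [Ring A] [Algebra ℂ A]

/-- The sequence `x_i, …, x_m` satisfies the quantum Serre relations of type `A`, where
`c` is the inverse of the deformation parameter. -/
structure SerreChain (c : ℂ) (x : ℕ → A) (i m : ℕ) : Prop where
  comm : ∀ a b, i ≤ a → b ≤ m → a + 2 ≤ b → Commute (x a) (x b)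
  serre : ∀ a b, i ≤ a → i ≤ b → a ≤ m → b ≤ m → (a + 1 = b ∨ b + 1 = a) →
    x a * x a * x b - (c + c⁻¹) • (x a * x b * x a) + x b * x a * x a = 0

variable {c : ℂ} {x : ℕ → A} {i m : ℕ}

theorem SerreChain.mono (h : SerreChain c x i m) {i' m' : ℕ} (hi : i ≤ i') (hm : m' ≤ m) :
    SerreChain c x i' m' where
  comm a b h1 h2 h3 := h.comm a b (by omega) (by omega) h3
  serre a b h1 h2 h3 h4 h5 := h.serre a b (by omega) (by omega) (by omega) (by omega) h5

theorem SerreChain.op (h : SerreChain c x i m) :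
    SerreChain c (fun a => MulOpposite.op (x a)) i m where
  comm a b h1 h2 h3 := (h.comm a b h1 h2 h3).op
  serre a b h1 h2 h3 h4 h5 := by
    have := congrArg MulOpposite.op (h.serre a b h1 h2 h3 h4 h5)
    simp only [MulOpposite.op_add, MulOpposite.op_sub, MulOpposite.op_mul, MulOpposite.op_smul,
      MulOpposite.op_zero, ← mul_assoc] at this
    rw [← this]
    abel

/-- The first variable commutes with the commutator of the segment up to the factor `c⁻¹`. -/
theorem SerreChain.skew_first {d : ℕ} (h : SerreChain c x i (i + d + 1)) (hc : c ≠ 0) :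
    x i * chainUp c x i (d + 1) = c⁻¹ • (chainUp c x i (d + 1) * x i) := by
  induction d with
  | zero => exact serre_skew hc (h.serre i (i + 1) le_rfl (by omega) (by omega) le_rfl (.inl rfl))
  | succ d ih =>
    rw [chainUp]
    have := skew_qcomm c (ih (h.mono le_rfl (by omega)))
      (show x i * x (i + (d + 1) + 1) = (1 : ℂ) • (x (i + (d + 1) + 1) * x i) by
        rw [one_smul]; exact h.comm _ _ le_rfl le_rfl (by omega))
    simpa only [mul_one] using this

/-- The last variable commutes with the commutator of the segment up to the factor `c`. -/
theorem SerreChain.skew_last {d : ℕ} (h : SerreChain c x i (i + d + 1)) (hc : c ≠ 0) :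
    x (i + d + 1) * chainUp c x i (d + 1) = c • (chainUp c x i (d + 1) * x (i + d + 1)) := by
  have key : x (i + d + 1) * chainUp c x (i + d) 1 = c • (chainUp c x (i + d) 1 * x (i + d + 1)) :=
    serre_skew' hc
      (h.serre (i + d + 1) (i + d) (by omega) (by omega) le_rfl (by omega) (.inr rfl))
  cases d with
  | zero => exact key
  | succ d =>
    rw [chainUp_split c (k := i + d + 1) rfl fun a b h1 h2 h3 => h.comm a b h1 (by omega) h3]
    have h1 : x (i + (d + 1) + 1) * chainUp c x i d =
        (1 : ℂ) • (chainUp c x i d * x (i + (d + 1) + 1)) := by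
      rw [one_smul]
      exact (multihomog_chainUp c x i d).commute fun a h1 h2 =>
        (h.comm _ _ h1 le_rfl (by omega)).symm
    have := skew_qcomm c h1 key
    rwa [one_mul] at this

/-- An inner variable commutes with the commutator of the whole segment. -/
theorem SerreChain.commute_inner {d l : ℕ} (h : SerreChain c x i (i + d)) (hc : c ≠ 0)
    (hc2 : c + c⁻¹ ≠ 0) (h1 : i < l) (h2 : l < i + d) : Commute (x l) (chainUp c x i d) := by
  -- the segment of three variables around `x_l`
  have h3 : Commute (x l) (chainUp c x (l - 1) 2) := by
    obtain ⟨l, rfl⟩ : ∃ l', l = l' + 1 := ⟨l - 1, by omega⟩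
    rw [Nat.add_sub_cancel]
    exact serre_middle hc hc2
      (h.serre (l + 1) l (by omega) (by omega) (by omega) (by omega) (.inr rfl))
      (h.serre (l + 1) (l + 1 + 1) (by omega) (by omega) (by omega) (by omega) (.inl rfl))
      (h.comm l (l + 1 + 1) (by omega) (by omega) le_rfl)
  have h4 : ∀ e, l + 1 + e ≤ i + d → Commute (x l) (chainUp c x (l - 1) (2 + e)) := by
    intro e he
    induction e with
    | zero => exact h3
    | succ e ih =>
      exact commute_qcomm c (ih (by omega))
        (h.comm l (l - 1 + (2 + e) + 1) (by omega) (by omega) (by omega))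
  obtain ⟨e, he⟩ : ∃ e, d = (l - 1 - i) + (2 + e) := ⟨d - (l - 1 - i) - 2, by omega⟩
  rcases Nat.eq_zero_or_pos (l - 1 - i) with h5 | h5
  · obtain rfl : i = l - 1 := by omega
    rw [he, h5, zero_add]
    exact h4 _ (by omega)
  · rw [show d = (l - 2 - i) + (2 + e) + 1 by omega,
      chainUp_split c (k := l - 1) (by omega) fun a b h1 h2 h3 => h.comm a b h1 (by omega) h3]
    exact commute_qcomm c ((multihomog_chainUp c x i _).commute fun a h6 h7 =>
      (h.comm a l h6 (by omega) (by omega)).symm) (h4 e (by omega))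

theorem op_chainLow (c : ℂ) (x : ℕ → A) (i d : ℕ) :
    MulOpposite.op (chainLow c x i d) = chainUp c (fun a => MulOpposite.op (x a)) i d := by
  induction d with
  | zero => rfl
  | succ d ih => simp [chainUp, chainLow, ← ih]

/-- The two `q`-commutators of one and the same segment commute. -/
theorem SerreChain.commute_up_low {d : ℕ} (h : SerreChain c x i (i + d)) (hc : c ≠ 0)
    (hc2 : c + c⁻¹ ≠ 0) : Commute (chainUp c x i d) (chainLow c x i d) := by
  cases d with
  | zero => exact Commute.refl _
  | succ d =>
    have h1 : chainUp c x i (d + 1) * chainLow c x i d =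
        c • (chainLow c x i d * chainUp c x i (d + 1)) :=
      (multihomog_chainLow c x i d).skew i c (by omega)
        (by simpa using skew_symm (inv_ne_zero hc) (h.skew_first hc))
        fun a h2 h3 h4 => (h.commute_inner hc hc2 (by omega) (by omega)).symm
    have h2 := skew_qcomm c (skew_symm hc (h.skew_last hc)) h1
    rwa [inv_mul_cancel₀ hc, one_smul] at h2

theorem SerreChain.skew_up_low_of_lt {j : ℕ} (h : SerreChain c x i m) (hc : c ≠ 0)
    (hc2 : c + c⁻¹ ≠ 0) (hij : i < j) (hj : j ≤ m) :
    chainUp c x i (m - i) * chainLow c x j (m - j) =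
      c⁻¹ • (chainLow c x j (m - j) * chainUp c x i (m - i)) := by
  obtain ⟨d, rfl⟩ : ∃ d, m = i + d + 1 := ⟨m - i - 1, by omega⟩
  rw [show i + d + 1 - i = d + 1 by omega]
  exact (multihomog_chainLow c x j _).skew (i + d + 1) c⁻¹ (by omega)
    (skew_symm hc (h.skew_last hc))
    fun a h2 h3 h4 => (h.commute_inner hc hc2 (by omega) (by omega)).symm

/-- Two commutators of opposite nesting over segments with a common right end commute up to a
scalar. The case `l < r` is reduced to `r < l` by passing to the opposite algebra. -/
theorem SerreChain.skew_up_low {l r : ℕ} (h : SerreChain c x i m) (hc : c ≠ 0)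
    (hc2 : c + c⁻¹ ≠ 0) (hl : i ≤ l) (hr : i ≤ r) (hlm : l ≤ m) (hrm : r ≤ m) :
    chainUp c x r (m - r) * chainLow c x l (m - l) =
      (if l = r then 1 else c⁻¹) • (chainLow c x l (m - l) * chainUp c x r (m - r)) := by
  rcases lt_trichotomy l r with h1 | rfl | h1
  · rw [if_neg h1.ne]
    apply MulOpposite.op_injective
    have := (h.op.mono hl le_rfl).skew_up_low_of_lt hc hc2 h1 hrm
    simpa only [← op_chainUp, ← op_chainLow, ← MulOpposite.op_mul, ← MulOpposite.op_smul]
      using this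
  · rw [if_pos rfl, one_smul]
    have := h.mono hl (show l + (m - l) ≤ m by omega)
    exact this.commute_up_low hc hc2
  · rw [if_neg h1.ne']
    exact (h.mono hr le_rfl).skew_up_low_of_lt hc hc2 h1 hlm

end serreChain

/-! ### Inner products of simple roots -/

section roots

variable {t : Series} {n : ℕ}

theorem inn_add_left {n : ℕ} (a b c : Fin n → ℤ) : inn (a + b) c = inn a c + inn b c := by
  simp [inn, add_mul, Finset.sum_add_distrib]

theorem inn_comm {n : ℕ} (a b : Fin n → ℤ) : inn a b = inn b a := by
  simp [inn, mul_comm]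

theorem inn_add_right {n : ℕ} (a b c : Fin n → ℤ) : inn a (b + c) = inn a b + inn a c := by
  rw [inn_comm, inn_add_left, inn_comm b, inn_comm c]

theorem inn_neg_left {n : ℕ} (a c : Fin n → ℤ) : inn (-a) c = -inn a c := by
  simp [inn]

theorem inn_sub_left {n : ℕ} (a b c : Fin n → ℤ) : inn (a - b) c = inn a c - inn b c := by
  rw [sub_eq_add_neg, inn_add_left, inn_neg_left, sub_eq_add_neg]

theorem inn_sub_right {n : ℕ} (a b c : Fin n → ℤ) : inn a (b - c) = inn a b - inn a c := by
  rw [inn_comm, inn_sub_left, inn_comm b, inn_comm c]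

theorem le_flip {i : ℕ} (h : i ≤ n) : n < flip t n i := by
  cases t <;> simp only [flip, dimN] <;> omega

theorem inn_eps {i j : ℕ} (hi : 1 ≤ i) (hin : i ≤ n) (hjn : j ≤ n) :
    inn (eps t n i) (eps t n j) = if i = j then 1 else 0 := by
  have h1 : ∀ k : Fin n, ∀ i, i ≤ n → eps t n i k = if (k : ℕ) + 1 = i then 1 else 0 := by
    intro k i h
    have := le_flip (t := t) h
    rw [eps, if_neg (show ¬ (k : ℕ) + 1 = flip t n i by omega), sub_zero]
  simp only [inn, h1 _ _ hin, h1 _ _ hjn]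
  rw [Finset.sum_eq_single ⟨i - 1, by omega⟩]
  · simp [Nat.sub_add_cancel hi]
  · intro b _ hb
    rw [if_neg, zero_mul]
    intro h
    exact hb (Fin.ext (by simp; omega))
  · simp

theorem inn_simpleRoot_eq_zero {a b : ℕ} (ha : 1 ≤ a) (hb : b ≤ n) (hab : a + 2 ≤ b)
    (hD : t = .D → b = n → a + 2 < n) : inn (simpleRoot t n a) (simpleRoot t n b) = 0 := by
  have hm : ∀ i j, 1 ≤ i → i ≤ n → j ≤ n →
    inn (eps t n i) (eps t n j) = if i = j then 1 else 0 := fun i j => inn_eps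
  rw [simpleRoot.eq_def, if_pos (by omega), simpleRoot.eq_def]
  split_ifs with h
  · simp (disch := omega) only [inn_sub_left, inn_sub_right, hm]
    grind
  · cases t
    · simp (disch := omega) only [inn_sub_left, hm]
      grind
    · simp (disch := omega) only [two_smul, inn_sub_left, inn_add_right, hm]
      grind
    · simp (disch := omega) only [inn_sub_left, inn_add_right, hm]
      grind

theorem inn_simpleRoot_last_D (hn : 3 ≤ n) :
    inn (simpleRoot .D n (n - 1)) (simpleRoot .D n n) = 0 := by
  have hm : ∀ i j, 1 ≤ i → i ≤ n → j ≤ n →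
    inn (eps .D n i) (eps .D n j) = if i = j then 1 else 0 := fun i j => inn_eps
  rw [simpleRoot.eq_def, if_pos (by omega), simpleRoot.eq_def, if_neg (by omega),
    Nat.sub_add_cancel (by omega)]
  simp (disch := omega) only [inn_sub_left, inn_add_right, hm]
  grind

theorem inn_simpleRoot_fork_D (hn : 3 ≤ n) :
    inn (simpleRoot .D n (n - 2)) (simpleRoot .D n n) < 0 := by
  have hm : ∀ i j, 1 ≤ i → i ≤ n → j ≤ n →
    inn (eps .D n i) (eps .D n j) = if i = j then 1 else 0 := fun i j => inn_eps
  rw [simpleRoot.eq_def, if_pos (by omega), simpleRoot.eq_def, if_neg (by omega),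
    show n - 2 + 1 = n - 1 by omega]
  simp (disch := omega) only [inn_sub_left, inn_add_right, hm]
  grind

theorem inn_simpleRoot_adjacent {a : ℕ} (ha : 1 ≤ a) (hb : a + 1 ≤ n)
    (hD : t = .D → a + 1 < n) : inn (simpleRoot t n a) (simpleRoot t n (a + 1)) < 0 := by
  have hm : ∀ i j, 1 ≤ i → i ≤ n → j ≤ n →
    inn (eps t n i) (eps t n j) = if i = j then 1 else 0 := fun i j => inn_eps
  rw [simpleRoot.eq_def, if_pos (by omega), simpleRoot.eq_def]
  split_ifs with h
  · simp (disch := omega) only [inn_sub_left, inn_sub_right, hm]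
    grind
  · obtain rfl : n = a + 1 := by omega
    cases t
    · simp (disch := omega) only [inn_sub_left, hm]
      grind
    · simp (disch := omega) only [two_smul, inn_sub_left, inn_add_right, hm]
      grind
    · simp at hD

theorem inn_simpleRoot_self_pos {a : ℕ} (ha : 1 ≤ a) (hb : a ≤ n) (hD : t = .D → 3 ≤ n) :
    0 < inn (simpleRoot t n a) (simpleRoot t n a) := by
  have hm : ∀ i j, 1 ≤ i → i ≤ n → j ≤ n →
    inn (eps t n i) (eps t n j) = if i = j then 1 else 0 := fun i j => inn_eps
  rw [simpleRoot.eq_def]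
  split_ifs with h
  · simp (disch := omega) only [inn_sub_left, inn_sub_right, hm]
    grind
  · cases t
    · simp (disch := omega) only [hm]
      grind
    · simp (disch := omega) only [two_smul, inn_add_left, inn_add_right, hm]
      grind
    · have := hD rfl
      simp (disch := omega) only [inn_add_left, inn_add_right, hm]
      grind

theorem inn_simpleRoot_self {a : ℕ} (ha : 1 ≤ a) (hb : a < n) :
    inn (simpleRoot t n a) (simpleRoot t n a) = 2 := by
  have hm : ∀ i j, 1 ≤ i → i ≤ n → j ≤ n →
    inn (eps t n i) (eps t n j) = if i = j then 1 else 0 := fun i j => inn_eps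
  rw [simpleRoot.eq_def, if_pos hb]
  simp (disch := omega) only [inn_sub_left, inn_sub_right, hm]
  grind

theorem inn_simpleRoot_next {a : ℕ} (ha : 1 ≤ a) (hb : a + 1 < n) :
    inn (simpleRoot t n a) (simpleRoot t n (a + 1)) = -1 := by
  have hm : ∀ i j, 1 ≤ i → i ≤ n → j ≤ n →
    inn (eps t n i) (eps t n j) = if i = j then 1 else 0 := fun i j => inn_eps
  rw [simpleRoot.eq_def, if_pos (by omega), simpleRoot.eq_def, if_pos hb]
  simp (disch := omega) only [inn_sub_left, inn_sub_right, hm]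
  grind

theorem eps_flip {i : ℕ} (hi : i ≤ dimN t n) :
    eps t n (flip t n i) = -eps t n i := by
  have : flip t n (flip t n i) = i := by simp only [flip]; omega
  ext k
  simp [eps, this]

end roots

/-! ### The `q`-numbers -/

section qnumbers

theorem qpow_add (ħ a b : ℂ) : qpow ħ (a + b) = qpow ħ a * qpow ħ b := by
  simp [qpow, mul_add, Complex.exp_add]

theorem qpow_zero (ħ : ℂ) : qpow ħ 0 = 1 := by simp [qpow]

theorem qpow_ne_zero (ħ a : ℂ) : qpow ħ a ≠ 0 := Complex.exp_ne_zero _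

theorem qpow_neg (ħ a : ℂ) : qpow ħ (-a) = (qpow ħ a)⁻¹ := by
  simp [qpow, Complex.exp_neg]

theorem qpow_two (ħ : ℂ) : qpow ħ 2 = qpow ħ 1 ^ 2 := by
  rw [show (2 : ℂ) = 1 + 1 by norm_num, qpow_add, sq]

variable {ħ : ℂ} (hq : ∀ m : ℕ, 0 < m → Complex.exp ħ ^ m ≠ 1)
include hq

theorem qpow_one_pow_ne {m : ℕ} (hm : 0 < m) : qpow ħ 1 ^ m ≠ 1 := by
  simpa [qpow] using hq m hm

theorem qpow_add_inv_ne_zero : qpow ħ 1 + (qpow ħ 1)⁻¹ ≠ 0 := by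
  intro h
  have h0 := qpow_ne_zero ħ 1
  field_simp at h
  apply qpow_one_pow_ne hq (m := 4) (by norm_num)
  linear_combination (qpow ħ 1 ^ 2 - 1) * h

theorem qnum_half_ne_zero : qnum ħ (1 / 2) ≠ 0 := by
  rw [qnum]
  refine div_ne_zero ?_ (q_sub_ne_zero hq)
  intro h
  apply qpow_one_pow_ne hq (m := 1) (by norm_num)
  rw [pow_one, show (1 : ℂ) = 1 / 2 + 1 / 2 by norm_num, qpow_add]
  nth_rewrite 1 [sub_eq_zero.1 h]
  rw [← qpow_add, neg_add_cancel, qpow_zero]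
  norm_num

theorem qnum_two : qnum ħ 2 = qpow ħ 1 + (qpow ħ 1)⁻¹ := by
  have h0 := qpow_ne_zero ħ 1
  rw [qnum, div_eq_iff (q_sub_ne_zero hq), qpow_neg, qpow_neg, qpow_two]
  field_simp
  ring

end qnumbers

theorem qnum_one {h : ℂ} (hh : qpow h 1 - qpow h (-1) ≠ 0) : qnum h 1 = 1 := div_self hh

theorem qbinom_one {h : ℂ} (hh : qpow h 1 - qpow h (-1) ≠ 0) :
    qbinom h 1 0 = 1 ∧ qbinom h 1 1 = 1 := by
  simp [qbinom, qfact, qnum_one hh]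

/-! ### Relations between the Chevalley generators -/

section relations

variable {t : Series} {n : ℕ} {ħ : ℂ}

/-- The defining relations of `U_q(g_-)` in terms of the generators. -/
theorem serre_eNeg (a b : Fin n) (hab : a ≠ b) :
    ∑ k ∈ Finset.range ((1 - cartan t n (a + 1) (b + 1)).toNat + 1),
    ((-1) ^ k * qbinom (hbarRoot t n ħ (a + 1)) (1 - cartan t n (a + 1) (b + 1)).toNat k) •
      (eNeg t n ħ (a + 1) ^ ((1 - cartan t n (a + 1) (b + 1)).toNat - k) *
        eNeg t n ħ (b + 1) * eNeg t n ħ (a + 1) ^ k) = 0 := by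
  have h := RingQuot.mkAlgHom_rel ℂ (SerreRel.rel (t := t) (ħ := ħ) a b hab)
  have e : ∀ a : Fin n, eNeg t n ħ (a + 1) =
      RingQuot.mkAlgHom ℂ (SerreRel t n ħ) (FreeAlgebra.ι ℂ a) := by
    intro a
    rw [eNeg, dif_pos ⟨by omega, by omega⟩]
    rfl
  simp only [e]
  simpa only [serre, map_sum, map_smul, map_mul, map_pow, map_zero] using h

theorem serre_eNeg' {a b : ℕ} (ha : 1 ≤ a) (han : a ≤ n) (hb : 1 ≤ b) (hbn : b ≤ n) (hab : a ≠ b)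
    {m : ℕ} (hm : (1 - cartan t n a b).toNat = m) :
    ∑ k ∈ Finset.range (m + 1), ((-1) ^ k * qbinom (hbarRoot t n ħ a) m k) •
      (eNeg t n ħ a ^ (m - k) * eNeg t n ħ b * eNeg t n ħ a ^ k) = 0 := by
  have := serre_eNeg (t := t) (n := n) (ħ := ħ) ⟨a - 1, by omega⟩ ⟨b - 1, by omega⟩
    (by simp; omega)
  simp only [Nat.sub_add_cancel ha, Nat.sub_add_cancel hb, hm] at this
  exact this

/-- The parameter `q_α` is not a square root of `1`, so that `[1]_{q_α} = 1`. -/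
theorem hbarRoot_ne (hq : ∀ m : ℕ, 0 < m → Complex.exp ħ ^ m ≠ 1) {a : ℕ} (ha : 1 ≤ a)
    (han : a ≤ n) (hD : t = .D → 3 ≤ n) :
    qpow (hbarRoot t n ħ a) 1 - qpow (hbarRoot t n ħ a) (-1) ≠ 0 := by
  apply q_sub_ne_zero
  intro m hm h
  have hp := inn_simpleRoot_self_pos ha han hD
  obtain ⟨N, hN⟩ := Int.eq_ofNat_of_zero_le hp.le
  apply hq (N * m) (Nat.mul_pos (by omega) hm)
  have h2 : Complex.exp (hbarRoot t n ħ a) ^ 2 = Complex.exp ħ ^ N := by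
    rw [← Complex.exp_nat_mul, ← Complex.exp_nat_mul, hbarRoot, hN]
    congr 1
    push_cast
    ring
  rw [pow_mul, ← h2, ← pow_mul, mul_comm, pow_mul, h, one_pow]

theorem commute_eNeg (hq : ∀ m : ℕ, 0 < m → Complex.exp ħ ^ m ≠ 1) (hD : t = .D → 3 ≤ n)
    {a b : ℕ} (ha : 1 ≤ a) (han : a ≤ n) (hb : 1 ≤ b) (hbn : b ≤ n) (hab : a ≠ b)
    (h : inn (simpleRoot t n a) (simpleRoot t n b) = 0) :
    Commute (eNeg t n ħ a) (eNeg t n ħ b) := by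
  have h1 := serre_eNeg' (t := t) (ħ := ħ) ha han hb hbn hab (m := 1) (by simp [cartan, h])
  obtain ⟨h2, h3⟩ := qbinom_one (hbarRoot_ne hq ha han hD)
  simp [Finset.sum_range_succ, h2, h3] at h1
  refine sub_eq_zero.1 (Eq.trans ?_ h1)
  module

/-- The Chevalley generators `f_a` differ from `e_{-α_a}` by invertible factors. -/
theorem chev_eq (hq : ∀ m : ℕ, 0 < m → Complex.exp ħ ^ m ≠ 1) (a : ℕ) :
    ∃ s : ℂ, s ≠ 0 ∧ chev t n ħ a = s • eNeg t n ħ a := by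
  cases t
  · by_cases h : a = n
    · exact ⟨qnum ħ (1 / 2), qnum_half_ne_zero hq, by simp only [chev, h, if_true]⟩
    · exact ⟨1, one_ne_zero, by simp only [chev, h, if_false, one_smul]⟩
  · exact ⟨1, one_ne_zero, (one_smul _ _).symm⟩
  · exact ⟨1, one_ne_zero, (one_smul _ _).symm⟩

theorem commute_chev (hq : ∀ m : ℕ, 0 < m → Complex.exp ħ ^ m ≠ 1) (hD : t = .D → 3 ≤ n)
    {a b : ℕ} (ha : 1 ≤ a) (hb : b ≤ n) (hab : a < b)
    (h : inn (simpleRoot t n a) (simpleRoot t n b) = 0) :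
    Commute (chev t n ħ a) (chev t n ħ b) := by
  obtain ⟨s, -, hs⟩ := chev_eq (t := t) (n := n) hq a
  obtain ⟨s', -, hs'⟩ := chev_eq (t := t) (n := n) hq b
  rw [hs, hs']
  exact ((commute_eNeg hq hD ha (by omega) (by omega) hb (by omega) h).smul_left s).smul_right s'

/-- For `sp(2n)`, the generators `f_1, …, f_{n-1}` of the subalgebra of type `A`. -/
theorem serreChain_C (hq : ∀ m : ℕ, 0 < m → Complex.exp ħ ^ m ≠ 1) :
    SerreChain (qpow ħ (-1)) (chev .C n ħ) 1 (n - 1) where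
  comm a b h1 h2 h3 := commute_chev hq (by simp) h1 (by omega) (by omega)
    (inn_simpleRoot_eq_zero h1 (by omega) h3 (by simp))
  serre a b h1 h2 h3 h4 h5 := by
    have hc : cartan .C n a b = -1 := by
      rw [cartan, inn_simpleRoot_self h1 (by omega)]
      rcases h5 with rfl | rfl
      · rw [inn_simpleRoot_next h1 (by omega)]
        rfl
      · rw [inn_comm, inn_simpleRoot_next h2 (by omega)]
        rfl
    have hh : hbarRoot .C n ħ a = ħ := by
      rw [hbarRoot, inn_simpleRoot_self h1 (by omega)]
      push_cast
      ring
    have h6 := serre_eNeg' (t := .C) (n := n) (ħ := ħ) h1 (by omega) h2 (by omega) (by omega)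
      (m := 2) (by rw [hc]; rfl)
    rw [hh] at h6
    have h7 : qnum ħ 1 = 1 := qnum_one (q_sub_ne_zero hq)
    have h8 := qpow_add_inv_ne_zero hq
    have h9 : qfact ħ 2 = qpow ħ 1 + (qpow ħ 1)⁻¹ := by
      rw [← qnum_two hq, qfact, Finset.prod_Icc_succ_top (by norm_num)]
      simp [h7]
    have h10 : qfact ħ 1 = 1 := by simp [qfact, h7]
    have h11 : qfact ħ 0 = 1 := by simp [qfact]
    simp [Finset.sum_range_succ, qbinom, h9, h10, h11, div_self h8] at h6
    rw [qpow_neg, inv_inv, add_comm (qpow ħ 1)⁻¹, chev, chev, ← h6]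
    simp only [sq, mul_assoc]
    module

end relations

/-! ### The explicit form of the partial order -/

section order

variable {t : Series} {n : ℕ}

/-- The explicit form of the partial order: the natural order of `[1, N]`, except that the two
middle nodes `n`, `n'` are incomparable for `D`. -/
def NodeLE (t : Series) (n i j : ℕ) : Prop :=
  i = j ∨ (i < j ∧ ¬ (t = .D ∧ i = n ∧ j = n + 1))

theorem NodeLE.trans {i j k : ℕ} (h : NodeLE t n i j) (h' : NodeLE t n j k) : NodeLE t n i k := by
  unfold NodeLE at *
  grind

theorem unitE_nodeLE {N r c : ℕ} (h : NodeLE t n c r) {x y : Fin N} (hxy : unitE N r c x y ≠ 0) :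
    NodeLE t n (y + 1) (x + 1) := by
  rw [unitE] at hxy
  split_ifs at hxy with h1
  · rwa [h1.1, h1.2]
  · exact absurd rfl hxy

theorem piF_nodeLE (hD : t = .D → 3 ≤ n) {a : ℕ} (ha : 1 ≤ a) (han : a ≤ n)
    {x y : Fin (dimN t n)} (hxy : piF t n a x y ≠ 0) : NodeLE t n (y + 1) (x + 1) := by
  have key : ∀ {N r c r' c' : ℕ} {x y : Fin N}, NodeLE t n c r → NodeLE t n c' r' →
      (unitE N r c + unitE N r' c') x y ≠ 0 → NodeLE t n (y + 1) (x + 1) := by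
    intro N r c r' c' x y h h' hxy
    by_cases h0 : unitE N r c x y = 0
    · refine unitE_nodeLE h' (x := x) (y := y) fun h1 => hxy ?_
      rw [Matrix.add_apply, h0, h1, add_zero]
    · exact unitE_nodeLE h h0
  rw [piF.eq_def] at hxy
  split_ifs at hxy with h
  · refine key ?_ ?_ hxy
    · exact .inr (by omega)
    · cases t <;> simp only [flip, dimN] <;> exact .inr (by grind)
  · cases t
    · exact key (.inr (by simp)) (.inr (by simp only [flip, dimN]; grind)) hxy
    · exact unitE_nodeLE (.inr (by simp only [flip, dimN]; grind)) hxy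
    · have := hD rfl
      exact key (.inr (by simp only [flip, dimN]; grind))
        (.inr (by simp only [flip, dimN]; grind)) hxy

/-- The matrices of the natural representation are triangular with respect to `NodeLE`. -/
theorem nodeLE_of_mem_adjoin (hD : t = .D → 3 ≤ n)
    {X : Matrix (Fin (dimN t n)) (Fin (dimN t n)) ℂ}
    (hX : X ∈ Algebra.adjoin ℂ {M | ∃ a, 1 ≤ a ∧ a ≤ n ∧ M = piF t n a}) :
    ∀ x y, X x y ≠ 0 → NodeLE t n (y + 1) (x + 1) := by
  induction hX using Algebra.adjoin_induction with
  | mem M h =>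
    obtain ⟨a, h1, h2, rfl⟩ := h
    exact fun x y => piF_nodeLE hD h1 h2
  | algebraMap r =>
    intro x y h
    by_cases hxy : x = y
    · exact .inl (by rw [hxy])
    · rw [Matrix.algebraMap_matrix_apply, if_neg hxy] at h
      exact absurd rfl h
  | add M M' _ _ h h' =>
    intro x y hxy
    by_cases h0 : M x y = 0
    · refine h' x y fun h1 => hxy ?_
      rw [Matrix.add_apply, h0, h1, add_zero]
    · exact h x y h0
  | mul M M' _ _ h h' =>
    intro x y hxy
    rw [Matrix.mul_apply] at hxy
    obtain ⟨z, -, hz⟩ := Finset.exists_ne_zero_of_sum_ne_zero hxy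
    exact (h' z y (right_ne_zero_of_mul hz)).trans (h x z (left_ne_zero_of_mul hz))

theorem unitE_mulVec {N r c i : ℕ} (hi : 1 ≤ i ∧ i ≤ N) :
    (unitE N r c).mulVec (basisW N i) = if c = i then basisW N r else 0 := by
  ext x
  rw [Matrix.mulVec, dotProduct, Finset.sum_eq_single ⟨i - 1, by omega⟩]
  · simp only [unitE, basisW, Nat.sub_add_cancel hi.1]
    by_cases h : c = i
    · simp [h, basisW]
    · simp [h, Ne.symm h]
  · intro y _ hy
    rw [basisW, if_neg, mul_zero]
    intro h
    exact hy (Fin.ext (by simp; omega))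
  · simp

theorem Preceq.of_piF {i j : ℕ} (hi : 1 ≤ i ∧ i ≤ dimN t n) (hj : 1 ≤ j ∧ j ≤ dimN t n)
    (a : ℕ) (ha : 1 ≤ a ∧ a ≤ n)
    (h : (piF t n a).mulVec (basisW (dimN t n) i) = basisW (dimN t n) j) : Preceq t n i j :=
  ⟨hi, hj, _, Algebra.subset_adjoin ⟨a, ha.1, ha.2, rfl⟩, h⟩

theorem preceq_succ (hD : t = .D → 3 ≤ n) {i : ℕ} (hi : 1 ≤ i) (hiN : i < dimN t n)
    (h : ¬ (t = .D ∧ i = n)) : Preceq t n i (i + 1) := by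
  have hi' : 1 ≤ i ∧ i ≤ dimN t n := ⟨hi, hiN.le⟩
  rcases lt_or_ge i n with h1 | h1
  · refine .of_piF hi' (by omega) i (by omega) ?_
    rw [piF.eq_def, if_pos h1, Matrix.add_mulVec, unitE_mulVec hi', unitE_mulVec hi', if_pos rfl,
      if_neg, add_zero]
    cases t <;> simp only [flip, dimN] at * <;> omega
  by_cases h2 : dimN t n - i < n
  · refine .of_piF hi' (by omega) (dimN t n - i) (by omega) ?_
    rw [piF.eq_def, if_pos h2, Matrix.add_mulVec, unitE_mulVec hi', unitE_mulVec hi', if_neg,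
      if_pos, zero_add]
    · congr 1
      simp only [flip]
      omega
    · simp only [flip]
      omega
    · cases t <;> simp only [dimN] at * <;> omega
  · refine .of_piF hi' (by omega) n (by cases t <;> simp only [dimN] at * <;> omega) ?_
    rw [piF.eq_def, if_neg (lt_irrefl _)]
    cases t
    · simp only [dimN] at hiN h2
      simp only [Matrix.add_mulVec, unitE_mulVec hi']
      rcases (show i = n ∨ i = n + 1 by omega) with rfl | rfl
      · simp
      · rw [if_neg (by omega), if_pos rfl, zero_add]
        congr 1
        simp only [flip, dimN]
        omega
    · simp only [dimN] at hiN h2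
      simp only [unitE_mulVec hi']
      rw [if_pos (by omega)]
      congr 1
      simp only [flip, dimN]
      omega
    · simp only [dimN] at hiN h2
      exact absurd ⟨rfl, by omega⟩ h

/-- The two steps around the middle nodes, which the last Chevalley generator makes. -/
theorem preceq_fork (hn : 3 ≤ n) : Preceq .D n (n - 1) (n + 1) ∧ Preceq .D n n (n + 2) := by
  constructor
  · have h : 1 ≤ n - 1 ∧ n - 1 ≤ dimN .D n := by simp only [dimN]; omega
    refine .of_piF h (by simp only [dimN]; omega) n (by omega) ?_
    rw [piF.eq_def, if_neg (lt_irrefl _)]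
    simp only [Matrix.add_mulVec, unitE_mulVec h]
    rw [if_pos trivial, if_neg (by omega), add_zero]
    congr 1
    simp only [flip, dimN]
    omega
  · have h : 1 ≤ n ∧ n ≤ dimN .D n := by simp only [dimN]; omega
    refine .of_piF h (by simp only [dimN]; omega) n (by omega) ?_
    rw [piF.eq_def, if_neg (lt_irrefl _)]
    simp only [Matrix.add_mulVec, unitE_mulVec h]
    rw [if_neg (by omega), zero_add, if_true]
    congr 1
    simp only [flip, dimN]
    omega

theorem preceq_refl {i : ℕ} (hi : 1 ≤ i ∧ i ≤ dimN t n) : Preceq t n i i :=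
  ⟨hi, hi, 1, one_mem _, by simp⟩

theorem preceq_of_lt (hD : t = .D → 3 ≤ n) {i j : ℕ} (hi : 1 ≤ i) (hj : j ≤ dimN t n)
    (hij : i < j) (h : ¬ (t = .D ∧ i = n ∧ j = n + 1)) : Preceq t n i j := by
  induction j using Nat.strong_induction_on with
  | _ j ih =>
    rcases Nat.lt_or_ge (i + 1) j with h1 | h1
    · by_cases h2 : t = .D ∧ j = n + 1
      · obtain ⟨rfl, rfl⟩ := h2
        have h3 := hD rfl
        rcases Nat.lt_or_ge i (n - 1) with h4 | h4
        · exact (ih (n - 1) (by omega) (by simp only [dimN]; omega) h4 (by omega)).trans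
            (preceq_fork h3).1
        · obtain rfl : i = n - 1 := by omega
          exact (preceq_fork h3).1
      · by_cases h5 : t = .D ∧ i = n ∧ j = n + 2
        · obtain ⟨rfl, rfl, rfl⟩ := h5
          exact (preceq_fork (hD rfl)).2
        · refine (ih (j - 1) (by omega) (by omega) (by omega) (by grind)).trans ?_
          have := preceq_succ hD (i := j - 1) (by omega) (by omega) (by grind)
          rwa [Nat.sub_add_cancel (by omega)] at this
    · obtain rfl : j = i + 1 := by omega
      exact preceq_succ hD hi (by omega) (by grind)

theorem preceq_iff (hD : t = .D → 3 ≤ n) {i j : ℕ} :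
    Preceq t n i j ↔ 1 ≤ i ∧ j ≤ dimN t n ∧ NodeLE t n i j := by
  constructor
  · rintro ⟨hi, hj, X, hX, h⟩
    refine ⟨hi.1, hj.2, ?_⟩
    have h1 := congrFun h ⟨j - 1, by omega⟩
    rw [Matrix.mulVec, dotProduct, Finset.sum_eq_single ⟨i - 1, by omega⟩] at h1
    · simp only [basisW, Nat.sub_add_cancel hi.1, Nat.sub_add_cancel hj.1, if_true, mul_one] at h1
      have h2 := nodeLE_of_mem_adjoin hD hX ⟨j - 1, by omega⟩ ⟨i - 1, by omega⟩ (by simp [h1])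
      simpa only [Nat.sub_add_cancel hi.1, Nat.sub_add_cancel hj.1] using h2
    · intro y _ hy
      rw [basisW, if_neg, mul_zero]
      intro h
      exact hy (Fin.ext (by simp; omega))
    · simp
  · rintro ⟨hi, hj, rfl | ⟨h1, h2⟩⟩
    · exact preceq_refl ⟨hi, hj⟩
    · exact preceq_of_lt hD hi hj h1 h2

theorem prec_iff (hD : t = .D → 3 ≤ n) {i j : ℕ} :
    Prec t n i j ↔ 1 ≤ i ∧ j ≤ dimN t n ∧ i < j ∧ ¬ (t = .D ∧ i = n ∧ j = n + 1) := by
  rw [Prec, preceq_iff hD, NodeLE]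
  grind

theorem cover_of (hD : t = .D → 3 ≤ n) {i j : ℕ} (h : Prec t n i j)
    (h' : j ≤ i + 1 ∨ (t = .D ∧ i + 1 = n ∧ j = n + 1) ∨ (t = .D ∧ i = n ∧ j = n + 2)) :
    Cover t n i j := by
  refine ⟨h, fun m => ?_⟩
  simp only [prec_iff hD] at *
  grind

end order

/-! ### Representations by shift operators -/

section rep

/-- Operators `Y_p` on functions of finite sets with `Y_p² = 0` and
`Y_p Y_{p+1} = u Y_{p+1} Y_p`, which commute otherwise: `Y_p` removes `p` from the argument. -/
def shiftOp (u : ℂ) (p : ℕ) : Module.End ℂ (Finset ℕ → ℂ) where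
  toFun g T := if p ∈ T then (if p + 1 ∈ T then u else 1) * g (T.erase p) else 0
  map_add' g h := by
    ext T
    simp only [Pi.add_apply]
    split_ifs <;> ring
  map_smul' s g := by
    ext T
    simp only [Pi.smul_apply, smul_eq_mul, RingHom.id_apply]
    split_ifs <;> ring

theorem shiftOp_apply (u : ℂ) (p : ℕ) (g : Finset ℕ → ℂ) (T : Finset ℕ) :
    shiftOp u p g T = if p ∈ T then (if p + 1 ∈ T then u else 1) * g (T.erase p) else 0 := rfl

theorem shiftOp_sq (u : ℂ) (p : ℕ) : shiftOp u p * shiftOp u p = 0 := by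
  ext g T
  simp [shiftOp_apply]

theorem shiftOp_aba (u : ℂ) (p r : ℕ) : shiftOp u p * shiftOp u r * shiftOp u p = 0 := by
  ext g T
  simp [shiftOp_apply]

theorem shiftOp_commute (u : ℂ) {p r : ℕ} (h : p + 2 ≤ r) :
    Commute (shiftOp u p) (shiftOp u r) := by
  refine LinearMap.ext fun g => funext fun T => ?_
  simp only [Module.End.mul_apply, shiftOp_apply, Finset.mem_erase,
    Finset.erase_right_comm (a := p)]
  have h1 : r ≠ p := by omega
  have h2 : r + 1 ≠ p := by omega
  have h3 : p + 1 ≠ r := by omega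
  simp only [h1, h2, h1.symm, h3, ne_eq, not_false_eq_true, true_and]
  split_ifs <;> ring

theorem shiftOp_skew (u : ℂ) (p : ℕ) :
    shiftOp u p * shiftOp u (p + 1) = u • (shiftOp u (p + 1) * shiftOp u p) := by
  refine LinearMap.ext fun g => funext fun T => ?_
  simp only [LinearMap.smul_apply, Pi.smul_apply, Module.End.mul_apply, shiftOp_apply,
    Finset.mem_erase, Finset.erase_right_comm (a := p)]
  have h2 : p + 1 + 1 ≠ p := by omega
  simp
  split_ifs <;> simp_all

theorem shiftOp_not_commute {u s s' : ℂ} (hu : u ≠ 1) (hs : s ≠ 0) (hs' : s' ≠ 0) (p : ℕ) :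
    ¬ Commute (s • shiftOp u p) (s' • shiftOp u (p + 1)) := by
  intro h
  have h1 := congrFun (congrArg (fun f : Module.End ℂ (Finset ℕ → ℂ) => f fun _ => 1) h.eq)
    {p, p + 1}
  simp [shiftOp_apply, Finset.mem_erase] at h1
  grind

variable {t : Series} {n : ℕ} {ħ : ℂ}

/-- If `g_a² = 0` and `g_a g_b g_a = 0`, then every monomial of a Serre relation of degree at
least two in `e_{-α_a}` vanishes, so the relations reduce to the commutation of orthogonal
generators. -/
theorem exists_algHom_of_nilpotent {A : Type*} [Ring A] [Algebra ℂ A]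
    (hq : ∀ m : ℕ, 0 < m → Complex.exp ħ ^ m ≠ 1) (hD : t = .D → 3 ≤ n) (g : ℕ → A)
    (hsq : ∀ a, g a * g a = 0) (haba : ∀ a b, g a * g b * g a = 0)
    (h : ∀ a b, 1 ≤ a → a < b → b ≤ n → inn (simpleRoot t n a) (simpleRoot t n b) < 0 ∨
      (inn (simpleRoot t n a) (simpleRoot t n b) = 0 ∧ Commute (g a) (g b))) :
    ∃ ψ : Uminus t n ħ →ₐ[ℂ] A, ∀ a, 1 ≤ a → a ≤ n → ψ (eNeg t n ħ a) = g a := by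
  have h' : ∀ a b, 1 ≤ a → a ≤ n → 1 ≤ b → b ≤ n → a ≠ b →
      inn (simpleRoot t n a) (simpleRoot t n b) < 0 ∨
      (inn (simpleRoot t n a) (simpleRoot t n b) = 0 ∧ Commute (g a) (g b)) := by
    intro a b h1 h2 h3 h4 h5
    rcases lt_or_gt_of_ne h5 with h6 | h6
    · exact h a b h1 h6 h4
    · rw [inn_comm]
      exact (h b a h3 h6 h2).imp_right fun h7 => ⟨h7.1, h7.2.symm⟩
  have hrel : ∀ ⦃x y⦄, SerreRel t n ħ x y →
      FreeAlgebra.lift ℂ (fun a : Fin n => g (a + 1)) x =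
        FreeAlgebra.lift ℂ (fun a : Fin n => g (a + 1)) y := by
    rintro _ _ ⟨a, b, hab⟩
    rw [serre, map_zero, map_sum]
    simp only [map_smul, map_mul, map_pow, FreeAlgebra.lift_ι_apply]
    have hab' : (a : ℕ) + 1 ≠ b + 1 := fun e => hab (Fin.ext (by omega))
    rcases h' (a + 1) (b + 1) (by omega) (by omega) (by omega) (by omega) hab' with h1 | ⟨h1, h2⟩
    · have h3 : cartan t n (a + 1) (b + 1) < 0 := by
        have := inn_simpleRoot_self_pos (t := t) (n := n) (a := a + 1) (by omega) (by omega) hD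
        rw [cartan]
        exact Int.ediv_neg_of_neg_of_pos (by omega) this
      obtain ⟨m, hm⟩ : ∃ m, (1 - cartan t n (a + 1) (b + 1)).toNat = m + 2 :=
        ⟨(1 - cartan t n (a + 1) (b + 1)).toNat - 2, by omega⟩
      rw [hm]
      have h4 : ∀ k, 2 ≤ k → g (a + 1) ^ k = 0 := fun k hk => pow_eq_zero_of_le hk (by
        rw [sq, hsq])
      refine Finset.sum_eq_zero fun k hk => ?_
      by_cases h5 : 2 ≤ k
      · rw [h4 k h5, mul_zero, smul_zero]
      by_cases h6 : 2 ≤ m + 2 - k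
      · rw [h4 _ h6, zero_mul, zero_mul, smul_zero]
      obtain rfl : k = 1 := by omega
      obtain rfl : m = 0 := by omega
      norm_num [haba]
    · have h3 : cartan t n (a + 1) (b + 1) = 0 := by simp [cartan, h1]
      obtain ⟨h4, h5⟩ := qbinom_one
        (hbarRoot_ne (t := t) (n := n) (a := a + 1) hq (by omega) (by omega) hD)
      rw [h3]
      simp [Finset.sum_range_succ, h4, h5, h2.eq]
  refine ⟨RingQuot.liftAlgHom ℂ ⟨_, hrel⟩, fun a h1 h2 => ?_⟩
  rw [eNeg, dif_pos ⟨h1, h2⟩, RingQuot.liftAlgHom_mkAlgHom_apply, FreeAlgebra.lift_ι_apply]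
  congr 1
  exact Nat.sub_add_cancel h1

theorem inn_simpleRoot_nonpos (hD : t = .D → 3 ≤ n) {a b : ℕ} (ha : 1 ≤ a) (hab : a < b)
    (hb : b ≤ n) : inn (simpleRoot t n a) (simpleRoot t n b) ≤ 0 := by
  by_cases h1 : b = a + 1
  · subst h1
    by_cases h2 : t = .D ∧ n = a + 1
    · obtain ⟨rfl, rfl⟩ := h2
      exact (inn_simpleRoot_last_D (hD rfl)).le
    · exact (inn_simpleRoot_adjacent ha hb (by grind)).le
  · by_cases h2 : t = .D ∧ b = n ∧ a + 2 = n
    · obtain ⟨rfl, rfl, h3⟩ := h2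
      obtain rfl : a = b - 2 := by omega
      exact (inn_simpleRoot_fork_D (hD rfl)).le
    · exact (inn_simpleRoot_eq_zero ha hb (by omega) (by grind)).le

/-- A map of the nodes of the Dynkin diagram to positions on a chain, `0` for the nodes that are
dropped, gives a representation by the operators `shiftOp`. -/
theorem exists_shift_rep (hq : ∀ m : ℕ, 0 < m → Complex.exp ħ ^ m ≠ 1) (hD : t = .D → 3 ≤ n)
    (u : ℂ) (lab : ℕ → ℕ)
    (hlab : ∀ a b, 1 ≤ a → a < b → b ≤ n → inn (simpleRoot t n a) (simpleRoot t n b) = 0 →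
      lab a = 0 ∨ lab b = 0 ∨ lab a + 2 ≤ lab b ∨ lab b + 2 ≤ lab a) :
    ∃ ψ : Uminus t n ħ →ₐ[ℂ] Module.End ℂ (Finset ℕ → ℂ), ∀ a, 1 ≤ a → a ≤ n →
      ∃ s : ℂ, s ≠ 0 ∧ ψ (chev t n ħ a) = if lab a = 0 then 0 else s • shiftOp u (lab a) := by
  obtain ⟨ψ, hψ⟩ := exists_algHom_of_nilpotent hq hD
    (fun a => if lab a = 0 then 0 else shiftOp u (lab a))
    (fun a => by split_ifs; exacts [mul_zero _, shiftOp_sq _ _])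
    (fun a b => by
      split_ifs
      exacts [mul_zero _, mul_zero _, by rw [mul_zero, zero_mul], shiftOp_aba _ _ _])
    (fun a b h1 h2 h3 => by
      refine (inn_simpleRoot_nonpos hD h1 h2 h3).lt_or_eq.imp_right fun h4 => ⟨h4, ?_⟩
      have := hlab a b h1 h2 h3 h4
      split_ifs with h5 h6 h6
      · exact Commute.zero_left _
      · exact Commute.zero_left _
      · exact Commute.zero_right _
      · rcases this with h7 | h7 | h7 | h7
        exacts [absurd h7 h5, absurd h7 h6, shiftOp_commute u h7, (shiftOp_commute u h7).symm])
  refine ⟨ψ, fun a h1 h2 => ?_⟩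
  obtain ⟨s, hs, h3⟩ := chev_eq (t := t) (n := n) hq a
  refine ⟨s, hs, ?_⟩
  rw [h3, map_smul, hψ a h1 h2, smul_ite, smul_zero]

/-- The representation on the chain of all nodes, without `n` for `D`. -/
theorem exists_shift_rep_chain (hq : ∀ m : ℕ, 0 < m → Complex.exp ħ ^ m ≠ 1)
    (hD : t = .D → 3 ≤ n) (u : ℂ) :
    ∃ ψ : Uminus t n ħ →ₐ[ℂ] Module.End ℂ (Finset ℕ → ℂ),
      ∀ a, 1 ≤ a → a ≤ n → (t = .D → a < n) →
        ∃ s : ℂ, s ≠ 0 ∧ ψ (chev t n ħ a) = s • shiftOp u a := by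
  classical
  obtain ⟨ψ, hψ⟩ := exists_shift_rep hq hD u
    (fun a => if t = .D ∧ a = n then 0 else a) fun a b h1 h2 h3 h4 => by
      by_cases h5 : t = .D ∧ b = n
      · exact .inr (.inl (if_pos h5))
      · rw [if_neg h5, if_neg (show ¬ (t = .D ∧ a = n) by omega)]
        rcases Nat.lt_or_ge (a + 1) b with h6 | h6
        · exact .inr (.inr (.inl h6))
        · obtain rfl : b = a + 1 := by omega
          exact absurd h4 (inn_simpleRoot_adjacent h1 h3 (by grind)).ne
  refine ⟨ψ, fun a h1 h2 h3 => ?_⟩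
  obtain ⟨s, hs, h4⟩ := hψ a h1 h2
  refine ⟨s, hs, ?_⟩
  rw [h4, if_neg (show ¬ (t = .D ∧ a = n) by grind), if_neg (by omega)]

/-- For `D`, the representation on the chain `1, …, n - 2, n`. -/
theorem exists_shift_rep_fork (hq : ∀ m : ℕ, 0 < m → Complex.exp ħ ^ m ≠ 1)
    (hn : 3 ≤ n) (u : ℂ) :
    ∃ ψ : Uminus .D n ħ →ₐ[ℂ] Module.End ℂ (Finset ℕ → ℂ),
      ∀ a, 1 ≤ a → a < n →
        ∃ s : ℂ, s ≠ 0 ∧ ψ (chev .D n ħ (if a + 1 = n then n else a)) = s • shiftOp u a := by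
  obtain ⟨ψ, hψ⟩ := exists_shift_rep (t := .D) hq (fun _ => hn) u
    (fun a => if a = n then n - 1 else if a + 1 = n then 0 else a) fun a b h1 h2 h3 h4 => by
      have h5 := inn_simpleRoot_adjacent (t := .D) (n := n) h1
      have h6 := inn_simpleRoot_fork_D hn
      by_cases h7 : a = n - 2
      · subst h7
        grind
      · grind
  refine ⟨ψ, fun a h1 h2 => ?_⟩
  obtain ⟨s, hs, h4⟩ := hψ (if a + 1 = n then n else a) (by split_ifs <;> omega)
    (by split_ifs <;> omega)
  refine ⟨s, hs, ?_⟩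
  rw [h4]
  have h5 : (if (if a + 1 = n then n else a) = n then n - 1
      else if (if a + 1 = n then n else a) + 1 = n then 0
      else (if a + 1 = n then n else a)) = a := by
    grind
  rw [h5, if_neg (by omega)]

/-- Adjacent generators do not commute, as is seen in a representation by shift operators. -/
theorem not_commute_chev (hq : ∀ m : ℕ, 0 < m → Complex.exp ħ ^ m ≠ 1) (hD : t = .D → 3 ≤ n)
    {a : ℕ} (ha : 1 ≤ a) (han : a + 1 ≤ n) (h : t = .D → a + 1 < n) :
    ¬ Commute (chev t n ħ a) (chev t n ħ (a + 1)) := by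
  obtain ⟨ψ, hψ⟩ := exists_shift_rep_chain (t := t) (n := n) hq hD 0
  obtain ⟨s, hs, h1⟩ := hψ a ha (by omega) (by grind)
  obtain ⟨s', hs', h2⟩ := hψ (a + 1) (by omega) han h
  intro hc
  have h3 := hc.map ψ
  rw [h1, h2] at h3
  exact shiftOp_not_commute zero_ne_one hs hs' a h3

theorem not_commute_chev_fork (hq : ∀ m : ℕ, 0 < m → Complex.exp ħ ^ m ≠ 1) (hn : 3 ≤ n) :
    ¬ Commute (chev .D n ħ (n - 2)) (chev .D n ħ n) := by
  obtain ⟨ψ, hψ⟩ := exists_shift_rep_fork (n := n) hq hn 0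
  obtain ⟨s, hs, h1⟩ := hψ (n - 2) (by omega) (by omega)
  obtain ⟨s', hs', h2⟩ := hψ (n - 2 + 1) (by omega) (by omega)
  rw [if_neg (by omega)] at h1
  rw [if_pos (by omega)] at h2
  intro hc
  have h3 := hc.map ψ
  rw [h1, h2] at h3
  exact shiftOp_not_commute zero_ne_one hs hs' (n - 2) h3

end rep

/-! ### Commutators of commutators -/

section mid

variable {A : Type*} [Ring A] [Algebra ℂ A]

/-- The commutator that defines `f_{l r'}` from `R = f_{* r'}` and `Z = f_{l *}` (or their
analogs for `C`, `D`); the factor of commutation depends on whether `l = r`. -/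
def midForm (c a : ℂ) (l r : ℕ) (R Z : A) : A :=
  if l = r then c⁻¹ • (R * Z - (a * c) • (Z * R)) else R * Z - a • (Z * R)

theorem midForm_zero_left (c a : ℂ) (l r : ℕ) (Z : A) : midForm c a l r 0 Z = 0 := by
  simp [midForm]

theorem midForm_zero_right (c a : ℂ) (l r : ℕ) (R : A) : midForm c a l r R 0 = 0 := by
  simp [midForm]

/-- A factorization of the left argument passes to the right of `midForm`: the factor of
commutation of `U` with `Z` turns the coefficients for `l ≠ r` into those for `l = k`, if
`l = k`. -/
theorem midForm_factor_right {c a : ℂ} (hc : c ≠ 0) {l r k : ℕ} {R R' U Z : A} (hlr : l ≠ r)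
    (hR : R' = (c⁻¹ - c) • (R * U))
    (hU : U * Z = (if l = k then c⁻¹ else 1 : ℂ) • (Z * U)) :
    midForm c a l r R' Z = (c⁻¹ - c) • (midForm c a l k R Z * U) := by
  rw [midForm, if_neg hlr, hR, midForm]
  have h1 : R * U * Z = (if l = k then c⁻¹ else 1 : ℂ) • (R * Z * U) := by
    rw [mul_assoc, hU, mul_smul_comm, mul_assoc]
  rw [smul_mul_assoc, h1, mul_smul_comm, ← mul_assoc]
  split_ifs
  · simp only [sub_mul, smul_mul_assoc]
    match_scalars <;> field_simp
  · simp only [sub_mul, smul_mul_assoc]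
    module

/-- The mirror image of `midForm_factor_right`. -/
theorem midForm_factor_left {c a : ℂ} (hc : c ≠ 0) {l r k : ℕ} {R U Z Z' : A} (hlr : l ≠ r)
    (hZ : Z' = (c⁻¹ - c) • (U * Z))
    (hU : R * U = (if k = r then c⁻¹ else 1 : ℂ) • (U * R)) :
    midForm c a l r R Z' = (c⁻¹ - c) • (U * midForm c a k r R Z) := by
  rw [midForm, if_neg hlr, hZ, midForm]
  have h1 : R * (U * Z) = (if k = r then c⁻¹ else 1 : ℂ) • (U * (R * Z)) := by
    rw [← mul_assoc, hU, smul_mul_assoc, mul_assoc]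
  rw [mul_smul_comm, h1, smul_mul_assoc, mul_assoc]
  split_ifs
  · simp only [mul_sub, mul_smul_comm]
    match_scalars <;> field_simp
  · simp only [mul_sub, mul_smul_comm]
    module

/-- Commutation of forms of degree one in the variables of two disjoint segments that are
linked by a skew-commutation at `k`. -/
theorem Multihomog.skew_segments {x : ℕ → A} {i d k l e m : ℕ} {y z : A} {c : ℂ} (hc : c ≠ 0)
    (hk : k = i + d + 1) (hkl : k ≤ l) (hle : l + e ≤ m)
    (hy : Multihomog x i d y) (hz : Multihomog x l e z)
    (hrel : x k * x (k - 1) = c • (x (k - 1) * x k))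
    (hcomm : ∀ a b, i ≤ a → b ≤ m → a + 2 ≤ b → Commute (x a) (x b)) :
    z * y = (if l = k then c else 1 : ℂ) • (y * z) := by
  split_ifs with h
  · subst h
    exact hy.skew_adjacent hc hk hz hrel fun a b h1 h2 h3 => hcomm a b h1 (by omega) h3
  · rw [one_smul]
    exact hy.commute fun a h1 h2 => (hz.commute fun b h3 h4 =>
      hcomm a b h1 (by omega) (by omega)).symm

end mid

/-! ### Images of the elements `f_{lr}` under homomorphisms -/

section entries

variable {t : Series} {n : ℕ} {ħ : ℂ}

theorem fEntry_low {i j : ℕ} (hij : i < j) (hj : 2 * j ≤ dimN t n + 1) :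
    fEntry t n ħ i j = fLow t n ħ i j := by
  rw [fEntry, if_neg (by omega), if_neg (by omega), if_pos hj]

theorem fEntry_up {i j : ℕ} (hij : i < j) (hj : 2 * j ≤ dimN t n + 1) :
    fEntry t n ħ (flip t n j) (flip t n i) = fUp t n ħ i j := by
  have h : flip t n (flip t n i) = i ∧ flip t n (flip t n j) = j := by
    simp only [flip]; omega
  rw [fEntry, if_neg, if_neg, if_neg, if_pos, h.1, h.2]
  all_goals (simp only [flip]; omega)

theorem fEntry_mid {i j : ℕ} (hi : i ≤ n) (hj : j ≤ n) :
    fEntry t n ħ i (flip t n j) = fMid t n ħ i j := by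
  have h : flip t n (flip t n j) = j := by
    cases t <;> simp only [flip, dimN] <;> omega
  rw [fEntry, if_neg, if_neg, if_neg, if_neg, h]
  all_goals (cases t <;> simp only [flip, dimN] <;> omega)

variable {A : Type*} [Ring A] [Algebra ℂ A]

theorem map_fLow (ψ : Uminus t n ħ →ₐ[ℂ] A) (i j : ℕ) :
    ψ (fLow t n ħ i j) = chainLow (qpow ħ (-1)) (fun a => ψ (chev t n ħ a)) i (j - i - 1) := by
  rw [fLow]
  induction j - i - 1 with
  | zero => rfl
  | succ d ih => rw [lowAux, qcomm, map_sub, map_smul, map_mul, map_mul, ih, chainLow]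

theorem map_fUp (ψ : Uminus t n ħ →ₐ[ℂ] A) (i j : ℕ) :
    ψ (fUp t n ħ i j) = chainUp (qpow ħ (-1)) (fun a => ψ (chev t n ħ a)) i (j - i - 1) := by
  rw [fUp]
  induction j - i - 1 with
  | zero => rfl
  | succ d ih => rw [upAux, qcomm, map_sub, map_smul, map_mul, map_mul, ih, chainUp]

theorem map_qcomm (ψ : Uminus t n ħ →ₐ[ℂ] A) (u v : Uminus t n ħ) (a : ℂ) :
    ψ (qcomm u v a) = ψ u * ψ v - a • (ψ v * ψ u) := by
  rw [qcomm, map_sub, map_smul, map_mul, map_mul]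

theorem qpow_neg_one_inv (ħ : ℂ) : (qpow ħ (-1))⁻¹ = qpow ħ 1 := by
  rw [qpow_neg, inv_inv]

theorem qpow_neg_two (ħ : ℂ) : qpow ħ (-2) = qpow ħ (-1) * qpow ħ (-1) := by
  rw [← qpow_add]; norm_num

end entries

/-! ### Factorization of `f_{lr}` for `so(2n+1)` -/

section seriesB

variable {n : ℕ} {ħ : ℂ} {A : Type*} [Ring A] [Algebra ℂ A] {ψ : Uminus .B n ħ →ₐ[ℂ] A}
  {c : ℂ} {x : ℕ → A}

theorem entryB_low (hc : c = qpow ħ (-1)) (hx : x = fun a => ψ (chev .B n ħ a))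
    {i j : ℕ} (hij : i < j) (hj : j ≤ n + 1) :
    ψ (fEntry .B n ħ i j) = chainLow c x i (j - i - 1) := by
  rw [fEntry_low hij (by simp only [dimN]; omega), map_fLow, hc, hx]

theorem entryB_up (hc : c = qpow ħ (-1)) (hx : x = fun a => ψ (chev .B n ħ a))
    {i j : ℕ} (hij : i < j) (hj : j ≤ n + 1) :
    ψ (fEntry .B n ħ (flip .B n j) (flip .B n i)) = chainUp c x i (j - i - 1) := by
  rw [fEntry_up hij (by simp only [dimN]; omega), map_fUp, hc, hx]

theorem entryB_mid (hc : c = qpow ħ (-1)) (hx : x = fun a => ψ (chev .B n ħ a))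
    {i j : ℕ} (hi : i ≤ n) (hj : j ≤ n) :
    ψ (fEntry .B n ħ i (flip .B n j)) =
      midForm c 1 i j (chainUp c x j (n + 1 - j - 1)) (chainLow c x i (n + 1 - i - 1)) := by
  rw [fEntry_mid hi hj, fMid, fMidB, midForm]
  split_ifs
  · rw [map_smul, map_qcomm, map_fUp, map_fLow, hc, hx, one_mul, qpow_neg_one_inv]
  · rw [map_qcomm, map_fUp, map_fLow, hc, hx]

/-- If `f_k` and `f_{k-1}` commute up to `c`, which is the vanishing of `f_{k-1,k+1}`, then every
`f_{lr}` with `l < k < r` vanishes and every `f_{lr}` with `l < k' < r` factorizes at `k'`. -/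
theorem factorsB (hc : c = qpow ħ (-1)) (hx : x = fun a => ψ (chev .B n ħ a))
    (hcomm : ∀ a b, 1 ≤ a → b ≤ n → a + 2 ≤ b → Commute (x a) (x b))
    {k : ℕ} (hk : 2 ≤ k) (hkn : k ≤ n)
    (hrel : x k * x (k - 1) = c • (x (k - 1) * x k)) {l r : ℕ} (hl : 1 ≤ l)
    (hr : r ≤ dimN .B n) :
    (l < k → k < r → ψ (fEntry .B n ħ l r) = 0) ∧
    (l < flip .B n k → flip .B n k < r → ψ (fEntry .B n ħ l r) =
      (c⁻¹ - c) • (ψ (fEntry .B n ħ l (flip .B n k)) * ψ (fEntry .B n ħ (flip .B n k) r))) := by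
  have hc0 : c ≠ 0 := hc ▸ qpow_ne_zero _ _
  have F1 : ∀ r ≤ dimN .B n, l < k → k < r → ψ (fEntry .B n ħ l r) = 0 := by
    intro r hr h1 h2
    have h3 : ∀ r, k < r → r ≤ n + 1 → chainLow c x l (r - l - 1) = 0 := fun r h3 h4 => by
      rw [chainLow_factor c c h1 h3 hc0 hrel fun a b h5 h6 h7 =>
        hcomm a b (by omega) (by omega) h7, sub_self, zero_smul]
    rcases Nat.lt_or_ge (n + 1) r with h4 | h4
    · obtain ⟨j, rfl, hj⟩ : ∃ j, r = flip .B n j ∧ j ≤ n :=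
        ⟨flip .B n r, by simp only [flip, dimN] at *; omega, by simp only [flip, dimN] at *; omega⟩
      rw [entryB_mid hc hx (by omega) hj, h3 (n + 1) (by omega) le_rfl, midForm_zero_right]
    · rw [entryB_low hc hx (by omega) h4, h3 r h2 h4]
  refine ⟨F1 r hr, fun h1 h2 => ?_⟩
  have hk' : k < flip .B n k ∧ flip .B n k ≤ dimN .B n := by simp only [flip, dimN]; omega
  rcases Nat.lt_or_ge l k with h3 | h3
  · rw [F1 r hr h3 (by omega), F1 _ hk'.2 h3 hk'.1, zero_mul, smul_zero]
  obtain ⟨j, rfl, hj, hjk⟩ : ∃ j, r = flip .B n j ∧ 1 ≤ j ∧ j < k :=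
    ⟨flip .B n r, by simp only [flip, dimN] at *; omega, by simp only [flip, dimN] at *; omega,
      by simp only [flip, dimN] at *; omega⟩
  have h4 : ∀ m, k < m → m ≤ n + 1 → chainUp c x j (m - j - 1) =
      (c⁻¹ - c) • (chainUp c x k (m - k - 1) * chainUp c x j (k - j - 1)) := fun m h4 h5 =>
    chainUp_factor c c⁻¹ hjk h4 (inv_ne_zero hc0) (skew_symm hc0 hrel) fun a b h5 h6 h7 =>
      hcomm a b (by omega) (by omega) h7
  rcases Nat.lt_or_ge n l with h5 | h5
  · obtain ⟨m, rfl, hm, hm'⟩ : ∃ m, l = flip .B n m ∧ k < m ∧ m ≤ n + 1 :=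
      ⟨flip .B n l, by simp only [flip, dimN] at *; omega, by simp only [flip, dimN] at *; omega,
        by simp only [flip, dimN] at *; omega⟩
    rw [entryB_up hc hx (by omega) hm', entryB_up hc hx hm hm', entryB_up hc hx hjk (by omega)]
    exact h4 m hm hm'
  · rw [entryB_mid hc hx h5 (by omega), entryB_mid hc hx h5 hkn, entryB_up hc hx hjk (by omega)]
    refine midForm_factor_right hc0 (by omega) (h4 (n + 1) (by omega) le_rfl) ?_
    have := (multihomog_chainUp c x j (k - j - 1)).skew_segments (m := n) hc0 (by omega) h3
      (by omega) (multihomog_chainLow c x l (n + 1 - l - 1)) hrel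
      fun a b h6 h7 h8 => hcomm a b (by omega) h7 h8
    rw [skew_symm (by split_ifs <;> simp [hc0]) this]
    congr 1
    split_ifs <;> simp

/-- The mirror image of `factorsB`: the vanishing of `f_{(k+1)',(k-1)'}` is the opposite
commutation relation. -/
theorem factorsB' (hc : c = qpow ħ (-1)) (hx : x = fun a => ψ (chev .B n ħ a))
    (hcomm : ∀ a b, 1 ≤ a → b ≤ n → a + 2 ≤ b → Commute (x a) (x b))
    {k : ℕ} (hk : 2 ≤ k) (hkn : k ≤ n)
    (hrel : x (k - 1) * x k = c • (x k * x (k - 1))) {l r : ℕ} (hl : 1 ≤ l)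
    (hr : r ≤ dimN .B n) :
    (l < flip .B n k → flip .B n k < r → ψ (fEntry .B n ħ l r) = 0) ∧
    (l < k → k < r → ψ (fEntry .B n ħ l r) =
      (c⁻¹ - c) • (ψ (fEntry .B n ħ l k) * ψ (fEntry .B n ħ k r))) := by
  have hc0 : c ≠ 0 := hc ▸ qpow_ne_zero _ _
  have F1 : ∀ l, 1 ≤ l → l < flip .B n k → flip .B n k < r → ψ (fEntry .B n ħ l r) = 0 := by
    intro l hl h1 h2
    obtain ⟨j, rfl, hj, hjk⟩ : ∃ j, r = flip .B n j ∧ 1 ≤ j ∧ j < k :=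
      ⟨flip .B n r, by simp only [flip, dimN] at *; omega, by simp only [flip, dimN] at *; omega,
        by simp only [flip, dimN] at *; omega⟩
    have h4 : ∀ m, k < m → m ≤ n + 1 → chainUp c x j (m - j - 1) = 0 := fun m h4 h5 => by
      rw [chainUp_factor c c hjk h4 hc0 hrel fun a b h5 h6 h7 =>
        hcomm a b (by omega) (by omega) h7, sub_self, zero_smul]
    rcases Nat.lt_or_ge n l with h5 | h5
    · obtain ⟨m, rfl, hm, hm'⟩ : ∃ m, l = flip .B n m ∧ k < m ∧ m ≤ n + 1 :=
        ⟨flip .B n l, by simp only [flip, dimN] at *; omega,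
          by simp only [flip, dimN] at *; omega, by simp only [flip, dimN] at *; omega⟩
      rw [entryB_up hc hx (by omega) hm', h4 m hm hm']
    · rw [entryB_mid hc hx h5 (by omega), h4 (n + 1) (by omega) le_rfl, midForm_zero_left]
  refine ⟨F1 l hl, fun h1 h2 => ?_⟩
  have hk' : k < flip .B n k := by simp only [flip, dimN]; omega
  rcases Nat.lt_or_ge (flip .B n k) r with h3 | h3
  · rw [F1 l hl (by omega) h3, F1 k (by omega) hk' h3, mul_zero, smul_zero]
  have h4 : ∀ m, k < m → m ≤ n + 1 → chainLow c x l (m - l - 1) =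
      (c⁻¹ - c) • (chainLow c x l (k - l - 1) * chainLow c x k (m - k - 1)) := fun m h4 h5 =>
    chainLow_factor c c⁻¹ h1 h4 (inv_ne_zero hc0) (skew_symm hc0 hrel) fun a b h5 h6 h7 =>
      hcomm a b (by omega) (by omega) h7
  rcases Nat.lt_or_ge (n + 1) r with h5 | h5
  · obtain ⟨j, rfl, hj, hjk⟩ : ∃ j, r = flip .B n j ∧ j ≤ n ∧ k ≤ j :=
      ⟨flip .B n r, by simp only [flip, dimN] at *; omega, by simp only [flip, dimN] at *; omega,
        by simp only [flip, dimN] at *; omega⟩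
    rw [entryB_mid hc hx (by omega) hj, entryB_mid hc hx hkn hj, entryB_low hc hx h1 (by omega)]
    refine midForm_factor_left hc0 (by omega) (h4 (n + 1) (by omega) le_rfl) ?_
    have := (multihomog_chainLow c x l (k - l - 1)).skew_segments (m := n) (inv_ne_zero hc0)
      (by omega) hjk (by omega) (multihomog_chainUp c x j (n + 1 - j - 1)) (skew_symm hc0 hrel)
      fun a b h6 h7 h8 => hcomm a b (by omega) h7 h8
    rw [this]
    simp only [eq_comm]
  · rw [entryB_low hc hx (by omega) h5, entryB_low hc hx h1 (by omega), entryB_low hc hx h2 h5]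
    exact h4 r h2 h5

end seriesB

/-! ### Factorization of `f_{lr}` for `sp(2n)` -/

section seriesC

variable {n : ℕ} {ħ : ℂ} {A : Type*} [Ring A] [Algebra ℂ A] {ψ : Uminus .C n ħ →ₐ[ℂ] A}
  {c : ℂ} {x : ℕ → A}

theorem entryC_low (hc : c = qpow ħ (-1)) (hx : x = fun a => ψ (chev .C n ħ a))
    {i j : ℕ} (hij : i < j) (hj : j ≤ n) :
    ψ (fEntry .C n ħ i j) = chainLow c x i (j - i - 1) := by
  rw [fEntry_low hij (by simp only [dimN]; omega), map_fLow, hc, hx]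

theorem entryC_up (hc : c = qpow ħ (-1)) (hx : x = fun a => ψ (chev .C n ħ a))
    {i j : ℕ} (hij : i < j) (hj : j ≤ n) :
    ψ (fEntry .C n ħ (flip .C n j) (flip .C n i)) = chainUp c x i (j - i - 1) := by
  rw [fEntry_up hij (by simp only [dimN]; omega), map_fUp, hc, hx]

theorem entryC_center (hq : ∀ m : ℕ, 0 < m → Complex.exp ħ ^ m ≠ 1) (hc : c = qpow ħ (-1))
    (hx : x = fun a => ψ (chev .C n ħ a)) :
    ψ (fEntry .C n ħ n (flip .C n n)) = (c⁻¹ + c) • x n := by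
  rw [fEntry_mid le_rfl le_rfl, fMid, fMidC, if_pos rfl, if_pos rfl, map_smul, hx, qnum_two hq, hc,
    qpow_neg_one_inv, qpow_neg]

theorem entryC_left (hc : c = qpow ħ (-1)) (hx : x = fun a => ψ (chev .C n ħ a))
    {i : ℕ} (hi : i < n) :
    ψ (fEntry .C n ħ i (flip .C n n)) =
      x n * chainLow c x i (n - i - 1) - (c * c) • (chainLow c x i (n - i - 1) * x n) := by
  rw [fEntry_mid hi.le le_rfl, fMid, fMidC, if_pos rfl, if_neg hi.ne, map_qcomm, map_fLow, hx, hc,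
    qpow_neg_two]

theorem entryC_right (hc : c = qpow ħ (-1)) (hx : x = fun a => ψ (chev .C n ħ a))
    {j : ℕ} (hj : j < n) :
    ψ (fEntry .C n ħ n (flip .C n j)) =
      chainUp c x j (n - j - 1) * x n - (c * c) • (x n * chainUp c x j (n - j - 1)) := by
  rw [fEntry_mid le_rfl hj.le, fMid, fMidC, if_neg hj.ne, if_pos rfl, map_qcomm, map_fUp, hx, hc,
    qpow_neg_two]

theorem entryC_mid (hc : c = qpow ħ (-1)) (hx : x = fun a => ψ (chev .C n ħ a))
    {i j : ℕ} (hi : i < n) (hj : j < n) :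
    ψ (fEntry .C n ħ i (flip .C n j)) =
      midForm c c i j (ψ (fEntry .C n ħ n (flip .C n j))) (chainLow c x i (n - i - 1)) := by
  rw [entryC_right hc hx hj, fEntry_mid hi.le hj.le, fMid, fMidC, if_neg hj.ne, if_neg hi.ne,
    midForm]
  split_ifs
  · rw [map_smul, map_qcomm, map_qcomm, map_fUp, map_fLow, hc, hx, qpow_neg_one_inv, qpow_neg_two]
  · rw [map_qcomm, map_qcomm, map_fUp, map_fLow, hc, hx, qpow_neg_two]

/-- The analog of `factorsB` for `k < n`. -/
theorem factorsC (hc : c = qpow ħ (-1)) (hx : x = fun a => ψ (chev .C n ħ a))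
    (hcomm : ∀ a b, 1 ≤ a → b ≤ n → a + 2 ≤ b → Commute (x a) (x b))
    {k : ℕ} (hk : 2 ≤ k) (hkn : k < n)
    (hrel : x k * x (k - 1) = c • (x (k - 1) * x k)) {l r : ℕ} (hl : 1 ≤ l)
    (hr : r ≤ dimN .C n) :
    (l < k → k < r → ψ (fEntry .C n ħ l r) = 0) ∧
    (l < flip .C n k → flip .C n k < r → ψ (fEntry .C n ħ l r) =
      (c⁻¹ - c) • (ψ (fEntry .C n ħ l (flip .C n k)) * ψ (fEntry .C n ħ (flip .C n k) r))) := by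
  have hc0 : c ≠ 0 := hc ▸ qpow_ne_zero _ _
  have F1 : ∀ r ≤ dimN .C n, l < k → k < r → ψ (fEntry .C n ħ l r) = 0 := by
    intro r hr h1 h2
    have h3 : ∀ r, k < r → r ≤ n → chainLow c x l (r - l - 1) = 0 := fun r h3 h4 => by
      rw [chainLow_factor c c h1 h3 hc0 hrel fun a b h5 h6 h7 =>
        hcomm a b (by omega) (by omega) h7, sub_self, zero_smul]
    rcases Nat.lt_or_ge n r with h4 | h4
    · obtain ⟨j, rfl, hj⟩ : ∃ j, r = flip .C n j ∧ j ≤ n :=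
        ⟨flip .C n r, by simp only [flip, dimN] at *; omega, by simp only [flip, dimN] at *; omega⟩
      rcases hj.lt_or_eq with hj | rfl
      · rw [entryC_mid hc hx (by omega) hj, h3 n (by omega) le_rfl, midForm_zero_right]
      · rw [entryC_left hc hx (by omega), h3 j (by omega) le_rfl]
        simp
    · rw [entryC_low hc hx (by omega) h4, h3 r h2 h4]
  refine ⟨F1 r hr, fun h1 h2 => ?_⟩
  have hk' : k < flip .C n k ∧ flip .C n k ≤ dimN .C n := by simp only [flip, dimN]; omega
  rcases Nat.lt_or_ge l k with h3 | h3
  · rw [F1 r hr h3 (by omega), F1 _ hk'.2 h3 hk'.1, zero_mul, smul_zero]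
  obtain ⟨j, rfl, hj, hjk⟩ : ∃ j, r = flip .C n j ∧ 1 ≤ j ∧ j < k :=
    ⟨flip .C n r, by simp only [flip, dimN] at *; omega, by simp only [flip, dimN] at *; omega,
      by simp only [flip, dimN] at *; omega⟩
  have h4 : ∀ m, k < m → m ≤ n → chainUp c x j (m - j - 1) =
      (c⁻¹ - c) • (chainUp c x k (m - k - 1) * chainUp c x j (k - j - 1)) := fun m h4 h5 =>
    chainUp_factor c c⁻¹ hjk h4 (inv_ne_zero hc0) (skew_symm hc0 hrel) fun a b h5 h6 h7 =>
      hcomm a b (by omega) (by omega) h7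
  have h6 : ψ (fEntry .C n ħ n (flip .C n j)) =
      (c⁻¹ - c) • (ψ (fEntry .C n ħ n (flip .C n k)) * chainUp c x j (k - j - 1)) := by
    rw [entryC_right hc hx (by omega), entryC_right hc hx hkn, h4 n hkn le_rfl]
    have h7 : Commute (x n) (chainUp c x j (k - j - 1)) :=
      (multihomog_chainUp c x j (k - j - 1)).commute fun a h8 h9 =>
        (hcomm a n (by omega) le_rfl (by omega)).symm
    simp only [smul_mul_assoc, mul_smul_comm, sub_mul]
    rw [mul_assoc _ _ (x n), ← h7.eq]
    simp only [mul_assoc]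
    module
  rcases Nat.lt_or_ge n l with h5 | h5
  · obtain ⟨m, rfl, hm, hm'⟩ : ∃ m, l = flip .C n m ∧ k < m ∧ m ≤ n :=
      ⟨flip .C n l, by simp only [flip, dimN] at *; omega, by simp only [flip, dimN] at *; omega,
        by simp only [flip, dimN] at *; omega⟩
    rw [entryC_up hc hx (by omega) hm', entryC_up hc hx hm hm', entryC_up hc hx hjk (by omega)]
    exact h4 m hm hm'
  rw [entryC_up hc hx hjk (by omega)]
  rcases h5.lt_or_eq with h5 | rfl
  · rw [entryC_mid hc hx h5 (by omega), entryC_mid hc hx h5 hkn]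
    refine midForm_factor_right hc0 (by omega) h6 ?_
    have := (multihomog_chainUp c x j (k - j - 1)).skew_segments (m := n) hc0 (by omega) h3
      (by omega) (multihomog_chainLow c x l (n - l - 1)) hrel
      fun a b h6 h7 h8 => hcomm a b (by omega) h7 h8
    rw [skew_symm (by split_ifs <;> simp [hc0]) this]
    congr 1
    split_ifs <;> simp
  · exact h6

/-- The mirror image of `factorsC`. -/
theorem factorsC' (hc : c = qpow ħ (-1)) (hx : x = fun a => ψ (chev .C n ħ a))
    (hcomm : ∀ a b, 1 ≤ a → b ≤ n → a + 2 ≤ b → Commute (x a) (x b))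
    {k : ℕ} (hk : 2 ≤ k) (hkn : k < n)
    (hrel : x (k - 1) * x k = c • (x k * x (k - 1))) {l r : ℕ} (hl : 1 ≤ l)
    (hr : r ≤ dimN .C n) :
    (l < flip .C n k → flip .C n k < r → ψ (fEntry .C n ħ l r) = 0) ∧
    (l < k → k < r → ψ (fEntry .C n ħ l r) =
      (c⁻¹ - c) • (ψ (fEntry .C n ħ l k) * ψ (fEntry .C n ħ k r))) := by
  have hc0 : c ≠ 0 := hc ▸ qpow_ne_zero _ _
  have F1 : ∀ l, 1 ≤ l → l < flip .C n k → flip .C n k < r → ψ (fEntry .C n ħ l r) = 0 := by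
    intro l hl h1 h2
    obtain ⟨j, rfl, hj, hjk⟩ : ∃ j, r = flip .C n j ∧ 1 ≤ j ∧ j < k :=
      ⟨flip .C n r, by simp only [flip, dimN] at *; omega, by simp only [flip, dimN] at *; omega,
        by simp only [flip, dimN] at *; omega⟩
    have h4 : ∀ m, k < m → m ≤ n → chainUp c x j (m - j - 1) = 0 := fun m h4 h5 => by
      rw [chainUp_factor c c hjk h4 hc0 hrel fun a b h5 h6 h7 =>
        hcomm a b (by omega) (by omega) h7, sub_self, zero_smul]
    have h6 : ψ (fEntry .C n ħ n (flip .C n j)) = 0 := by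
      rw [entryC_right hc hx (by omega), h4 n hkn le_rfl]
      simp
    rcases Nat.lt_or_ge n l with h5 | h5
    · obtain ⟨m, rfl, hm, hm'⟩ : ∃ m, l = flip .C n m ∧ k < m ∧ m ≤ n :=
        ⟨flip .C n l, by simp only [flip, dimN] at *; omega,
          by simp only [flip, dimN] at *; omega, by simp only [flip, dimN] at *; omega⟩
      rw [entryC_up hc hx (by omega) hm', h4 m hm hm']
    · rcases h5.lt_or_eq with h5 | rfl
      · rw [entryC_mid hc hx h5 (by omega), h6, midForm_zero_left]
      · exact h6
  refine ⟨F1 l hl, fun h1 h2 => ?_⟩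
  have hk' : k < flip .C n k := by simp only [flip, dimN]; omega
  rcases Nat.lt_or_ge (flip .C n k) r with h3 | h3
  · rw [F1 l hl (by omega) h3, F1 k (by omega) hk' h3, mul_zero, smul_zero]
  have h4 : ∀ m, k < m → m ≤ n → chainLow c x l (m - l - 1) =
      (c⁻¹ - c) • (chainLow c x l (k - l - 1) * chainLow c x k (m - k - 1)) := fun m h4 h5 =>
    chainLow_factor c c⁻¹ h1 h4 (inv_ne_zero hc0) (skew_symm hc0 hrel) fun a b h5 h6 h7 =>
      hcomm a b (by omega) (by omega) h7
  have h7 : Commute (x n) (chainLow c x l (k - l - 1)) :=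
    (multihomog_chainLow c x l (k - l - 1)).commute fun a h8 h9 =>
      (hcomm a n (by omega) le_rfl (by omega)).symm
  rw [entryC_low hc hx h1 hkn.le]
  rcases Nat.lt_or_ge n r with h5 | h5
  · obtain ⟨j, rfl, hj, hjk⟩ : ∃ j, r = flip .C n j ∧ j ≤ n ∧ k ≤ j :=
      ⟨flip .C n r, by simp only [flip, dimN] at *; omega, by simp only [flip, dimN] at *; omega,
        by simp only [flip, dimN] at *; omega⟩
    rcases hj.lt_or_eq with hj | rfl
    · rw [entryC_mid hc hx (by omega) hj, entryC_mid hc hx hkn hj]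
      refine midForm_factor_left hc0 (by omega) (h4 n hkn le_rfl) ?_
      rw [entryC_right hc hx hj]
      have h8 := (multihomog_chainLow c x l (k - l - 1)).skew_segments (m := n) (inv_ne_zero hc0)
        (by omega) hjk (by omega) (multihomog_chainUp c x j (n - j - 1)) (skew_symm hc0 hrel)
        fun a b h6 h7 h8 => hcomm a b (by omega) h7 h8
      have h10 : chainLow c x l (k - l - 1) * x n =
          (1 : ℂ) • (x n * chainLow c x l (k - l - 1)) := by rw [one_smul, h7.eq]
      have h9 := skew_qcomm (c * c) (skew_symm (by split_ifs <;> simp [hc0]) h8) h10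
      rw [skew_symm (by split_ifs <;> simp [hc0]) h9, mul_one, inv_inv]
      simp only [eq_comm]
    · rw [entryC_left hc hx (by omega), entryC_left hc hx hkn, h4 j hkn le_rfl]
      simp only [smul_mul_assoc, mul_smul_comm, mul_sub]
      rw [← mul_assoc (x j), h7.eq]
      simp only [mul_assoc]
      module
  · rw [entryC_low hc hx (by omega) h5, entryC_low hc hx h2 h5]
    exact h4 r h2 h5

/-- The case `k = n`, where the relation is the vanishing of `f_{n-1,n'}`. This is the only place
where the Serre relations of adjacent generators enter: they yield the commutation of `f_{n' j'}`
with `f_{l n}` up to a scalar. -/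
theorem factorsC_last (hq : ∀ m : ℕ, 0 < m → Complex.exp ħ ^ m ≠ 1) (hc : c = qpow ħ (-1))
    (hx : x = fun a => ψ (chev .C n ħ a)) (hserre : SerreChain c x 1 (n - 1))
    (hcomm : ∀ a b, 1 ≤ a → b ≤ n → a + 2 ≤ b → Commute (x a) (x b)) (hn : 2 ≤ n)
    (hrel : x n * x (n - 1) = (c * c) • (x (n - 1) * x n)) {l r : ℕ} (hl : 1 ≤ l)
    (hr : r ≤ dimN .C n) :
    (l < n → n < r → ψ (fEntry .C n ħ l r) = 0) ∧
    (l < flip .C n n → flip .C n n < r → ψ (fEntry .C n ħ l r) =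
      (c⁻¹ - c) • (ψ (fEntry .C n ħ l (flip .C n n)) * ψ (fEntry .C n ħ (flip .C n n) r))) := by
  have hc0 : c ≠ 0 := hc ▸ qpow_ne_zero _ _
  have hc2 : c + c⁻¹ ≠ 0 := by
    rw [hc, qpow_neg_one_inv, qpow_neg, add_comm]
    exact qpow_add_inv_ne_zero hq
  -- `f_n` commutes with the two kinds of chains that end in `f_{n-1}` up to `c²`
  have hy : ∀ i z, 1 ≤ i → i < n → Multihomog x i (n - i - 1) z → x n * z = (c * c) • (z * x n) :=
    fun i z h1 h2 hz => hz.skew (n - 1) _ (by omega) hrel fun a h3 h4 h5 =>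
      (hcomm a n (by omega) le_rfl (by omega)).symm
  have F1 : ∀ r ≤ dimN .C n, l < n → n < r → ψ (fEntry .C n ħ l r) = 0 := by
    intro r hr h1 h2
    obtain ⟨j, rfl, hj1, hj⟩ : ∃ j, r = flip .C n j ∧ 1 ≤ j ∧ j ≤ n :=
      ⟨flip .C n r, by simp only [flip, dimN] at *; omega, by simp only [flip, dimN] at *; omega,
        by simp only [flip, dimN] at *; omega⟩
    have hZ := hy l _ hl h1 (multihomog_chainLow c x l (n - l - 1))
    rcases hj.lt_or_eq with hj | rfl
    · have hX := hy j _ hj1 hj (multihomog_chainUp c x j (n - j - 1))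
      have hXZ := hserre.skew_up_low (l := l) (r := j) hc0 hc2 hl hj1 (by omega) (by omega)
      rw [show n - 1 - j = n - j - 1 by omega, show n - 1 - l = n - l - 1 by omega] at hXZ
      rw [entryC_mid hc hx h1 hj, entryC_right hc hx hj, hX]
      set X := chainUp c x j (n - j - 1)
      set Z := chainLow c x l (n - l - 1)
      have h3 : X * x n * Z = (c * c * (if l = j then 1 else c⁻¹)) • (Z * (X * x n)) := by
        rw [mul_assoc, hZ, mul_smul_comm, ← mul_assoc, hXZ, smul_mul_assoc, smul_smul, mul_assoc Z]
      rw [midForm]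
      split_ifs at h3 ⊢
      · simp only [sub_mul, mul_sub, smul_mul_assoc, mul_smul_comm, h3]
        module
      · simp only [sub_mul, mul_sub, smul_mul_assoc, mul_smul_comm, h3, mul_assoc,
          mul_inv_cancel₀ hc0]
        module
    · rw [entryC_left hc hx h1, hZ, sub_self]
  refine ⟨F1 r hr, fun h1 h2 => ?_⟩
  have hk' : n < flip .C n n ∧ flip .C n n ≤ dimN .C n := by simp only [flip, dimN]; omega
  rcases Nat.lt_or_ge l n with h3 | h3
  · rw [F1 r hr h3 (by omega), F1 _ hk'.2 h3 hk'.1, zero_mul, smul_zero]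
  obtain rfl : l = n := by simp only [flip, dimN] at *; omega
  obtain ⟨j, rfl, hj, hjk⟩ : ∃ j, r = flip .C l j ∧ 1 ≤ j ∧ j < l :=
    ⟨flip .C l r, by simp only [flip, dimN] at *; omega, by simp only [flip, dimN] at *; omega,
      by simp only [flip, dimN] at *; omega⟩
  have hX := skew_symm (mul_ne_zero hc0 hc0)
    (hy j _ hj hjk (multihomog_chainUp c x j (l - j - 1)))
  rw [entryC_right hc hx hjk, entryC_center hq hc hx, entryC_up hc hx hjk le_rfl, hX]
  simp only [smul_mul_assoc]
  match_scalars
  field_simp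
  ring

/-- The mirror image of `factorsC_last`; here `f_{n' j'}` and `f_{l n}` need not be commuted. -/
theorem factorsC_last' (hq : ∀ m : ℕ, 0 < m → Complex.exp ħ ^ m ≠ 1) (hc : c = qpow ħ (-1))
    (hx : x = fun a => ψ (chev .C n ħ a))
    (hcomm : ∀ a b, 1 ≤ a → b ≤ n → a + 2 ≤ b → Commute (x a) (x b)) (hn : 2 ≤ n)
    (hrel : x (n - 1) * x n = (c * c) • (x n * x (n - 1))) {l r : ℕ} (hl : 1 ≤ l)
    (hr : r ≤ dimN .C n) :
    (l < flip .C n n → flip .C n n < r → ψ (fEntry .C n ħ l r) = 0) ∧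
    (l < n → n < r → ψ (fEntry .C n ħ l r) =
      (c⁻¹ - c) • (ψ (fEntry .C n ħ l n) * ψ (fEntry .C n ħ n r))) := by
  have hc0 : c ≠ 0 := hc ▸ qpow_ne_zero _ _
  have hcc := mul_ne_zero hc0 hc0
  have hy : ∀ i z, 1 ≤ i → i < n → Multihomog x i (n - i - 1) z →
      x n * z = (c * c)⁻¹ • (z * x n) :=
    fun i z h1 h2 hz => hz.skew (n - 1) _ (by omega) (skew_symm hcc hrel) fun a h3 h4 h5 =>
      (hcomm a n (by omega) le_rfl (by omega)).symm
  have F1 : ∀ l, 1 ≤ l → l < flip .C n n → flip .C n n < r → ψ (fEntry .C n ħ l r) = 0 := by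
    intro l hl h1 h2
    obtain ⟨j, rfl, hj1, hj⟩ : ∃ j, r = flip .C n j ∧ 1 ≤ j ∧ j < n :=
      ⟨flip .C n r, by simp only [flip, dimN] at *; omega, by simp only [flip, dimN] at *; omega,
        by simp only [flip, dimN] at *; omega⟩
    have h6 : ψ (fEntry .C n ħ n (flip .C n j)) = 0 := by
      rw [entryC_right hc hx hj, hy j _ hj1 hj (multihomog_chainUp c x j (n - j - 1)), smul_smul,
        mul_inv_cancel₀ hcc, one_smul, sub_self]
    rcases (show l ≤ n by simp only [flip, dimN] at *; omega).lt_or_eq with h5 | rfl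
    · rw [entryC_mid hc hx h5 hj, h6, midForm_zero_left]
    · exact h6
  refine ⟨F1 l hl, fun h1 h2 => ?_⟩
  have hk' : n < flip .C n n := by simp only [flip, dimN]; omega
  rcases Nat.lt_or_ge (flip .C n n) r with h3 | h3
  · rw [F1 l hl (by omega) h3, F1 n (by omega) hk' h3, mul_zero, smul_zero]
  obtain rfl : r = flip .C n n := by simp only [flip, dimN] at *; omega
  rw [entryC_left hc hx h1, entryC_center hq hc hx, entryC_low hc hx h1 le_rfl,
    hy l _ hl h1 (multihomog_chainLow c x l (n - l - 1))]
  simp only [mul_smul_comm]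
  match_scalars
  field_simp
  ring

end seriesC

/-! ### Factorization of `f_{lr}` for `so(2n)` -/

section seriesD

variable {n : ℕ} {ħ : ℂ} {A : Type*} [Ring A] [Algebra ℂ A] {ψ : Uminus .D n ħ →ₐ[ℂ] A}
  {c : ℂ} {x x' : ℕ → A}

theorem entryD_low (hc : c = qpow ħ (-1)) (hx : x = fun a => ψ (chev .D n ħ a))
    {i j : ℕ} (hij : i < j) (hj : j ≤ n) :
    ψ (fEntry .D n ħ i j) = chainLow c x i (j - i - 1) := by
  rw [fEntry_low hij (by simp only [dimN]; omega), map_fLow, hc, hx]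

theorem entryD_up (hc : c = qpow ħ (-1)) (hx : x = fun a => ψ (chev .D n ħ a))
    {i j : ℕ} (hij : i < j) (hj : j ≤ n) :
    ψ (fEntry .D n ħ (flip .D n j) (flip .D n i)) = chainUp c x i (j - i - 1) := by
  rw [fEntry_up hij (by simp only [dimN]; omega), map_fUp, hc, hx]

/-- For `so(2n)`, the elements `f_{ln'}` are commutators of the sequence `x'` in which `x_{n-1}` is
replaced with `x_n`; these are the two arms of the Dynkin diagram. -/
theorem entryD_left (hc : c = qpow ħ (-1)) (hx : x = fun a => ψ (chev .D n ħ a))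
    (hx' : x' = fun a => x (if a + 1 = n then n else a)) {i : ℕ} (hi : i < n) :
    ψ (fEntry .D n ħ i (flip .D n n)) = chainLow c x' i (n - i - 1) := by
  rw [fEntry_mid hi.le le_rfl, fMid, fMidD, if_pos rfl, if_neg hi.ne]
  split_ifs with h
  · rw [show n - i - 1 = 0 by omega, chainLow, hx']
    simp only [h, if_true, hx]
  · obtain ⟨d, hd⟩ : ∃ d, n - i - 1 = d + 1 := ⟨n - i - 2, by omega⟩
    rw [map_qcomm, map_fLow, hd, chainLow, ← hx, ← hc, show n - 1 - i - 1 = d by omega,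
      chainLow_congr c (x := x') (y := x)]
    · have h1 : x' (i + d + 1) = ψ (chev .D n ħ n) := by
        rw [hx']
        simp only [show i + d + 1 + 1 = n by omega, if_true, hx]
      rw [h1]
    · intro a h1 h2
      rw [hx']
      simp only [show a + 1 ≠ n by omega, if_false]

theorem entryD_right (hc : c = qpow ħ (-1)) (hx : x = fun a => ψ (chev .D n ħ a))
    (hx' : x' = fun a => x (if a + 1 = n then n else a)) {j : ℕ} (hj : j < n) :
    ψ (fMidDn n ħ j) = chainUp c x' j (n - j - 1) := by
  rw [fMidDn]
  split_ifs with h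
  · rw [show n - j - 1 = 0 by omega, chainUp, hx']
    simp only [h, if_true, hx]
  · obtain ⟨d, hd⟩ : ∃ d, n - j - 1 = d + 1 := ⟨n - j - 2, by omega⟩
    rw [map_qcomm, map_fUp, hd, chainUp, ← hx, ← hc, show n - 1 - j - 1 = d by omega,
      chainUp_congr c (x := x') (y := x)]
    · have h1 : x' (j + d + 1) = ψ (chev .D n ħ n) := by
        rw [hx']
        simp only [show j + d + 1 + 1 = n by omega, if_true, hx]
      rw [h1]
    · intro a h1 h2
      rw [hx']
      simp only [show a + 1 ≠ n by omega, if_false]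

theorem entryD_right' (hc : c = qpow ħ (-1)) (hx : x = fun a => ψ (chev .D n ħ a))
    (hx' : x' = fun a => x (if a + 1 = n then n else a)) {j : ℕ} (hj : j < n) :
    ψ (fEntry .D n ħ n (flip .D n j)) = chainUp c x' j (n - j - 1) := by
  rw [fEntry_mid le_rfl hj.le, fMid, fMidD, if_neg hj.ne, if_pos rfl, entryD_right hc hx hx' hj]

theorem entryD_mid (hc : c = qpow ħ (-1)) (hx : x = fun a => ψ (chev .D n ħ a))
    (hx' : x' = fun a => x (if a + 1 = n then n else a)) {i j : ℕ} (hi : i < n) (hj : j < n) :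
    ψ (fEntry .D n ħ i (flip .D n j)) =
      midForm c c i j (chainUp c x' j (n - j - 1)) (chainLow c x i (n - i - 1)) := by
  rw [fEntry_mid hi.le hj.le, fMid, fMidD, if_neg hj.ne, if_neg hi.ne, midForm]
  split_ifs
  · rw [map_smul, map_qcomm, entryD_right hc hx hx' hj, map_fLow, hc, hx, qpow_neg_one_inv,
      qpow_neg_two]
  · rw [map_qcomm, entryD_right hc hx hx' hj, map_fLow, hc, hx]

/-- The analog of `factorsB`. For `k = n - 1` the ideal has two generators, one for each arm of the
Dynkin diagram, and the relations for `x` and `x'` are independent. -/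
theorem factorsD (hc : c = qpow ħ (-1)) (hx : x = fun a => ψ (chev .D n ħ a))
    (hx' : x' = fun a => x (if a + 1 = n then n else a))
    (hcomm : ∀ a b, 1 ≤ a → b < n → a + 2 ≤ b → Commute (x a) (x b))
    (hcomm' : ∀ a b, 1 ≤ a → b < n → a + 2 ≤ b → Commute (x' a) (x' b))
    {k : ℕ} (hk : 2 ≤ k) (hkn : k < n)
    (hrel : x k * x (k - 1) = c • (x (k - 1) * x k))
    (hrel' : x' k * x' (k - 1) = c • (x' (k - 1) * x' k)) {l r : ℕ} (hl : 1 ≤ l)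
    (hr : r ≤ dimN .D n) :
    (l < k → k < r → ψ (fEntry .D n ħ l r) = 0) ∧
    (l < flip .D n k → flip .D n k < r → ψ (fEntry .D n ħ l r) =
      (c⁻¹ - c) • (ψ (fEntry .D n ħ l (flip .D n k)) * ψ (fEntry .D n ħ (flip .D n k) r))) := by
  have hc0 : c ≠ 0 := hc ▸ qpow_ne_zero _ _
  have F1 : ∀ r ≤ dimN .D n, l < k → k < r → ψ (fEntry .D n ħ l r) = 0 := by
    intro r hr h1 h2
    have h3 : ∀ r, k < r → r ≤ n → chainLow c x l (r - l - 1) = 0 := fun r h3 h4 => by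
      rw [chainLow_factor c c h1 h3 hc0 hrel fun a b h5 h6 h7 =>
        hcomm a b (by omega) (by omega) h7, sub_self, zero_smul]
    rcases Nat.lt_or_ge n r with h4 | h4
    · obtain ⟨j, rfl, hj⟩ : ∃ j, r = flip .D n j ∧ j ≤ n :=
        ⟨flip .D n r, by simp only [flip, dimN] at *; omega, by simp only [flip, dimN] at *; omega⟩
      rcases hj.lt_or_eq with hj | rfl
      · rw [entryD_mid hc hx hx' (by omega) hj, h3 n (by omega) le_rfl, midForm_zero_right]
      · rw [entryD_left hc hx hx' (by omega), chainLow_factor c c h1 hkn hc0 hrel'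
          fun a b h5 h6 h7 => hcomm' a b (by omega) (by omega) h7, sub_self, zero_smul]
    · rw [entryD_low hc hx (by omega) h4, h3 r h2 h4]
  refine ⟨F1 r hr, fun h1 h2 => ?_⟩
  have hk' : k < flip .D n k ∧ flip .D n k ≤ dimN .D n := by simp only [flip, dimN]; omega
  rcases Nat.lt_or_ge l k with h3 | h3
  · rw [F1 r hr h3 (by omega), F1 _ hk'.2 h3 hk'.1, zero_mul, smul_zero]
  obtain ⟨j, rfl, hj, hjk⟩ : ∃ j, r = flip .D n j ∧ 1 ≤ j ∧ j < k :=
    ⟨flip .D n r, by simp only [flip, dimN] at *; omega, by simp only [flip, dimN] at *; omega,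
      by simp only [flip, dimN] at *; omega⟩
  have h4' : chainUp c x' j (n - j - 1) =
      (c⁻¹ - c) • (chainUp c x' k (n - k - 1) * chainUp c x j (k - j - 1)) := by
    rw [chainUp_factor c c⁻¹ hjk hkn (inv_ne_zero hc0) (skew_symm hc0 hrel') fun a b h5 h6 h7 =>
      hcomm' a b (by omega) (by omega) h7]
    congr 2
    refine chainUp_congr c fun a h5 h6 => ?_
    rw [hx']
    simp only [show a + 1 ≠ n by omega, if_false]
  rw [entryD_up hc hx hjk hkn.le]
  rcases Nat.lt_or_ge n l with h5 | h5
  · obtain ⟨m, rfl, hm, hm'⟩ : ∃ m, l = flip .D n m ∧ k < m ∧ m ≤ n :=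
      ⟨flip .D n l, by simp only [flip, dimN] at *; omega, by simp only [flip, dimN] at *; omega,
        by simp only [flip, dimN] at *; omega⟩
    rw [entryD_up hc hx (by omega) hm', entryD_up hc hx hm hm']
    exact chainUp_factor c c⁻¹ hjk hm (inv_ne_zero hc0) (skew_symm hc0 hrel) fun a b h5 h6 h7 =>
      hcomm a b (by omega) (by omega) h7
  rcases h5.lt_or_eq with h5 | rfl
  · rw [entryD_mid hc hx hx' h5 (by omega), entryD_mid hc hx hx' h5 hkn]
    refine midForm_factor_right hc0 (by omega) h4' ?_
    have := (multihomog_chainUp c x j (k - j - 1)).skew_segments (m := n - 1) hc0 (by omega) h3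
      (by omega) (multihomog_chainLow c x l (n - l - 1)) hrel
      fun a b h6 h7 h8 => hcomm a b (by omega) (by omega) h8
    rw [skew_symm (by split_ifs <;> simp [hc0]) this]
    congr 1
    split_ifs <;> simp
  · rw [entryD_right' hc hx hx' (by omega), entryD_right' hc hx hx' hkn]
    exact h4'

/-- The mirror image of `factorsD`. -/
theorem factorsD' (hc : c = qpow ħ (-1)) (hx : x = fun a => ψ (chev .D n ħ a))
    (hx' : x' = fun a => x (if a + 1 = n then n else a))
    (hcomm : ∀ a b, 1 ≤ a → b < n → a + 2 ≤ b → Commute (x a) (x b))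
    (hcomm' : ∀ a b, 1 ≤ a → b < n → a + 2 ≤ b → Commute (x' a) (x' b))
    {k : ℕ} (hk : 2 ≤ k) (hkn : k < n)
    (hrel : x (k - 1) * x k = c • (x k * x (k - 1)))
    (hrel' : x' (k - 1) * x' k = c • (x' k * x' (k - 1))) {l r : ℕ} (hl : 1 ≤ l)
    (hr : r ≤ dimN .D n) :
    (l < flip .D n k → flip .D n k < r → ψ (fEntry .D n ħ l r) = 0) ∧
    (l < k → k < r → ψ (fEntry .D n ħ l r) =
      (c⁻¹ - c) • (ψ (fEntry .D n ħ l k) * ψ (fEntry .D n ħ k r))) := by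
  have hc0 : c ≠ 0 := hc ▸ qpow_ne_zero _ _
  have F1 : ∀ l, 1 ≤ l → l < flip .D n k → flip .D n k < r → ψ (fEntry .D n ħ l r) = 0 := by
    intro l hl h1 h2
    obtain ⟨j, rfl, hj, hjk⟩ : ∃ j, r = flip .D n j ∧ 1 ≤ j ∧ j < k :=
      ⟨flip .D n r, by simp only [flip, dimN] at *; omega, by simp only [flip, dimN] at *; omega,
        by simp only [flip, dimN] at *; omega⟩
    have h4' : chainUp c x' j (n - j - 1) = 0 := by
      rw [chainUp_factor c c hjk hkn hc0 hrel' fun a b h5 h6 h7 =>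
        hcomm' a b (by omega) (by omega) h7, sub_self, zero_smul]
    rcases Nat.lt_or_ge n l with h5 | h5
    · obtain ⟨m, rfl, hm, hm'⟩ : ∃ m, l = flip .D n m ∧ k < m ∧ m ≤ n :=
        ⟨flip .D n l, by simp only [flip, dimN] at *; omega,
          by simp only [flip, dimN] at *; omega, by simp only [flip, dimN] at *; omega⟩
      rw [entryD_up hc hx (by omega) hm', chainUp_factor c c hjk hm hc0 hrel fun a b h5 h6 h7 =>
        hcomm a b (by omega) (by omega) h7, sub_self, zero_smul]
    · rcases h5.lt_or_eq with h5 | rfl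
      · rw [entryD_mid hc hx hx' h5 (by omega), h4', midForm_zero_left]
      · rw [entryD_right' hc hx hx' (by omega), h4']
  refine ⟨F1 l hl, fun h1 h2 => ?_⟩
  have hk' : k < flip .D n k := by simp only [flip, dimN]; omega
  rcases Nat.lt_or_ge (flip .D n k) r with h3 | h3
  · rw [F1 l hl (by omega) h3, F1 k (by omega) hk' h3, mul_zero, smul_zero]
  have h4 : ∀ m, k < m → m ≤ n → chainLow c x l (m - l - 1) =
      (c⁻¹ - c) • (chainLow c x l (k - l - 1) * chainLow c x k (m - k - 1)) := fun m h4 h5 =>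
    chainLow_factor c c⁻¹ h1 h4 (inv_ne_zero hc0) (skew_symm hc0 hrel) fun a b h5 h6 h7 =>
      hcomm a b (by omega) (by omega) h7
  have h6 : chainLow c x' l (k - l - 1) = chainLow c x l (k - l - 1) := by
    refine chainLow_congr c fun a h5 h6 => ?_
    rw [hx']
    simp only [show a + 1 ≠ n by omega, if_false]
  rw [entryD_low hc hx h1 hkn.le]
  rcases Nat.lt_or_ge n r with h5 | h5
  · obtain ⟨j, rfl, hj, hjk⟩ : ∃ j, r = flip .D n j ∧ j ≤ n ∧ k ≤ j :=
      ⟨flip .D n r, by simp only [flip, dimN] at *; omega, by simp only [flip, dimN] at *; omega,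
        by simp only [flip, dimN] at *; omega⟩
    rcases hj.lt_or_eq with hj | rfl
    · rw [entryD_mid hc hx hx' (by omega) hj, entryD_mid hc hx hx' hkn hj]
      refine midForm_factor_left hc0 (by omega) (h4 n hkn le_rfl) ?_
      have h8 := (multihomog_chainLow c x' l (k - l - 1)).skew_segments (m := n - 1)
        (inv_ne_zero hc0) (by omega) hjk (by omega) (multihomog_chainUp c x' j (n - j - 1))
        (skew_symm hc0 hrel') fun a b h6 h7 h8 => hcomm' a b (by omega) (by omega) h8
      rw [h6] at h8
      rw [h8]
      simp only [eq_comm]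
    · rw [entryD_left hc hx hx' (by omega), entryD_left hc hx hx' hkn, ← h6]
      exact chainLow_factor c c⁻¹ h1 hkn (inv_ne_zero hc0) (skew_symm hc0 hrel')
        fun a b h5 h6 h7 => hcomm' a b (by omega) (by omega) h7
  · rw [entryD_low hc hx (by omega) h5, entryD_low hc hx h2 h5]
    exact h4 r h2 h5

end seriesD

/-! ### Factorization of `f_{lr}` modulo `J_k` -/

section ideals

variable {t : Series} {n : ℕ} {ħ : ℂ}

/-- The projection to the quotient by `J_k`. -/
def quotJ (t : Series) (n : ℕ) (ħ : ℂ) (k : ℕ) :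
    Uminus t n ħ →ₐ[ℂ] (idealJ t n ħ k).ringCon.Quotient :=
  (idealJ t n ħ k).ringCon.mkₐ ℂ

theorem quotJ_eq_iff {k : ℕ} {u v : Uminus t n ħ} :
    quotJ t n ħ k u = quotJ t n ħ k v ↔ u - v ∈ idealJ t n ħ k := by
  rw [← TwoSidedIdeal.rel_iff]
  exact (idealJ t n ħ k).ringCon.eq

theorem quotJ_eq_zero {k : ℕ} {u : Uminus t n ħ} (hu : u ∈ idealJ t n ħ k) :
    quotJ t n ħ k u = 0 := by
  rw [← map_zero (quotJ t n ħ k), quotJ_eq_iff, sub_zero]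
  exact hu

theorem eps_middle_B : eps .B n (n + 1) = 0 := by
  have h := eps_flip (t := .B) (n := n) (i := n + 1) (by simp only [dimN]; omega)
  rw [show flip .B n (n + 1) = n + 1 by simp only [flip, dimN]; omega] at h
  exact self_eq_neg.1 h

theorem eps_sub_succ {a : ℕ} (han : a ≤ n) (hD : t = .D → a < n) :
    eps t n a - eps t n (a + 1) = simpleRoot t n a := by
  rw [simpleRoot.eq_def]
  split_ifs with h
  · rfl
  obtain rfl : a = n := by omega
  cases t
  · rw [eps_middle_B, sub_zero]
  · have h1 := eps_flip (t := .C) (n := a) (i := a) (by simp only [dimN]; omega)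
    rw [show flip .C a a = a + 1 by simp only [flip, dimN]; omega] at h1
    rw [h1, sub_neg_eq_add]
    exact (two_smul ℕ _).symm
  · exact absurd (hD rfl) h

theorem eps_neg_sub {a b : ℕ} (ha : a ≤ dimN t n) (hb : b ≤ dimN t n) :
    eps t n (flip t n b) - eps t n (flip t n a) = eps t n a - eps t n b := by
  rw [eps_flip ha, eps_flip hb]
  abel

theorem mem_idealJ_low (hq : ∀ m : ℕ, 0 < m → Complex.exp ħ ^ m ≠ 1) (hD : t = .D → 3 ≤ n)
    {k : ℕ} (hk : 2 ≤ k) (hkn : k ≤ n) (hkD : t = .D → k < n) :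
    fEntry t n ħ (k - 1) (k + 1) ∈ idealJ t n ħ k := by
  have hN : k + 1 ≤ dimN t n := by cases t <;> simp only [dimN] <;> omega
  refine TwoSidedIdeal.subset_span ⟨k - 1, k + 1, k - 1, k, ?_, ?_, by omega, by omega, ?_, ?_,
    ?_, rfl⟩
  · refine cover_of hD ((prec_iff hD).2 ⟨by omega, by omega, by omega, by omega⟩) (.inl (by omega))
  · refine cover_of hD ((prec_iff hD).2 ⟨by omega, by omega, by omega, by grind⟩) (.inl (by omega))
  · have := eps_sub_succ (t := t) (n := n) (a := k - 1) (by omega) (by omega)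
    rwa [Nat.sub_add_cancel (by omega)] at this
  · exact eps_sub_succ hkn hkD
  · have := not_commute_chev (t := t) (n := n) (a := k - 1) hq hD (by omega) (by omega)
      (by grind)
    rwa [Nat.sub_add_cancel (by omega)] at this

theorem mem_idealJ_up (hq : ∀ m : ℕ, 0 < m → Complex.exp ħ ^ m ≠ 1) (hD : t = .D → 3 ≤ n)
    {k : ℕ} (hk : 2 ≤ k) (hkn : k ≤ n) (hkD : t = .D → k < n) :
    fEntry t n ħ (flip t n (k + 1)) (flip t n (k - 1)) ∈ idealJ t n ħ (flip t n k) := by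
  have hN : k + 1 ≤ dimN t n := by cases t <;> simp only [dimN] <;> omega
  have hf : t = .D → k + 1 ≤ n → n < flip t n (k + 1) := fun _ => le_flip
  refine TwoSidedIdeal.subset_span ⟨flip t n (k + 1), flip t n (k - 1), k, k - 1, ?_, ?_, by omega,
    by omega, ?_, ?_, ?_, rfl⟩
  · refine cover_of hD ((prec_iff hD).2 ?_) ?_ <;> simp only [flip] at * <;> grind
  · refine cover_of hD ((prec_iff hD).2 ?_) ?_ <;> simp only [flip] at * <;> grind
  · rw [eps_neg_sub (by omega) hN]
    exact eps_sub_succ hkn hkD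
  · rw [eps_neg_sub (by omega) (by omega)]
    have := eps_sub_succ (t := t) (n := n) (a := k - 1) (by omega) (by omega)
    rwa [Nat.sub_add_cancel (by omega)] at this
  · have := not_commute_chev (t := t) (n := n) (a := k - 1) hq hD (by omega) (by omega)
      (by grind)
    rw [Nat.sub_add_cancel (by omega)] at this
    exact fun h => this h.symm

theorem eps_sub_fork (hn : 3 ≤ n) :
    eps .D n (n - 1) - eps .D n (flip .D n n) = simpleRoot .D n n := by
  rw [eps_flip (by simp only [dimN]; omega), sub_neg_eq_add, simpleRoot.eq_def,
    if_neg (lt_irrefl _)]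

/-- For `so(2n)` and `k = n - 1` there is a second immediate successor `n'`. -/
theorem mem_idealJ_left_D (hq : ∀ m : ℕ, 0 < m → Complex.exp ħ ^ m ≠ 1) (hn : 3 ≤ n) :
    fEntry .D n ħ (n - 2) (flip .D n n) ∈ idealJ .D n ħ (n - 1) := by
  have hf : flip .D n n = n + 1 := by simp only [flip, dimN]; omega
  have hD : Series.D = .D → 3 ≤ n := fun _ => hn
  refine TwoSidedIdeal.subset_span ⟨n - 2, flip .D n n, n - 2, n, ?_, ?_, by omega, by omega,
    ?_, eps_sub_fork hn, not_commute_chev_fork hq hn, rfl⟩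
  · refine cover_of hD ((prec_iff hD).2 ⟨by omega, ?_, by omega, by omega⟩) (.inl (by omega))
    simp only [dimN]; omega
  · rw [hf]
    refine cover_of hD ((prec_iff hD).2 ⟨by omega, ?_, by omega, by omega⟩)
      (.inr (.inl ⟨rfl, by omega, rfl⟩))
    simp only [dimN]; omega
  · have := eps_sub_succ (t := .D) (n := n) (a := n - 2) (by omega) (by omega)
    rwa [show n - 2 + 1 = n - 1 by omega] at this

theorem mem_idealJ_right_D (hq : ∀ m : ℕ, 0 < m → Complex.exp ħ ^ m ≠ 1) (hn : 3 ≤ n) :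
    fEntry .D n ħ n (flip .D n (n - 2)) ∈ idealJ .D n ħ (flip .D n (n - 1)) := by
  have hf : flip .D n (n - 1) = n + 2 := by simp only [flip, dimN]; omega
  have hf' : flip .D n (n - 2) = n + 3 := by simp only [flip, dimN]; omega
  have hff : flip .D n (flip .D n n) = n := by simp only [flip, dimN]; omega
  have hD : Series.D = .D → 3 ≤ n := fun _ => hn
  have hN : dimN .D n = 2 * n := rfl
  have hF : flip .D n n ≤ dimN .D n := by simp only [flip, dimN]; omega
  refine TwoSidedIdeal.subset_span ⟨n, flip .D n (n - 2), n, n - 2, ?_, ?_, by omega, by omega,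
    ?_, ?_, fun h => not_commute_chev_fork hq hn h.symm, rfl⟩
  · rw [hf]
    exact cover_of hD ((prec_iff hD).2 ⟨by omega, by omega, by omega, by omega⟩)
      (.inr (.inr ⟨rfl, rfl, rfl⟩))
  · rw [hf, hf']
    exact cover_of hD ((prec_iff hD).2 ⟨by omega, by omega, by omega, by omega⟩) (.inl (by omega))
  · rw [← eps_sub_fork hn, ← eps_neg_sub (by omega) hF, hff]
  · rw [eps_neg_sub (by omega) (by omega)]
    have := eps_sub_succ (t := .D) (n := n) (a := n - 2) (by omega) (by omega)
    rwa [show n - 2 + 1 = n - 1 by omega] at this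

variable {A : Type*} [Ring A] [Algebra ℂ A]

theorem rel_of_chainLow {c : ℂ} {x : ℕ → A} {k : ℕ} (hk : 1 ≤ k)
    (h : chainLow c x (k - 1) 1 = 0) : x k * x (k - 1) = c • (x (k - 1) * x k) := by
  rw [chainLow, chainLow, add_zero, Nat.sub_add_cancel hk] at h
  exact sub_eq_zero.1 h

theorem rel_of_chainUp {c : ℂ} {x : ℕ → A} {k : ℕ} (hk : 1 ≤ k)
    (h : chainUp c x (k - 1) 1 = 0) : x (k - 1) * x k = c • (x k * x (k - 1)) := by
  rw [chainUp, chainUp, add_zero, Nat.sub_add_cancel hk] at h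
  exact sub_eq_zero.1 h

theorem commute_chev_chain (hq : ∀ m : ℕ, 0 < m → Complex.exp ħ ^ m ≠ 1) (hD : t = .D → 3 ≤ n)
    (ψ : Uminus t n ħ →ₐ[ℂ] A) {a b : ℕ} (ha : 1 ≤ a) (hb : b ≤ n) (hab : a + 2 ≤ b)
    (h : t = .D → b = n → a + 2 < n) : Commute (ψ (chev t n ħ a)) (ψ (chev t n ħ b)) :=
  (commute_chev hq hD ha hb (by omega) (inn_simpleRoot_eq_zero ha hb hab h)).map ψ

/-- A homomorphism vanishing on `J_k`, `k ≤ s`, annihilates `f_{lr}` for `l < k < r` and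
factorizes `f_{lr}` for `l < k' < r`. -/
theorem factors_low (hq : ∀ m : ℕ, 0 < m → Complex.exp ħ ^ m ≠ 1) (hD : t = .D → 3 ≤ n)
    (ψ : Uminus t n ħ →ₐ[ℂ] A) {k : ℕ} (hk : 2 ≤ k) (hks : k ≤ sRank t n)
    (hψ : ∀ u ∈ idealJ t n ħ k, ψ u = 0) {l r : ℕ} (hl : 1 ≤ l) (hr : r ≤ dimN t n) :
    (l < k → k < r → ψ (fEntry t n ħ l r) = 0) ∧
    (l < flip t n k → flip t n k < r → ψ (fEntry t n ħ l r) =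
      (qpow ħ 1 - qpow ħ (-1)) •
        (ψ (fEntry t n ħ l (flip t n k)) * ψ (fEntry t n ħ (flip t n k) r))) := by
  rw [← qpow_neg_one_inv]
  have h2 : k + 1 - (k - 1) - 1 = 1 := by omega
  have hcomm := fun a b ha hb hab => commute_chev_chain hq hD ψ (a := a) (b := b) ha hb hab
  cases t
  · simp only [sRank] at hks
    have h1 := hψ _ (mem_idealJ_low hq hD hk hks (by simp))
    rw [entryB_low rfl rfl (by omega) (by omega), h2] at h1
    exact factorsB rfl rfl (fun a b ha hb hab => hcomm a b ha hb hab (by simp)) hk hks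
      (rel_of_chainLow (by omega) h1) hl hr
  · simp only [sRank] at hks
    have h1 := hψ _ (mem_idealJ_low hq hD hk hks (by simp))
    rcases hks.lt_or_eq with h3 | rfl
    · rw [entryC_low rfl rfl (by omega) (by omega), h2] at h1
      exact factorsC rfl rfl (fun a b ha hb hab => hcomm a b ha hb hab (by simp)) hk h3
        (rel_of_chainLow (by omega) h1) hl hr
    · rw [show k + 1 = flip .C k k by simp only [flip, dimN]; omega,
        entryC_left rfl rfl (by omega), show k - (k - 1) - 1 = 0 by omega, chainLow,
        sub_eq_zero] at h1
      have hs := serreChain_C (n := k) hq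
      refine factorsC_last hq rfl rfl ⟨fun a b h3 h4 h5 => (hs.comm a b h3 h4 h5).map ψ,
        fun a b h3 h4 h5 h6 h7 => ?_⟩ (fun a b ha hb hab => hcomm a b ha hb hab (by simp)) hk
        h1 hl hr
      simpa using congrArg ψ (hs.serre a b h3 h4 h5 h6 h7)
  · simp only [sRank] at hks
    have hn := hD rfl
    have h1 := hψ _ (mem_idealJ_low hq hD hk (by omega) (by omega))
    rw [entryD_low rfl rfl (by omega) (by omega), h2] at h1
    have h4 := rel_of_chainLow (by omega) h1
    refine factorsD rfl rfl rfl (fun a b ha hb hab => hcomm a b ha hb.le hab (by omega))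
      (fun a b ha hb hab => ?_) hk (by omega) h4 ?_ hl hr
    · rw [if_neg (by omega)]
      split_ifs with h5
      · exact hcomm a n ha le_rfl (by omega) (by omega)
      · exact hcomm a b ha hb.le hab (by omega)
    · by_cases h5 : k + 1 = n
      · obtain rfl : k = n - 1 := by omega
        have h6 := hψ _ (mem_idealJ_left_D hq hn)
        rw [entryD_left rfl rfl rfl (by omega), show n - (n - 2) - 1 = 1 by omega,
          show n - 2 = n - 1 - 1 by omega] at h6
        exact rel_of_chainLow (by omega) h6
      · rw [if_neg h5, if_neg (by omega)]
        exact h4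

/-- The mirror image of `factors_low`, for `J_{k'}`. -/
theorem factors_up (hq : ∀ m : ℕ, 0 < m → Complex.exp ħ ^ m ≠ 1) (hD : t = .D → 3 ≤ n)
    (ψ : Uminus t n ħ →ₐ[ℂ] A) {k : ℕ} (hk : 2 ≤ k) (hks : k ≤ sRank t n)
    (hψ : ∀ u ∈ idealJ t n ħ (flip t n k), ψ u = 0) {l r : ℕ} (hl : 1 ≤ l) (hr : r ≤ dimN t n) :
    (l < flip t n k → flip t n k < r → ψ (fEntry t n ħ l r) = 0) ∧
    (l < k → k < r → ψ (fEntry t n ħ l r) =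
      (qpow ħ 1 - qpow ħ (-1)) • (ψ (fEntry t n ħ l k) * ψ (fEntry t n ħ k r))) := by
  rw [← qpow_neg_one_inv]
  have h2 : k + 1 - (k - 1) - 1 = 1 := by omega
  have hcomm := fun a b ha hb hab => commute_chev_chain hq hD ψ (a := a) (b := b) ha hb hab
  cases t
  · simp only [sRank] at hks
    have h1 := hψ _ (mem_idealJ_up hq hD hk hks (by simp))
    rw [entryB_up rfl rfl (by omega) (by omega), h2] at h1
    exact factorsB' rfl rfl (fun a b ha hb hab => hcomm a b ha hb hab (by simp)) hk hks
      (rel_of_chainUp (by omega) h1) hl hr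
  · simp only [sRank] at hks
    have h1 := hψ _ (mem_idealJ_up hq hD hk hks (by simp))
    rcases hks.lt_or_eq with h3 | rfl
    · rw [entryC_up rfl rfl (by omega) (by omega), h2] at h1
      exact factorsC' rfl rfl (fun a b ha hb hab => hcomm a b ha hb hab (by simp)) hk h3
        (rel_of_chainUp (by omega) h1) hl hr
    · rw [show flip .C k (k + 1) = k by simp only [flip, dimN]; omega,
        entryC_right rfl rfl (by omega), show k - (k - 1) - 1 = 0 by omega, chainUp,
        sub_eq_zero] at h1
      exact factorsC_last' hq rfl rfl (fun a b ha hb hab => hcomm a b ha hb hab (by simp)) hk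
        h1 hl hr
  · simp only [sRank] at hks
    have hn := hD rfl
    have h1 := hψ _ (mem_idealJ_up hq hD hk (by omega) (by omega))
    rw [entryD_up rfl rfl (by omega) (by omega), h2] at h1
    have h4 := rel_of_chainUp (by omega) h1
    refine factorsD' rfl rfl rfl (fun a b ha hb hab => hcomm a b ha hb.le hab (by omega))
      (fun a b ha hb hab => ?_) hk (by omega) h4 ?_ hl hr
    · rw [if_neg (by omega)]
      split_ifs with h5
      · exact hcomm a n ha le_rfl (by omega) (by omega)
      · exact hcomm a b ha hb.le hab (by omega)
    · by_cases h5 : k + 1 = n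
      · obtain rfl : k = n - 1 := by omega
        have h6 := hψ _ (mem_idealJ_right_D hq hn)
        rw [entryD_right' rfl rfl rfl (by omega), show n - (n - 2) - 1 = 1 by omega,
          show n - 2 = n - 1 - 1 by omega] at h6
        exact rel_of_chainUp (by omega) h6
      · rw [if_neg h5, if_neg (by omega)]
        exact h4

/-- The relations for `f_{lr}` that drive both congruences; the roles of `factors_low` and
`factors_up` are exchanged when `k` lies in the right half. -/
theorem fEntry_factors (hq : ∀ m : ℕ, 0 < m → Complex.exp ħ ^ m ≠ 1) (hD : t = .D → 3 ≤ n)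
    {i j k : ℕ} (hi : 1 ≤ i) (hj : j ≤ dimN t n) (hk : k ∈ SigmaSet t n i j) {l r : ℕ}
    (hl : 1 ≤ l) (hlk : l < k) (hkr : k < r) (hr : r ≤ dimN t n) :
    fEntry t n ħ l r ∈ idealJ t n ħ k ∧
    fEntry t n ħ l r - (qpow ħ 1 - qpow ħ (-1)) • (fEntry t n ħ l k * fEntry t n ħ k r) ∈
      idealJ t n ħ (flip t n k) := by
  obtain ⟨⟨h1, h2⟩, h3⟩ := hk
  constructor
  · rw [← sub_zero (fEntry t n ħ l r), ← quotJ_eq_iff, map_zero]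
    rcases h3 with h3 | h3
    · exact (factors_low hq hD _ (by omega) h3.2 (fun u => quotJ_eq_zero) hl hr).1 hlk hkr
    · obtain ⟨m, rfl, hm⟩ : ∃ m, k = flip t n m ∧ 2 ≤ m ∧ m ≤ sRank t n := by
        refine ⟨flip t n k, ?_⟩
        cases t <;> simp only [flip, dimN, sRank] at * <;> omega
      exact (factors_up hq hD _ hm.1 hm.2 (fun u => quotJ_eq_zero) hl hr).1 hlk hkr
  · rw [← quotJ_eq_iff, map_smul, map_mul]
    rcases h3 with h3 | h3
    · exact (factors_up hq hD _ (by omega) h3.2 (fun u => quotJ_eq_zero) hl hr).2 hlk hkr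
    · obtain ⟨m, rfl, hm⟩ : ∃ m, k = flip t n m ∧ 2 ≤ m ∧ m ≤ sRank t n := by
        refine ⟨flip t n k, ?_⟩
        cases t <;> simp only [flip, dimN, sRank] at * <;> omega
      have h4 : flip t n (flip t n m) = m := by
        cases t <;> simp only [flip, dimN, sRank] at * <;> omega
      exact (factors_low hq hD (quotJ t n ħ _) hm.1 hm.2
        (fun u hu => quotJ_eq_zero (by rwa [h4])) hl hr).2 hlk hkr

end ideals

/-! ### Routes through a separating node -/

section routes

variable {t : Series} {n : ℕ}

theorem Prec.lt (hD : t = .D → 3 ≤ n) {i j : ℕ} (h : Prec t n i j) : i < j :=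
  ((prec_iff hD).1 h).2.2.1

theorem Prec.trans (hD : t = .D → 3 ≤ n) {i j k : ℕ} (h : Prec t n i j) (h' : Prec t n j k) :
    Prec t n i k :=
  ⟨h.1.trans h'.1, ((h.lt hD).trans (h'.lt hD)).ne⟩

/-- Routes from `i` to `j` are the sets of nodes in between that form a chain together with the
end points. -/
theorem mem_routes (hD : t = .D → 3 ≤ n) {i j : ℕ} (hij : i < j) {S : Finset ℕ} :
    S ∈ routes t n i j ↔ S ⊆ Finset.Ioo i j ∧
      ∀ a ∈ insert i (insert j S), ∀ b ∈ insert i (insert j S), a < b → Prec t n a b := by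
  classical
  refine Finset.mem_filter.trans ?_
  rw [Finset.mem_powerset]
  refine and_congr_right fun hS => ?_
  have : IsTrans ℕ (Prec t n) := ⟨fun _ _ _ h h' => h.trans hD h'⟩
  rw [List.isChain_iff_pairwise]
  have hmem : ∀ a, a ∈ i :: (S.sort (· ≤ ·) ++ [j]) ↔ a ∈ insert i (insert j S) := by
    intro a
    simp only [List.mem_cons, List.mem_append, Finset.mem_sort, Finset.mem_insert,
      List.not_mem_nil, or_false]
    tauto
  have hlt : List.Pairwise (· < ·) (i :: (S.sort (· ≤ ·) ++ [j])) := by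
    rw [List.pairwise_cons, List.pairwise_append]
    refine ⟨fun a ha => ?_, Finset.sortedLT_sort S |>.pairwise, List.pairwise_singleton _ _,
      fun a ha b hb => ?_⟩
    · rcases List.mem_append.1 ha with ha | ha
      · exact (Finset.mem_Ioo.1 (hS ((Finset.mem_sort _).1 ha))).1
      · rwa [List.mem_singleton.1 ha]
    · rw [List.mem_singleton.1 hb]
      exact (Finset.mem_Ioo.1 (hS ((Finset.mem_sort _).1 ha))).2
  constructor
  · intro h a ha b hb hab
    have : Std.Symm fun a b => (a < b → Prec t n a b) ∧ (b < a → Prec t n b a) :=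
      ⟨fun _ _ h => ⟨h.2, h.1⟩⟩
    have h1 := h.imp (S := fun a b => (a < b → Prec t n a b) ∧ (b < a → Prec t n b a))
      fun {a b} h => ⟨fun _ => h, fun h' => absurd (h.lt hD) h'.asymm⟩
    exact (h1.forall ((hmem a).2 ha) ((hmem b).2 hb) hab.ne).1 hab
  · intro h
    exact hlt.imp_of_mem fun ha hb hab => h _ ((hmem _).1 ha) _ ((hmem _).1 hb) hab

theorem mem_between {i j l : ℕ} :
    l ∈ between t n i j ↔ Preceq t n i l ∧ Prec t n l j := by
  classical
  refine Finset.mem_filter.trans ?_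
  rw [Finset.mem_range]
  exact ⟨fun h => h.2, fun h => ⟨by have := h.2.1.1; omega, h⟩⟩

theorem sort_union {S₁ S₂ : Finset ℕ} (h : ∀ a ∈ S₁, ∀ b ∈ S₂, a < b) :
    (S₁ ∪ S₂).sort (· ≤ ·) = S₁.sort (· ≤ ·) ++ S₂.sort (· ≤ ·) := by
  have hlt : (S₁.sort (· ≤ ·) ++ S₂.sort (· ≤ ·)).Pairwise (· < ·) :=
    List.pairwise_append.2 ⟨(Finset.sortedLT_sort S₁).pairwise, (Finset.sortedLT_sort S₂).pairwise,
      fun a ha b hb => h a ((Finset.mem_sort _).1 ha) b ((Finset.mem_sort _).1 hb)⟩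
  have h1 : (S₁.sort (· ≤ ·) ++ S₂.sort (· ≤ ·)).toFinset = S₁ ∪ S₂ := by
    ext a
    simp
  rw [← h1]
  exact (List.toFinset_sort (· ≤ ·) (hlt.imp fun h => h.ne)).2 (hlt.imp fun h => h.le)

variable {i j k : ℕ}

/-- Comparability of a node `k` with all nodes between `i` and `j`. -/
def Separates (t : Series) (n i k j : ℕ) : Prop :=
  Prec t n i k ∧ Prec t n k j ∧
    ∀ l, Preceq t n i l → Preceq t n l j → (l < k → Prec t n l k) ∧ (k < l → Prec t n k l)

theorem union_mem_routes (hD : t = .D → 3 ≤ n) (hk : Separates t n i k j) {S₁ S₂ : Finset ℕ}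
    (h₁ : S₁ ∈ routes t n i k) (h₂ : S₂ ∈ routes t n k j) :
    S₁ ∪ S₂ ∈ routes t n i j ∧ S₁ ∪ insert k S₂ ∈ routes t n i j := by
  have hik := hk.1.lt hD
  have hkj := hk.2.1.lt hD
  rw [mem_routes hD hik] at h₁
  rw [mem_routes hD hkj] at h₂
  have hsub : S₁ ∪ insert k S₂ ⊆ Finset.Ioo i j := by
    intro a ha
    rw [Finset.mem_union, Finset.mem_insert] at ha
    rw [Finset.mem_Ioo]
    rcases ha with ha | rfl | ha
    · have := Finset.mem_Ioo.1 (h₁.1 ha); omega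
    · exact ⟨hik, hkj⟩
    · have := Finset.mem_Ioo.1 (h₂.1 ha); omega
  have hsub' : S₁ ∪ S₂ ⊆ S₁ ∪ insert k S₂ :=
    Finset.union_subset_union_right (Finset.subset_insert _ _)
  have hside : ∀ a ∈ insert i (insert j (S₁ ∪ insert k S₂)),
      (a ≤ k ∧ a ∈ insert i (insert k S₁)) ∨ (k ≤ a ∧ a ∈ insert k (insert j S₂)) := by
    intro a ha
    simp only [Finset.mem_insert, Finset.mem_union] at ha ⊢
    rcases ha with rfl | rfl | ha | rfl | ha
    · exact .inl ⟨hik.le, by tauto⟩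
    · exact .inr ⟨hkj.le, by tauto⟩
    · exact .inl ⟨(Finset.mem_Ioo.1 (h₁.1 ha)).2.le, by tauto⟩
    · exact .inl ⟨le_rfl, by tauto⟩
    · exact .inr ⟨(Finset.mem_Ioo.1 (h₂.1 ha)).1.le, by tauto⟩
  have hpair : ∀ a ∈ insert i (insert j (S₁ ∪ insert k S₂)),
      ∀ b ∈ insert i (insert j (S₁ ∪ insert k S₂)), a < b → Prec t n a b := by
    intro a ha b hb hab
    rcases hside a ha with ⟨ha', ha⟩ | ⟨ha', ha⟩ <;> rcases hside b hb with ⟨hb', hb⟩ | ⟨hb', hb⟩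
    · exact h₁.2 a ha b hb hab
    · rcases ha'.lt_or_eq with ha' | rfl
      · rcases hb'.lt_or_eq with hb' | rfl
        · exact (h₁.2 a ha k (by simp) ha').trans hD (h₂.2 k (by simp) b hb hb')
        · exact h₁.2 a ha _ (by simp) ha'
      · exact h₂.2 _ (by simp) b hb hab
    · omega
    · exact h₂.2 a ha b hb hab
  rw [mem_routes hD (hik.trans hkj), mem_routes hD (hik.trans hkj)]
  refine ⟨⟨hsub'.trans hsub, fun a ha b hb => hpair a ?_ b ?_⟩, hsub, hpair⟩
  · exact Finset.insert_subset_insert _ (Finset.insert_subset_insert _ hsub') ha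
  · exact Finset.insert_subset_insert _ (Finset.insert_subset_insert _ hsub') hb

theorem filter_mem_routes (hD : t = .D → 3 ≤ n) (hk : Separates t n i k j) {S : Finset ℕ}
    (h : S ∈ routes t n i j) :
    S.filter (· < k) ∈ routes t n i k ∧ S.filter (k < ·) ∈ routes t n k j := by
  have hik := hk.1.lt hD
  have hkj := hk.2.1.lt hD
  rw [mem_routes hD (hik.trans hkj)] at h
  have hcmp : ∀ a ∈ S, (a < k → Prec t n a k) ∧ (k < a → Prec t n k a) := by
    intro a ha
    have h1 := Finset.mem_Ioo.1 (h.1 ha)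
    exact hk.2.2 a (h.2 i (by simp) a (by simp [ha]) h1.1).1
      (h.2 a (by simp [ha]) j (by simp) h1.2).1
  rw [mem_routes hD hik, mem_routes hD hkj]
  refine ⟨⟨fun a ha => ?_, fun a ha b hb hab => ?_⟩, ⟨fun a ha => ?_, fun a ha b hb hab => ?_⟩⟩
  · rw [Finset.mem_filter] at ha
    exact Finset.mem_Ioo.2 ⟨(Finset.mem_Ioo.1 (h.1 ha.1)).1, ha.2⟩
  · simp only [Finset.mem_insert, Finset.mem_filter] at ha hb
    rcases hb with rfl | rfl | hb
    · rcases ha with rfl | rfl | ha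
      · omega
      · omega
      · have := Finset.mem_Ioo.1 (h.1 ha.1); omega
    · rcases ha with rfl | rfl | ha
      · exact hk.1
      · omega
      · exact (hcmp a ha.1).1 ha.2
    · rcases ha with rfl | rfl | ha
      · exact h.2 a (by simp) b (by simp [hb.1]) hab
      · omega
      · exact h.2 a (by simp [ha.1]) b (by simp [hb.1]) hab
  · rw [Finset.mem_filter] at ha
    exact Finset.mem_Ioo.2 ⟨ha.2, (Finset.mem_Ioo.1 (h.1 ha.1)).2⟩
  · simp only [Finset.mem_insert, Finset.mem_filter] at ha hb
    rcases ha with rfl | rfl | ha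
    · rcases hb with rfl | rfl | hb
      · omega
      · exact hk.2.1
      · exact (hcmp b hb.1).2 hb.2
    · rcases hb with rfl | rfl | hb
      · omega
      · omega
      · have := Finset.mem_Ioo.1 (h.1 hb.1); omega
    · rcases hb with rfl | rfl | hb
      · omega
      · exact h.2 a (by simp [ha.1]) b (by simp) hab
      · exact h.2 a (by simp [ha.1]) b (by simp [hb.1]) hab

/-- Routes from `i` to `j` come in pairs, with and without `k`, and are composed of routes from
`i` to `k` and from `k` to `j`. -/
theorem sum_routes (hD : t = .D → 3 ≤ n) (hk : Separates t n i k j) {M : Type*}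
    [AddCommMonoid M] (g : Finset ℕ → M) :
    ∑ S ∈ routes t n i j, g S =
      ∑ p ∈ routes t n i k ×ˢ routes t n k j, (g (p.1 ∪ insert k p.2) + g (p.1 ∪ p.2)) := by
  have hik := hk.1.lt hD
  have hkj := hk.2.1.lt hD
  have hlt : ∀ p ∈ routes t n i k ×ˢ routes t n k j, (∀ a ∈ p.1, a < k) ∧ (∀ a ∈ p.2, k < a) := by
    intro p hp
    rw [Finset.mem_product, mem_routes hD hik, mem_routes hD hkj] at hp
    exact ⟨fun a ha => (Finset.mem_Ioo.1 (hp.1.1 ha)).2,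
      fun a ha => (Finset.mem_Ioo.1 (hp.2.1 ha)).1⟩
  rw [Finset.sum_add_distrib, ← Finset.sum_filter_add_sum_filter_not _ (fun S => k ∈ S)]
  congr 1
  · refine Finset.sum_nbij' (fun S => (S.filter (· < k), S.filter (k < ·)))
      (fun p => p.1 ∪ insert k p.2) ?_ ?_ ?_ ?_ ?_
    · intro S hS
      exact Finset.mem_product.2 (filter_mem_routes hD hk (Finset.mem_filter.1 hS).1)
    · intro p hp
      have := Finset.mem_product.1 hp
      exact Finset.mem_filter.2 ⟨(union_mem_routes hD hk this.1 this.2).2, by simp⟩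
    · intro S hS
      have := (Finset.mem_filter.1 hS).2
      ext a
      simp only [Finset.mem_union, Finset.mem_filter, Finset.mem_insert]
      rcases lt_trichotomy a k with h | rfl | h
      · simp [h, h.ne, h.asymm]
      · simp [this]
      · simp [h, h.ne', h.asymm]
    · intro p hp
      obtain ⟨h1, h2⟩ := hlt p hp
      ext a <;> simp only [Finset.mem_union, Finset.mem_filter, Finset.mem_insert] <;>
        have := h1 a <;> have := h2 a <;> grind
    · intro S hS
      have := (Finset.mem_filter.1 hS).2
      congr 1
      ext a
      simp only [Finset.mem_union, Finset.mem_filter, Finset.mem_insert]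
      rcases lt_trichotomy a k with h | rfl | h
      · simp [h, h.ne, h.asymm]
      · simp [this]
      · simp [h, h.ne', h.asymm]
  · refine Finset.sum_nbij' (fun S => (S.filter (· < k), S.filter (k < ·)))
      (fun p => p.1 ∪ p.2) ?_ ?_ ?_ ?_ ?_
    · intro S hS
      exact Finset.mem_product.2 (filter_mem_routes hD hk (Finset.mem_filter.1 hS).1)
    · intro p hp
      have := Finset.mem_product.1 hp
      obtain ⟨h1, h2⟩ := hlt p hp
      refine Finset.mem_filter.2 ⟨(union_mem_routes hD hk this.1 this.2).1, fun h => ?_⟩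
      rcases Finset.mem_union.1 h with h | h
      · exact lt_irrefl _ (h1 k h)
      · exact lt_irrefl _ (h2 k h)
    · intro S hS
      have := (Finset.mem_filter.1 hS).2
      ext a
      simp only [Finset.mem_union, Finset.mem_filter]
      rcases lt_trichotomy a k with h | rfl | h
      · simp [h, h.asymm]
      · simp [this]
      · simp [h, h.asymm]
    · intro p hp
      obtain ⟨h1, h2⟩ := hlt p hp
      ext a <;> simp only [Finset.mem_union, Finset.mem_filter] <;>
        have := h1 a <;> have := h2 a <;> grind
    · intro S hS
      have := (Finset.mem_filter.1 hS).2
      congr 1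
      ext a
      simp only [Finset.mem_union, Finset.mem_filter]
      rcases lt_trichotomy a k with h | rfl | h
      · simp [h, h.asymm]
      · simp [this]
      · simp [h, h.asymm]

/-- The nodes left out by a composite route. -/
theorem between_sdiff (hD : t = .D → 3 ≤ n) (hk : Separates t n i k j) {S₁ S₂ : Finset ℕ}
    (h₁ : S₁ ∈ routes t n i k) (h₂ : S₂ ∈ routes t n k j) :
    between t n i j \ insert i (S₁ ∪ insert k S₂) =
      (between t n i k \ insert i S₁) ∪ (between t n k j \ insert k S₂) ∧
    between t n i j \ insert i (S₁ ∪ S₂) =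
      insert k (between t n i j \ insert i (S₁ ∪ insert k S₂)) ∧
    Disjoint (between t n i k \ insert i S₁) (between t n k j \ insert k S₂) := by
  have hik := hk.1.lt hD
  have hkj := hk.2.1.lt hD
  rw [mem_routes hD hik] at h₁
  rw [mem_routes hD hkj] at h₂
  have hs1 : ∀ a ∈ S₁, a < k := fun a ha => (Finset.mem_Ioo.1 (h₁.1 ha)).2
  have hs2 : ∀ a ∈ S₂, k < a := fun a ha => (Finset.mem_Ioo.1 (h₂.1 ha)).1
  have hlow : ∀ a, a ∈ between t n i k ↔ a ∈ between t n i j ∧ a < k := by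
    intro a
    rw [mem_between, mem_between]
    exact ⟨fun h => ⟨⟨h.1, h.2.trans hD hk.2.1⟩, h.2.lt hD⟩,
      fun h => ⟨h.1.1, (hk.2.2 a h.1.1 h.1.2.1).1 h.2⟩⟩
  have hup : ∀ a, a ∈ between t n k j ↔ a ∈ between t n i j ∧ k ≤ a := by
    intro a
    rw [mem_between, mem_between]
    refine ⟨fun h => ⟨⟨hk.1.1.trans h.1, h.2⟩, ?_⟩, fun h => ⟨?_, h.1.2⟩⟩
    · by_cases h' : k = a
      · exact h'.le
      · exact (Prec.lt hD ⟨h.1, h'⟩).le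
    · rcases h.2.lt_or_eq with h' | rfl
      · exact ((hk.2.2 a h.1.1 h.1.2.1).2 h').1
      · exact preceq_refl hk.1.1.2.1
  have hkk : k ∈ between t n i j := mem_between.2 ⟨hk.1.1, hk.2.1⟩
  refine ⟨?_, ?_, ?_⟩
  · ext a
    simp only [Finset.mem_sdiff, Finset.mem_union, Finset.mem_insert, hlow, hup]
    have := hs1 a
    have := hs2 a
    grind
  · ext a
    simp only [Finset.mem_sdiff, Finset.mem_union, Finset.mem_insert]
    have := hs1 a
    have := hs2 a
    grind
  · rw [Finset.disjoint_left]
    intro a ha hb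
    simp only [Finset.mem_sdiff, hlow, hup] at ha hb
    omega

end routes

/-! ### Factorization of `f̌_{ij}` -/

section factor

variable {t : Series} {n : ℕ} {ħ : ℂ}

theorem fPath_append_cons (i k j : ℕ) (L₁ L₂ : List ℕ) :
    fPath t n ħ i (L₁ ++ k :: L₂) j = fPath t n ħ i L₁ k * fPath t n ħ k L₂ j := by
  induction L₁ generalizing i with
  | nil => rfl
  | cons a L ih => rw [List.cons_append, fPath, fPath, ih, mul_assoc]

/-- In a path that avoids `k`, the step across `k` may be replaced with `c` times the product of two
steps through `k`. -/
theorem fPath_append_sub_mem (J : TwoSidedIdeal (Uminus t n ħ)) (c : ℂ) (i k j : ℕ)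
    (L₁ L₂ : List ℕ)
    (h : ∀ l ∈ i :: L₁, ∀ r ∈ L₂ ++ [j],
      fEntry t n ħ l r - c • (fEntry t n ħ l k * fEntry t n ħ k r) ∈ J) :
    fPath t n ħ i (L₁ ++ L₂) j - c • (fPath t n ħ i L₁ k * fPath t n ħ k L₂ j) ∈ J := by
  induction L₁ generalizing i with
  | nil =>
    cases L₂ with
    | nil => exact h i (by simp) j (by simp)
    | cons a L =>
      have := J.mul_mem_right _ (fPath t n ħ a L j) (h i (by simp) a (by simp))
      simpa only [List.nil_append, fPath, sub_mul, smul_mul_assoc, mul_assoc] using this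
  | cons a L ih =>
    have := J.mul_mem_left (fEntry t n ħ i a) _
      (ih a fun l hl r hr => h l (List.mem_cons_of_mem _ hl) r hr)
    simpa only [List.cons_append, fPath, mul_sub, mul_smul_comm, mul_assoc] using this

/-- The extension of a two-sided ideal of `U_q(g_-)` to the scalars `Uh n`. -/
abbrev extIdeal (J : TwoSidedIdeal (Uminus t n ħ)) : Submodule (Uh n) (Uh n ⊗[ℂ] Uminus t n ħ) :=
  Submodule.baseChange (Uh n) ((TwoSidedIdeal.asIdeal J).restrictScalars ℂ)

theorem fcheck_of_ne {b i j : ℕ} (h : i ≠ j) :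
    fcheck t n ħ b i j = ∑ S ∈ routes t n i j,
      (∏ l ∈ between t n i j \ insert i S, Abar t n ħ b l) ⊗ₜ
        fPath t n ħ i (S.sort (· ≤ ·)) j := by
  rw [fcheck, if_neg h]

/-- If `f_{lr} ≡ c f_{lk} f_{kr}` modulo an ideal for all `l ≺ k ≺ r`, then the routes with and
without `k` contribute proportionally to `f̌_{ij}`, which factorizes at `k`. -/
theorem fcheck_factor (hD : t = .D → 3 ≤ n) (J : TwoSidedIdeal (Uminus t n ħ)) (c : ℂ)
    (b : ℕ) {i j k : ℕ} (hk : Separates t n i k j)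
    (h : ∀ l r, Preceq t n i l → Prec t n l k → Prec t n k r → Preceq t n r j →
      fEntry t n ħ l r - c • (fEntry t n ħ l k * fEntry t n ħ k r) ∈ J) :
    fcheck t n ħ b i j -
      (1 + c • Abar t n ħ b k) • (fcheck t n ħ b i k * fcheck t n ħ b k j) ∈ extIdeal J := by
  have hik := hk.1.lt hD
  have hkj := hk.2.1.lt hD
  rw [fcheck_of_ne (hik.trans hkj).ne, fcheck_of_ne hik.ne, fcheck_of_ne hkj.ne,
    sum_routes hD hk, Finset.sum_mul_sum, ← Finset.sum_product', Finset.smul_sum,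
    ← Finset.sum_sub_distrib]
  refine Submodule.sum_mem _ fun p hp => ?_
  obtain ⟨hp1, hp2⟩ := Finset.mem_product.1 hp
  obtain ⟨e1, e2, e3⟩ := between_sdiff hD hk hp1 hp2
  rw [mem_routes hD hik] at hp1
  rw [mem_routes hD hkj] at hp2
  have hs1 : ∀ a ∈ p.1, i < a ∧ a < k := fun a ha => Finset.mem_Ioo.1 (hp1.1 ha)
  have hs2 : ∀ a ∈ p.2, k < a ∧ a < j := fun a ha => Finset.mem_Ioo.1 (hp2.1 ha)
  have f1 : (p.1 ∪ p.2).sort (· ≤ ·) = p.1.sort (· ≤ ·) ++ p.2.sort (· ≤ ·) :=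
    sort_union fun a ha b hb => (hs1 a ha).2.trans (hs2 b hb).1
  have f2 : (p.1 ∪ insert k p.2).sort (· ≤ ·) =
      p.1.sort (· ≤ ·) ++ k :: p.2.sort (· ≤ ·) := by
    rw [sort_union, Finset.sort_insert]
    · exact fun b hb => (hs2 b hb).1.le
    · exact fun hb => lt_irrefl _ (hs2 k hb).1
    · intro a ha b hb
      rcases Finset.mem_insert.1 hb with rfl | hb
      · exact (hs1 a ha).2
      · exact (hs1 a ha).2.trans (hs2 b hb).1
  have hmem := fPath_append_sub_mem J c i k j (p.1.sort (· ≤ ·)) (p.2.sort (· ≤ ·)) (by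
    intro l hl r hr
    refine h l r ?_ ?_ ?_ ?_
    · rcases List.mem_cons.1 hl with rfl | hl
      · exact preceq_refl hk.1.1.1
      · rw [Finset.mem_sort] at hl
        exact (hp1.2 i (by simp) l (by simp [hl]) (hs1 l hl).1).1
    · rcases List.mem_cons.1 hl with rfl | hl
      · exact hk.1
      · rw [Finset.mem_sort] at hl
        exact hp1.2 l (by simp [hl]) k (by simp) (hs1 l hl).2
    · rcases List.mem_append.1 hr with hr | hr
      · rw [Finset.mem_sort] at hr
        exact hp2.2 k (by simp) r (by simp [hr]) (hs2 r hr).1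
      · rw [List.mem_singleton.1 hr]
        exact hk.2.1
    · rcases List.mem_append.1 hr with hr | hr
      · rw [Finset.mem_sort] at hr
        exact (hp2.2 r (by simp [hr]) j (by simp) (hs2 r hr).2).1
      · rw [List.mem_singleton.1 hr]
        exact preceq_refl hk.2.1.1.2.1)
  have hnot : k ∉ between t n i j \ insert i (p.1 ∪ insert k p.2) := by simp
  rw [f1, f2, e2, Finset.prod_insert hnot, e1, Finset.prod_union e3, fPath_append_cons,
    Algebra.TensorProduct.tmul_mul_tmul]
  set C := (∏ l ∈ between t n i k \ insert i p.1, Abar t n ħ b l) *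
    ∏ l ∈ between t n k j \ insert k p.2, Abar t n ħ b l
  set P := fPath t n ħ i (p.1.sort (· ≤ ·)) k * fPath t n ħ k (p.2.sort (· ≤ ·)) j
  have key : C ⊗ₜ[ℂ] P + (Abar t n ħ b k * C) ⊗ₜ[ℂ]
      fPath t n ħ i (p.1.sort (· ≤ ·) ++ p.2.sort (· ≤ ·)) j -
        (1 + c • Abar t n ħ b k) • (C ⊗ₜ[ℂ] P) =
      (Abar t n ħ b k * C) ⊗ₜ[ℂ]
        (fPath t n ħ i (p.1.sort (· ≤ ·) ++ p.2.sort (· ≤ ·)) j - c • P) := by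
    rw [TensorProduct.smul_tmul', smul_eq_mul, add_mul, one_mul, TensorProduct.add_tmul,
      smul_mul_assoc, TensorProduct.smul_tmul, TensorProduct.tmul_sub]
    abel
  rw [key]
  exact Submodule.tmul_mem_baseChange_of_mem _ hmem

theorem mul_mem_extIdeal (J : TwoSidedIdeal (Uminus t n ħ)) (x : Uh n ⊗[ℂ] Uminus t n ħ)
    {z : Uh n ⊗[ℂ] Uminus t n ħ} (hz : z ∈ extIdeal J) : x * z ∈ extIdeal J := by
  rw [extIdeal, Submodule.baseChange_eq_span] at hz
  induction hz using Submodule.span_induction with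
  | mem z hz =>
    obtain ⟨u, hu, rfl⟩ := hz
    induction x using TensorProduct.induction_on with
    | zero => rw [zero_mul]; exact Submodule.zero_mem _
    | tmul a v =>
      rw [TensorProduct.mk_apply, Algebra.TensorProduct.tmul_mul_tmul]
      exact Submodule.tmul_mem_baseChange_of_mem _ (J.mul_mem_left v u hu)
    | add x y hx hy => rw [add_mul]; exact Submodule.add_mem _ hx hy
  | zero => rw [mul_zero]; exact Submodule.zero_mem _
  | add y z _ _ hy hz => rw [mul_add]; exact Submodule.add_mem _ hy hz
  | smul a z _ hz => rw [mul_smul_comm]; exact Submodule.smul_mem _ a hz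

theorem one_add_smul_Abar (hq : ∀ m : ℕ, 0 < m → Complex.exp ħ ^ m ≠ 1) (j k : ℕ) :
    1 + (qpow ħ 1 - qpow ħ (-1)) • Abar t n ħ j k = yy t n ħ j k := by
  rw [Abar, smul_inv_smul₀ (q_sub_ne_zero hq)]
  abel

/-- The set `Σ` leaves out the two incomparable nodes for `so(2n)`. -/
theorem separates_of_mem_SigmaSet (hD : t = .D → 3 ≤ n) {i j k : ℕ} (hij : Prec t n i j)
    (hk : k ∈ SigmaSet t n i j) : Separates t n i k j := by
  obtain ⟨⟨h1, h2⟩, h3⟩ := hk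
  have h4 : t = .D → k ≠ n ∧ k ≠ n + 1 := by
    rintro rfl
    simp only [sRank, flip, dimN] at h3
    have := hD rfl
    omega
  refine ⟨?_, ?_, fun l hl hl' => ⟨fun h => ?_, fun h => ?_⟩⟩ <;>
    simp only [prec_iff hD, preceq_iff hD] at * <;> grind

end factor

/-! ### Non-vanishing of `f̌_{ij}(λ)` -/

section nonvanishing

variable {t : Series} {n : ℕ} {ħ : ℂ}

theorem evalAt_tmul (lam : Fin n → ℂ) (a : Uh n) (u : Uminus t n ħ) :
    evalAt lam (a ⊗ₜ[ℂ] u) = evalChar ħ lam a • u := rfl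

theorem evalAt_mul (lam : Fin n → ℂ) (x y : Uh n ⊗[ℂ] Uminus t n ħ) :
    evalAt lam (x * y) = evalAt lam x * evalAt lam y := by
  induction x using TensorProduct.induction_on with
  | zero => rw [zero_mul, map_zero, zero_mul]
  | tmul a u =>
    induction y using TensorProduct.induction_on with
    | zero => rw [mul_zero, map_zero, mul_zero]
    | tmul b v =>
      rw [Algebra.TensorProduct.tmul_mul_tmul, evalAt_tmul, evalAt_tmul, evalAt_tmul, map_mul,
        smul_mul_smul_comm]
    | add y z hy hz => rw [mul_add, map_add, map_add, hy, hz, mul_add]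
  | add x z hx hz => rw [add_mul, map_add, map_add, hx, hz, add_mul]

theorem evalAt_smul (lam : Fin n → ℂ) (a : Uh n) (x : Uh n ⊗[ℂ] Uminus t n ħ) :
    evalAt lam (a • x) = evalChar ħ lam a • evalAt lam x := by
  induction x using TensorProduct.induction_on with
  | zero => rw [smul_zero, map_zero, smul_zero]
  | tmul b u =>
    rw [TensorProduct.smul_tmul', evalAt_tmul, evalAt_tmul, smul_eq_mul, map_mul, mul_smul]
  | add x z hx hz => rw [smul_add, map_add, map_add, hx, hz, smul_add]

theorem map_evalAt_eq_zero {A : Type*} [Ring A] [Algebra ℂ A] (ψ : Uminus t n ħ →ₐ[ℂ] A)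
    (lam : Fin n → ℂ) {z : Uh n ⊗[ℂ] Uminus t n ħ} (hz : z ∈ extIdeal (TwoSidedIdeal.ker ψ)) :
    ψ (evalAt lam z) = 0 := by
  rw [extIdeal, Submodule.baseChange_eq_span] at hz
  induction hz using Submodule.span_induction with
  | mem z hz =>
    obtain ⟨u, hu, rfl⟩ := hz
    have hu' : ψ u = 0 := (TwoSidedIdeal.mem_ker ψ).1 hu
    rw [TensorProduct.mk_apply, evalAt_tmul, map_one, one_smul, hu']
  | zero => rw [map_zero, map_zero]
  | add y z _ _ hy hz => rw [map_add, map_add, hy, hz, add_zero]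
  | smul a z _ hz => rw [evalAt_smul, map_smul, hz, smul_zero]

/-- For immediate neighbors only the empty route contributes. -/
theorem fcheck_cover (hD : t = .D → 3 ≤ n) (b : ℕ) {i j : ℕ} (h : Cover t n i j) :
    fcheck t n ħ b i j = 1 ⊗ₜ fEntry t n ħ i j := by
  have hij := h.1.lt hD
  have h1 : routes t n i j = {∅} := by
    ext S
    rw [Finset.mem_singleton, mem_routes hD hij]
    constructor
    · intro hS
      rw [Finset.eq_empty_iff_forall_notMem]
      intro a ha
      have := Finset.mem_Ioo.1 (hS.1 ha)
      exact h.2 a ⟨hS.2 i (by simp) a (by simp [ha]) this.1,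
        hS.2 a (by simp [ha]) j (by simp) this.2⟩
    · rintro rfl
      refine ⟨Finset.empty_subset _, fun a ha b hb hab => ?_⟩
      simp only [Finset.mem_insert, Finset.notMem_empty, or_false] at ha hb
      rcases ha with rfl | rfl <;> rcases hb with rfl | rfl
      · omega
      · exact h.1
      · omega
      · omega
  have h2 : between t n i j \ insert i ∅ = ∅ := by
    rw [Finset.sdiff_eq_empty_iff_subset]
    intro l hl
    rw [mem_between] at hl
    by_contra h3
    exact h.2 l ⟨⟨hl.1, fun h4 => h3 (by simp [h4])⟩, hl.2⟩
  rw [fcheck_of_ne hij.ne, h1, Finset.sum_singleton, h2, Finset.prod_empty, Finset.sort_empty,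
    fPath]

/-- If the nodes between `i₀` and `j` form a chain and a representation by shift operators
annihilates all `f_{lr}` except for immediate neighbors, then `f̌_{i j}` acts as the product of the
operators of the neighbors, which does not vanish. -/
theorem evalAt_fcheck_ne_zero_of_rep (hD : t = .D → 3 ≤ n) {u : ℂ} (hu : u ≠ 0)
    (ψ : Uminus t n ħ →ₐ[ℂ] Module.End ℂ (Finset ℕ → ℂ)) (p : ℕ → ℕ) (b : ℕ) {i₀ j : ℕ}
    (hchain : ∀ l r, Preceq t n i₀ l → Preceq t n i₀ r → Preceq t n r j → Preceq t n l j → l < r →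
      Prec t n l r)
    (hzero : ∀ l k r, Preceq t n i₀ l → Prec t n l k → Prec t n k r → Preceq t n r j →
      ψ (fEntry t n ħ l r) = 0)
    (hcover : ∀ l r, Preceq t n i₀ l → Cover t n l r → Preceq t n r j →
      ∃ s : ℂ, s ≠ 0 ∧ ψ (fEntry t n ħ l r) = s • shiftOp u (p l))
    (hp : ∀ l r, Preceq t n i₀ l → Prec t n l r → Prec t n r j → p l ≠ p r)
    (lam : Fin n → ℂ) (hij : Prec t n i₀ j) : evalAt lam (fcheck t n ħ b i₀ j) ≠ 0 := by
  have key : ∀ d i, Preceq t n i₀ i → Prec t n i j → j - i ≤ d → ∀ T : Finset ℕ,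
      (∀ l, Preceq t n i l → Prec t n l j → p l ∈ T) →
      ψ (evalAt lam (fcheck t n ħ b i j)) (fun _ => 1) T ≠ 0 := by
    intro d
    induction d with
    | zero => intro i _ h h'; have := h.lt hD; omega
    | succ d ih =>
      intro i hi hij' hd T hT
      have hiT : p i ∈ T := hT i (preceq_refl hij'.1.1) hij'
      have hw : (if p i + 1 ∈ T then u else 1) ≠ 0 := by
        split_ifs
        · exact hu
        · exact one_ne_zero
      by_cases hex : ∃ k, Prec t n i k ∧ Prec t n k j
      · classical
        -- the immediate successor of `i`
        obtain ⟨k, ⟨hik, hkj⟩, hmin⟩ : ∃ k, (Prec t n i k ∧ Prec t n k j) ∧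
            ∀ m < k, ¬ (Prec t n i m ∧ Prec t n m j) :=
          ⟨Nat.find hex, Nat.find_spec hex, fun m => Nat.find_min hex⟩
        have hcov : Cover t n i k := ⟨hik, fun m hm =>
          hmin m (hm.2.lt hD) ⟨hm.1, hm.2.trans hD hkj⟩⟩
        have hk0 : Preceq t n i₀ k := hi.trans hik.1
        have hsep : Separates t n i k j := ⟨hik, hkj, fun l h1 h2 =>
          ⟨hchain l k (hi.trans h1) hk0 hkj.1 h2, hchain k l hk0 (hi.trans h1) h2 hkj.1⟩⟩
        have h1 := map_evalAt_eq_zero ψ lam (fcheck_factor hD (TwoSidedIdeal.ker ψ) 0 b hsep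
          fun l r h1 h2 h3 h4 => by
            rw [zero_smul, sub_zero, TwoSidedIdeal.mem_ker]
            exact hzero l k r (hi.trans h1) h2 h3 h4)
        rw [zero_smul, add_zero, one_smul, map_sub, map_sub, sub_eq_zero, evalAt_mul, map_mul,
          fcheck_cover hD b hcov, evalAt_tmul, map_one, one_smul] at h1
        obtain ⟨s, hs, h2⟩ := hcover i k hi hcov hkj.1
        rw [h1, h2, smul_mul_assoc, LinearMap.smul_apply, Pi.smul_apply, smul_eq_mul,
          Module.End.mul_apply, shiftOp_apply, if_pos hiT]
        refine mul_ne_zero hs (mul_ne_zero hw (ih k hk0 hkj ?_ _ fun l h3 h4 => ?_))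
        · have := hik.lt hD
          have := hkj.lt hD
          omega
        · have hil : Prec t n i l := by
            by_cases h5 : k = l
            · exact h5 ▸ hik
            · exact hik.trans hD ⟨h3, h5⟩
          exact Finset.mem_erase.2 ⟨(hp i l hi hil h4).symm, hT l hil.1 h4⟩
      · have hcov : Cover t n i j := ⟨hij', fun m hm => hex ⟨m, hm⟩⟩
        obtain ⟨s, hs, h2⟩ := hcover i j hi hcov (preceq_refl hij'.1.2.1)
        rw [fcheck_cover hD b hcov, evalAt_tmul, map_one, one_smul, h2, LinearMap.smul_apply,
          Pi.smul_apply, smul_eq_mul, shiftOp_apply, if_pos hiT, mul_one]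
        exact mul_ne_zero hs hw
  intro h0
  refine key (j - i₀) i₀ (preceq_refl hij.1.1) hij le_rfl
    ((between t n i₀ j).image p) (fun l h1 h2 => Finset.mem_image_of_mem p
      (mem_between.2 ⟨h1, h2⟩)) ?_
  rw [h0, map_zero]
  rfl

theorem chainLow_shift_eq_zero {c : ℂ} (hc : c ≠ 0) {m : ℕ} {y : ℕ → Module.End ℂ (Finset ℕ → ℂ)}
    (hy : ∀ a, 1 ≤ a → a ≤ m → ∃ s : ℂ, s ≠ 0 ∧ y a = s • shiftOp c⁻¹ a) {i j : ℕ} (hi : 1 ≤ i)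
    (hij : i + 2 ≤ j) (hj : j ≤ m + 1) : chainLow c y i (j - i - 1) = 0 := by
  rw [chainLow_factor c c (k := i + 1) (by omega) (by omega) hc, sub_self, zero_smul]
  · obtain ⟨s, -, h1⟩ := hy i hi (by omega)
    obtain ⟨s', -, h2⟩ := hy (i + 1) (by omega) (by omega)
    rw [Nat.add_sub_cancel, h1, h2, smul_mul_smul_comm, smul_mul_smul_comm, shiftOp_skew,
      mul_comm s', smul_comm c, smul_inv_smul₀ hc]
  · intro a b h1 h2 h3
    obtain ⟨s, -, h4⟩ := hy a (by omega) (by omega)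
    obtain ⟨s', -, h5⟩ := hy b (by omega) (by omega)
    rw [h4, h5]
    exact ((shiftOp_commute _ h3).smul_left s).smul_right s'

theorem chainUp_shift_eq_zero {c : ℂ} (hc : c ≠ 0) {m : ℕ} {y : ℕ → Module.End ℂ (Finset ℕ → ℂ)}
    (hy : ∀ a, 1 ≤ a → a ≤ m → ∃ s : ℂ, s ≠ 0 ∧ y a = s • shiftOp c a) {i j : ℕ} (hi : 1 ≤ i)
    (hij : i + 2 ≤ j) (hj : j ≤ m + 1) : chainUp c y i (j - i - 1) = 0 := by
  rw [chainUp_factor c c (k := i + 1) (by omega) (by omega) hc, sub_self, zero_smul]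
  · obtain ⟨s, -, h1⟩ := hy i hi (by omega)
    obtain ⟨s', -, h2⟩ := hy (i + 1) (by omega) (by omega)
    rw [Nat.add_sub_cancel, h1, h2, smul_mul_smul_comm, smul_mul_smul_comm, shiftOp_skew,
      mul_comm s', smul_comm c]
  · intro a b h1 h2 h3
    obtain ⟨s, -, h4⟩ := hy a (by omega) (by omega)
    obtain ⟨s', -, h5⟩ := hy b (by omega) (by omega)
    rw [h4, h5]
    exact ((shiftOp_commute _ h3).smul_left s).smul_right s'

theorem Cover.le_succ (hD : t = .D → 3 ≤ n) {l r : ℕ} (h : Cover t n l r) :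
    r ≤ l + 1 ∨ (t = .D ∧ l + 1 = n ∧ r = n + 1) ∨ (t = .D ∧ l = n ∧ r = n + 2) := by
  obtain ⟨h1, h2⟩ := h
  have h3 := h2 (l + 1)
  have h4 := h2 (l + 2)
  simp only [prec_iff hD] at h1 h3 h4
  grind

/-- Non-vanishing in the left half of the diagram. -/
theorem evalAt_fcheck_ne_zero_low (hq : ∀ m : ℕ, 0 < m → Complex.exp ħ ^ m ≠ 1)
    (hD : t = .D → 3 ≤ n) (b : ℕ) {i j : ℕ} (hij : Prec t n i j) (hj : 2 * j ≤ dimN t n + 1)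
    (lam : Fin n → ℂ) : evalAt lam (fcheck t n ħ b i j) ≠ 0 := by
  have hc0 := qpow_ne_zero ħ (-1)
  obtain ⟨ψ, hψ⟩ := exists_shift_rep_chain (t := t) (n := n) hq hD (qpow ħ (-1))⁻¹
  have hj' : j ≤ n + 1 ∧ (t = .D → j ≤ n) := by
    cases t <;> simp only [dimN] at hj <;> simp <;> omega
  have hy : ∀ a, 1 ≤ a → a ≤ j - 1 →
      ∃ s : ℂ, s ≠ 0 ∧ ψ (chev t n ħ a) = s • shiftOp (qpow ħ (-1))⁻¹ a :=
    fun a h1 h2 => hψ a h1 (by omega) (by grind)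
  have hf : ∀ l r, l < r → r ≤ j → ψ (fEntry t n ħ l r) =
      chainLow (qpow ħ (-1)) (fun a => ψ (chev t n ħ a)) l (r - l - 1) := fun l r h1 h2 => by
    rw [fEntry_low h1 (by omega), map_fLow]
  refine evalAt_fcheck_ne_zero_of_rep hD (inv_ne_zero hc0) ψ id b ?_ ?_ ?_ ?_ lam hij
  · intro l r h1 h2 h3 h4 h5
    simp only [prec_iff hD, preceq_iff hD, NodeLE] at *
    grind
  · intro l k r h1 h2 h3 h4
    have h5 := h2.lt hD
    have h6 := h3.lt hD
    rw [preceq_iff hD, NodeLE] at h1 h4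
    rw [prec_iff hD] at h2
    rw [hf l r (by omega) (by omega)]
    exact chainLow_shift_eq_zero hc0 hy h2.1 (by omega) (by omega)
  · intro l r h1 h2 h3
    have h4 := h2.le_succ hD
    have h5 := (prec_iff hD).1 h2.1
    rw [preceq_iff hD, NodeLE] at h3
    obtain rfl : r = l + 1 := by
      rcases h4 with h4 | ⟨h6, h7, h8⟩ | ⟨h6, h7, h8⟩
      · omega
      · have := hj'.2 h6
        omega
      · have := hj'.2 h6
        omega
    rw [hf _ _ (by omega) (by omega), show l + 1 - l - 1 = 0 by omega]
    exact hy l h5.1 (by omega)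
  · intro l r h1 h2 h3
    exact (h2.lt hD).ne

/-- Non-vanishing in the right half of the diagram. -/
theorem evalAt_fcheck_ne_zero_up (hq : ∀ m : ℕ, 0 < m → Complex.exp ħ ^ m ≠ 1)
    (hD : t = .D → 3 ≤ n) (b : ℕ) {i j : ℕ} (hij : Prec t n i j) (hi : dimN t n + 1 ≤ 2 * i)
    (lam : Fin n → ℂ) : evalAt lam (fcheck t n ħ b i j) ≠ 0 := by
  have hc0 := qpow_ne_zero ħ (-1)
  obtain ⟨ψ, hψ⟩ := exists_shift_rep_chain (t := t) (n := n) hq hD (qpow ħ (-1))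
  have hi' : flip t n i ≤ n + 1 ∧ (t = .D → flip t n i ≤ n) ∧ (t = .D → n < i) := by
    cases t <;> simp only [dimN, flip] at * <;> simp <;> omega
  have hy : ∀ a, 1 ≤ a → a ≤ flip t n i - 1 →
      ∃ s : ℂ, s ≠ 0 ∧ ψ (chev t n ħ a) = s • shiftOp (qpow ħ (-1)) a :=
    fun a h1 h2 => hψ a h1 (by omega) (by grind)
  have hf : ∀ l r, l < r → i ≤ l → r ≤ dimN t n → ψ (fEntry t n ħ l r) =
      chainUp (qpow ħ (-1)) (fun a => ψ (chev t n ħ a)) (flip t n r)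
        (flip t n l - flip t n r - 1) := fun l r h1 h2 h3 => by
    have h4 : flip t n (flip t n l) = l ∧ flip t n (flip t n r) = r := by
      simp only [flip]; omega
    have h5 := fEntry_up (t := t) (n := n) (ħ := ħ) (i := flip t n r) (j := flip t n l)
      (by simp only [flip]; omega) (by simp only [flip]; omega)
    rw [h4.1, h4.2] at h5
    rw [h5, map_fUp]
  refine evalAt_fcheck_ne_zero_of_rep hD hc0 ψ (fun l => flip t n l - 1) b ?_ ?_ ?_ ?_ lam hij
  · intro l r h1 h2 h3 h4 h5
    simp only [prec_iff hD, preceq_iff hD, NodeLE] at *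
    grind
  · intro l k r h1 h2 h3 h4
    have h5 := h2.lt hD
    have h6 := h3.lt hD
    rw [preceq_iff hD, NodeLE] at h1 h4
    rw [prec_iff hD] at h3
    rw [hf l r (by omega) (by omega) (by omega)]
    refine chainUp_shift_eq_zero hc0 hy ?_ ?_ ?_ <;> simp only [flip] at * <;> omega
  · intro l r h1 h2 h3
    have h4 := h2.le_succ hD
    have h5 := (prec_iff hD).1 h2.1
    rw [preceq_iff hD, NodeLE] at h1
    obtain rfl : r = l + 1 := by grind
    have h6 : flip t n l - flip t n (l + 1) - 1 = 0 := by simp only [flip]; omega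
    have h7 : flip t n (l + 1) = flip t n l - 1 := by simp only [flip]; omega
    rw [hf _ _ (by omega) (by omega) (by omega), h6, chainUp, h7]
    exact hy _ (by simp only [flip] at *; omega) (by simp only [flip] at *; omega)
  · intro l r h1 h2 h3
    have h4 := h2.lt hD
    have h5 := h3.lt hD
    have h6 := hij.1.2.1
    simp only [flip]
    omega

/-- Non-vanishing of `f̌_{in'}(λ)` for `so(2n)`. The nodes between `i` and `n'` correspond to the arm
`1, …, n - 2, n` of the Dynkin diagram. -/
theorem evalAt_fcheck_ne_zero_left_D (hq : ∀ m : ℕ, 0 < m → Complex.exp ħ ^ m ≠ 1)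
    (hn : 3 ≤ n) (b : ℕ) {i : ℕ} (hij : Prec .D n i (n + 1))
    (lam : Fin n → ℂ) : evalAt lam (fcheck .D n ħ b i (n + 1)) ≠ 0 := by
  have hD : Series.D = .D → 3 ≤ n := fun _ => hn
  have hc0 := qpow_ne_zero ħ (-1)
  obtain ⟨ψ, hψ⟩ := exists_shift_rep_fork hq hn (qpow ħ (-1))⁻¹
  have hy : ∀ a, 1 ≤ a → a ≤ n - 1 → ∃ s : ℂ, s ≠ 0 ∧
      (fun a => ψ (chev .D n ħ (if a + 1 = n then n else a))) a =
        s • shiftOp (qpow ħ (-1))⁻¹ a :=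
    fun a h1 h2 => hψ a h1 (by omega)
  have hN : flip .D n n = n + 1 := by simp only [flip, dimN]; omega
  have hf : ∀ l r, 1 ≤ l → l < r → r < n → ψ (fEntry .D n ħ l r) = chainLow (qpow ħ (-1))
      (fun a => ψ (chev .D n ħ (if a + 1 = n then n else a))) l (r - l - 1) :=
    fun l r h1 h2 h3 => by
      rw [entryD_low rfl rfl h2 h3.le]
      refine chainLow_congr _ fun a h4 h5 => ?_
      rw [if_neg (by omega)]
  have hf' : ∀ l, l < n → ψ (fEntry .D n ħ l (n + 1)) = chainLow (qpow ħ (-1))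
      (fun a => ψ (chev .D n ħ (if a + 1 = n then n else a))) l (n - l - 1) :=
    fun l h1 => by
      rw [← hN, entryD_left rfl rfl rfl h1]
  refine evalAt_fcheck_ne_zero_of_rep hD (inv_ne_zero hc0) ψ id b ?_ ?_ ?_ ?_ lam hij
  · intro l r h1 h2 h3 h4 h5
    simp only [prec_iff hD, preceq_iff hD, NodeLE] at *
    grind
  · intro l k r h1 h2 h3 h4
    simp only [prec_iff hD, preceq_iff hD, NodeLE] at *
    rcases (show r = n + 1 ∨ r < n by grind) with rfl | h5
    · rw [hf' l (by grind)]
      exact chainLow_shift_eq_zero hc0 hy h2.1 (by grind) (by omega)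
    · rw [hf l r h2.1 (by omega) h5]
      exact chainLow_shift_eq_zero hc0 hy h2.1 (by omega) (by omega)
  · intro l r h1 h2 h3
    have h4 := h2.le_succ hD
    have h5 := (prec_iff hD).1 h2.1
    rw [preceq_iff hD, NodeLE] at h3
    rcases (show r = n + 1 ∨ r < n by grind) with rfl | h6
    · obtain rfl : l = n - 1 := by grind
      rw [hf' _ (by omega), show n - (n - 1) - 1 = 0 by omega]
      exact hy _ (by omega) le_rfl
    · obtain rfl : r = l + 1 := by omega
      rw [hf _ _ h5.1 (by omega) h6, show l + 1 - l - 1 = 0 by omega]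
      exact hy l h5.1 (by omega)
  · intro l r h1 h2 h3
    exact (h2.lt hD).ne

/-- Non-vanishing of `f̌_{nj}(λ)` for `so(2n)`, the mirror image of `evalAt_fcheck_ne_zero_left_D`. -/
theorem evalAt_fcheck_ne_zero_right_D (hq : ∀ m : ℕ, 0 < m → Complex.exp ħ ^ m ≠ 1)
    (hn : 3 ≤ n) (b : ℕ) {j : ℕ} (hij : Prec .D n n j)
    (lam : Fin n → ℂ) : evalAt lam (fcheck .D n ħ b n j) ≠ 0 := by
  have hD : Series.D = .D → 3 ≤ n := fun _ => hn
  have hc0 := qpow_ne_zero ħ (-1)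
  obtain ⟨ψ, hψ⟩ := exists_shift_rep_fork hq hn (qpow ħ (-1))
  have hy : ∀ a, 1 ≤ a → a ≤ n - 1 → ∃ s : ℂ, s ≠ 0 ∧
      (fun a => ψ (chev .D n ħ (if a + 1 = n then n else a))) a =
        s • shiftOp (qpow ħ (-1)) a :=
    fun a h1 h2 => hψ a h1 (by omega)
  have hN : dimN .D n = 2 * n := rfl
  have hf : ∀ l r, n + 1 < l → l < r → r ≤ 2 * n → ψ (fEntry .D n ħ l r) = chainUp (qpow ħ (-1))
      (fun a => ψ (chev .D n ħ (if a + 1 = n then n else a))) (2 * n + 1 - r) (r - l - 1) :=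
    fun l r h1 h2 h3 => by
      have h4 := entryD_up (ψ := ψ) rfl rfl (i := 2 * n + 1 - r) (j := 2 * n + 1 - l)
        (by omega) (by omega)
      rw [show flip .D n (2 * n + 1 - l) = l by simp only [flip, dimN]; omega,
        show flip .D n (2 * n + 1 - r) = r by simp only [flip, dimN]; omega,
        show 2 * n + 1 - l - (2 * n + 1 - r) - 1 = r - l - 1 by omega] at h4
      rw [h4]
      refine chainUp_congr _ fun a h4 h5 => ?_
      rw [if_neg (by omega)]
  have hf' : ∀ r, n + 1 < r → r ≤ 2 * n → ψ (fEntry .D n ħ n r) = chainUp (qpow ħ (-1))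
      (fun a => ψ (chev .D n ħ (if a + 1 = n then n else a))) (2 * n + 1 - r)
        (n - (2 * n + 1 - r) - 1) :=
    fun r h1 h2 => by
      have h4 := entryD_right' (ψ := ψ) rfl rfl rfl (j := 2 * n + 1 - r) (by omega)
      rwa [show flip .D n (2 * n + 1 - r) = r by simp only [flip, dimN]; omega] at h4
  refine evalAt_fcheck_ne_zero_of_rep hD hc0 ψ (fun l => if l = n then n - 1 else 2 * n - l) b
    ?_ ?_ ?_ ?_ lam hij
  · intro l r h1 h2 h3 h4 h5
    simp only [prec_iff hD, preceq_iff hD, NodeLE] at *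
    grind
  · intro l k r h1 h2 h3 h4
    simp only [prec_iff hD, preceq_iff hD, NodeLE] at *
    rcases (show l = n ∨ n + 1 < l by grind) with rfl | h5
    · rw [hf' r (by grind) (by omega)]
      exact chainUp_shift_eq_zero hc0 hy (by omega) (by grind) (by omega)
    · rw [hf l r h5 (by omega) (by omega),
        show r - l - 1 = 2 * n + 1 - l - (2 * n + 1 - r) - 1 by omega]
      exact chainUp_shift_eq_zero hc0 hy (by omega) (by omega) (by omega)
  · intro l r h1 h2 h3
    have h4 := h2.le_succ hD
    have h5 := (prec_iff hD).1 h2.1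
    rw [preceq_iff hD, NodeLE] at h1
    rcases (show l = n ∨ n + 1 < l by grind) with h6 | h6
    · subst h6
      obtain rfl : r = l + 2 := by grind
      rw [hf' _ (by omega) (by omega), show l - (2 * l + 1 - (l + 2)) - 1 = 0 by omega, chainUp,
        show 2 * l + 1 - (l + 2) = l - 1 by omega, if_pos rfl]
      exact hy _ (by omega) le_rfl
    · obtain rfl : r = l + 1 := by
        rcases h4 with h4 | ⟨-, h7, h8⟩ | ⟨-, h7, h8⟩
        · have := h5.2.2.1
          omega
        · omega
        · omega
      have h7 := h5.2.1
      rw [hN] at h7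
      rw [hf _ _ h6 (by omega) h7, show l + 1 - l - 1 = 0 by omega, chainUp,
        show 2 * n + 1 - (l + 1) = 2 * n - l by omega, if_neg (by omega),
        if_neg (show l ≠ n by omega)]
      have h8 := hy (2 * n - l) (by omega) (by omega)
      simpa only [if_neg (show 2 * n - l + 1 ≠ n by omega)] using h8
  · intro l r h1 h2 h3
    simp only [prec_iff hD, preceq_iff hD, NodeLE] at *
    grind

end nonvanishing

/-! ### The congruences modulo `J_k` -/

section congruences

variable {t : Series} {n : ℕ} {ħ : ℂ}

/-- Factorization with `c = 0` gives the coefficient `1`, and with `c = q - q⁻¹` the coefficient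
`1 + (y_k - 1) = y_k`. -/
theorem congrJ_factor (hq : ∀ m : ℕ, 0 < m → Complex.exp ħ ^ m ≠ 1) (hD : t = .D → 3 ≤ n)
    (b : ℕ) {i j k : ℕ} (hij : Prec t n i j) (hk : k ∈ SigmaSet t n i j) :
    CongrJ t n ħ k (fcheck t n ħ b i j) (fcheck t n ħ b i k * fcheck t n ħ b k j) ∧
    CongrJ t n ħ (flip t n k) (fcheck t n ħ b i j)
      (yy t n ħ b k • (fcheck t n ħ b i k * fcheck t n ħ b k j)) := by
  have hsep := separates_of_mem_SigmaSet hD hij hk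
  have hf : ∀ l r, Prec t n l k → Prec t n k r → _ := fun l r h1 h2 =>
    fEntry_factors hq hD hij.1.1.1 hij.1.2.1.2 hk h1.1.1.1 (h1.lt hD) (h2.lt hD) h2.1.2.1.2
  constructor
  · have := fcheck_factor hD (idealJ t n ħ k) 0 b hsep fun l r _ h1 h2 _ => by
      rw [zero_smul, sub_zero]
      exact (hf l r h1 h2).1
    rwa [zero_smul, add_zero, one_smul] at this
  · have := fcheck_factor hD (idealJ t n ħ (flip t n k)) _ b hsep
      fun l r _ h1 h2 _ => (hf l r h1 h2).2
    rwa [one_add_smul_Abar hq] at this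

/-- Factorization at `k` modulo `J_k`, followed by factorization of the second factor at `k'`, which
produces `y_{k'}` since `k` is the flip of `k'`. -/
theorem congrJ_factor_twice (hq : ∀ m : ℕ, 0 < m → Complex.exp ħ ^ m ≠ 1) (hD : t = .D → 3 ≤ n)
    (b : ℕ) {i j k : ℕ} (hij : Prec t n i j) (hk : k ∈ SigmaSet t n i j)
    (hk' : flip t n k ∈ SigmaSet t n i j) (hkk : k < flip t n k) :
    CongrJ t n ħ k (fcheck t n ħ b i j)
      (yy t n ħ b (flip t n k) • (fcheck t n ħ b i k * fcheck t n ħ b k (flip t n k) *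
        fcheck t n ħ b (flip t n k) j)) := by
  have hkj := (separates_of_mem_SigmaSet hD hij hk).2.1
  have h1 := (congrJ_factor hq hD b hij hk).1
  have h2 := (congrJ_factor hq hD b hkj (k := flip t n k) ⟨⟨hkk, hk'.1.2⟩, hk'.2⟩).2
  rw [show flip t n (flip t n k) = k by
    have := hkj.1.1.2
    simp only [flip]; omega] at h2
  have h3 := Submodule.add_mem _ h1 (mul_mem_extIdeal _ (fcheck t n ħ b i k) h2)
  rwa [mul_sub, sub_add_sub_cancel, mul_smul_comm, ← mul_assoc] at h3

end congruences

end QReg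

end

theorem mainTheorem5 (t : QReg.Series) (n : ℕ) (hn : 1 ≤ n) (hD : t = QReg.Series.D → 3 ≤ n)
    (ħ : ℂ) (hq : ∀ m : ℕ, 0 < m → Complex.exp ħ ^ m ≠ 1) :
    (∀ i j : ℕ, QReg.Prec t n i j →
      (∀ k ∈ QReg.SigmaSet t n i j,
        QReg.CongrJ t n ħ k (QReg.fcheck t n ħ j i j)
          (QReg.fcheck t n ħ j i k * QReg.fcheck t n ħ j k j) ∧
        QReg.CongrJ t n ħ (QReg.flip t n k) (QReg.fcheck t n ħ j i j)
          (QReg.yy t n ħ j k • (QReg.fcheck t n ħ j i k * QReg.fcheck t n ħ j k j))) ∧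
      (∀ k : ℕ, k ∈ QReg.SigmaSet t n i j → QReg.flip t n k ∈ QReg.SigmaSet t n i j →
        k < QReg.flip t n k →
        QReg.CongrJ t n ħ k (QReg.fcheck t n ħ j i j)
          (QReg.yy t n ħ j (QReg.flip t n k) •
            (QReg.fcheck t n ħ j i k * QReg.fcheck t n ħ j k (QReg.flip t n k) *
              QReg.fcheck t n ħ j (QReg.flip t n k) j)))) ∧
    (∀ i j : ℕ, QReg.Prec t n i j →
      (j < QReg.flip t n (QReg.sRank t n) ∨ QReg.sRank t n < i) →
      ∀ lam : Fin n → ℂ, QReg.evalAt lam (QReg.fcheck t n ħ j i j) ≠ 0) := by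
  refine ⟨fun i j hij => ⟨fun k hk => QReg.congrJ_factor hq hD j hij hk, fun k hk hk' hkk =>
    QReg.congrJ_factor_twice hq hD j hij hk hk' hkk⟩, fun i j hij h lam => ?_⟩
  by_cases h1 : 2 * j ≤ QReg.dimN t n + 1
  · exact QReg.evalAt_fcheck_ne_zero_low hq hD j hij h1 lam
  by_cases h2 : QReg.dimN t n + 1 ≤ 2 * i
  · exact QReg.evalAt_fcheck_ne_zero_up hq hD j hij h2 lam
  cases t
  · simp only [QReg.flip, QReg.dimN, QReg.sRank] at *
    omega
  · simp only [QReg.flip, QReg.dimN, QReg.sRank] at *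
    omega
  · simp only [QReg.flip, QReg.dimN, QReg.sRank] at h h1 h2
    rcases h with h | h
    · obtain rfl : j = n + 1 := by omega
      exact QReg.evalAt_fcheck_ne_zero_left_D hq (hD rfl) _ hij lam
    · obtain rfl : i = n := by omega
      exact QReg.evalAt_fcheck_ne_zero_right_D hq (hD rfl) _ hij lam
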